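/- **Setting.** Let $\mathcal H$ be a separable complex Hilbert space, $(f\otimes g)v=\langle v,g\rangle f$, and let $\langle A,B\rangle_{S_2}=\sum_i\langle A\chi_i,B\chi_i\rangle$ ($(\chi_i)$ an orthonormal basis) be the Hilbert–Schmidt inner product, with norm $|||\cdot|||_2$. Let $(X_t,Y_t)_{t\in\mathbb Z}$ be a centered weakly stationary process in $L^p(\Omega;\mathcal H\oplus\mathcal H)$ for some $p>4$. Assume that each component $V\in\{X,Y\}$ can be written $V_t=g(\epsilon_t,\epsilon_{t-1},\dots)$ a.s., with $g$ measurable and $(\epsilon_t)_{t\in\mathbb Z}$ i.i.d. in a measurable space, and that $\sum_{j\ge0}\nu_p(V_j)<\infty$. Here $\nu_q(V_t)=\|V_t-\mathbb E[V_t\mid\mathcal G_{t,\{0\}}]\|_{L^q}$, and $\mathcal G_{t,\{0\}}$ is generated by $(\epsilon_j)_{j\le t}$ with $\epsilon_0$ replaced by a copy $\epsilon_0'$ of $\epsilon_0$ that is independent of $(\epsilon_t)_t$. Let $$\mathcal F_V^{(\omega)}=\frac1{2\pi}\sum_{h\in\mathbb Z}\mathbb E(V_h\otimes V_0)e^{-\mathrm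 i\omega h},\qquad M_{\mathcal F}(\omega)=\mathcal F_X^{(\omega)}-\mathcal F_Y^{(\omega)} .$$ **Window.** Let $w:\mathbb R\to\mathbb R$ be even, bounded and continuous except at finitely many points, with $w(x)-1=O(|x|)$ as $x\to0$ (in particular $w(0)=1=\lim_{x\to0}w(x)$), $\kappa=\int w^2<\infty$, $\lim_{b\downarrow0}b\sum_{h\in\mathbb Z}w^2(bh)=\kappa$, and $\sup_{0<b\le1}b\sum_{|h|\ge L/b}w^2(bh)\to0$ as $L\to\infty$. **Bandwidths.** Let $b_1=b_1(T_1)$ (for $X$) and $b_2=b_2(T_2)$ (for $Y$) be functions of the sample sizes. For each pair $(V,b)\in\{(X,b_1),(Y,b_2)\}$ assume that there is a real $\ell\ge1$ with $\sum_{h\in\mathbb Z}|h|^\ell\nu_2(V_h)<\infty$, $b_T\to0$, $b_TT\to\infty$, $b_T^{1+2\ell}T\to0$ as $T\to\infty$, and, if $\ell>2$, in addition $w(x)-1=O(|x|^{\ell/2})$ as $x\to0$. Let $T_1,T_2\to\infty$ along sequences $T_1=T_1(n)$, $T_2=T_2(n)$. Assume that either $(X_t)$ and $(Y_t)$ are independent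 and $b_1T_1/(b_1T_1+b_2T_2)\to\theta$ for some $\theta\in(0,1)$, or $T_1=T_2$ and $b_1\sim b_2$. **Estimators.** Put $\tilde w^{(\omega)}_{b,s,t}=(2\pi)^{-1}w(b(t-s))e^{\mathrm i\omega(t-s)}$. For $\eta\in[0,1]$ let $$\hat{\mathcal F}_X^{(\omega)}(\eta)=\frac1{\lfloor\eta T_1\rfloor}\sum_{s,t=1}^{\lfloor\eta T_1\rfloor}\tilde w^{(\omega)}_{b_1,s,t}\,X_s\otimes X_t,\qquad \mathcal Z^{X,\omega}_{T,\eta}=\frac{\sqrt{b_1}}{\sqrt{T_1}}\sum_{s=1}^{\lfloor\eta T_1\rfloor}\Big(\sum_{t=1}^{\lfloor\eta T_1\rfloor}\tilde w^{(\omega)}_{b_1,s,t}\,X_s\otimes X_t-\mathcal F_X^{(\omega)}\Big),$$ with $\hat{\mathcal F}_X^{(\omega)}(\eta)=0$ if $\lfloor\eta T_1\rfloor=0$, and define $\hat{\mathcal F}_Y^{(\omega)}(\eta)$ and $\mathcal Z^{Y,\omega}_{T,\eta}$ analogously from $Y,b_2,T_2$. For $[a,c]\subseteq[0,\pi]$ let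 $$\hat{\mathcal Z}_{\mathcal F}(\eta)=\int_a^c\Big(|||\eta(\hat{\mathcal F}_X^{(\omega)}(\eta)-\hat{\mathcal F}_Y^{(\omega)}(\eta))|||_2^2-\eta^2|||\mathcal F_X^{(\omega)}-\mathcal F_Y^{(\omega)}|||_2^2\Big)d\omega .$$ **Theorem.** The series defining $\mathcal F_X^{(\omega)}$ and $\mathcal F_Y^{(\omega)}$ converge, these operators are Hilbert–Schmidt, and all integrals over $\omega$ are well defined. As $n\to\infty$, $$\sqrt{b_1T_1+b_2T_2}\,\hat{\mathcal Z}_{\mathcal F}(\eta)=\sqrt{b_1T_1+b_2T_2}\int_a^c\frac{2}{\sqrt{b_1T_1}}\Re\langle\mathcal Z^{X,\omega}_{T,\eta},\eta M_{\mathcal F}(\omega)\rangle_{S_2}d\omega-\sqrt{b_1T_1+b_2T_2}\int_a^c\frac{2}{\sqrt{b_2T_2}}\Re\langle\mathcal Z^{Y,\omega}_{T,\eta},\eta M_{\mathcal F}(\omega)\rangle_{S_2}d\omega+R_n(\eta),$$ where $\sup_{\eta\in[0,1]}|R_n(\eta)|=o_P(1)$. -/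

import Mathlib

open MeasureTheory ProbabilityTheory Filter Topology Asymptotics

open scoped ENNReal

namespace SpectralTest

noncomputable section

/-! ### Hilbert-Schmidt operators -/

section HilbertSchmidt

variable {H : Type*} [NormedAddCommGroup H] [InnerProductSpace ℂ H]
variable {ι : Type*} (e : HilbertBasis ι ℂ H)

/-- `A` has finite Hilbert-Schmidt norm, i.e. `A ∈ S₂(H)`. -/
def IsHilbertSchmidt (A : H →L[ℂ] H) : Prop :=
  Summable fun i => ‖A (e i)‖ ^ 2

/-- The Hilbert-Schmidt norm `⦀A⦀₂ = (∑ᵢ ‖A eᵢ‖²)^{1/2}`. -/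
def hsNorm (A : H →L[ℂ] H) : ℝ :=
  √(∑' i, ‖A (e i)‖ ^ 2)

/-- The Hilbert-Schmidt inner product `⟨A, B⟩_{S₂} = ∑ᵢ ⟨A eᵢ, B eᵢ⟩`, linear in `A` and conjugate
linear in `B` (Mathlib's `inner` is linear in its second argument). -/
def hsInner (A B : H →L[ℂ] H) : ℂ :=
  ∑' i, inner ℂ (B (e i)) (A (e i))

end HilbertSchmidt

/-! ### Second order structure of a pair of functional time series -/

section SecondOrder

variable {Ω : Type*} [MeasurableSpace Ω] (μ : Measure Ω)
variable {H : Type*} [NormedAddCommGroup H] [InnerProductSpace ℂ H]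

/-- The rank one operator `f ⊗ g : v ↦ ⟨v, g⟩ f` (with `⟨·,·⟩` linear in its first argument). -/
def tensor (f g : H) : H →L[ℂ] H :=
  InnerProductSpace.rankOne ℂ f g

/-- The (cross-)covariance operator `E (U_s ⊗ V_t)` of centered processes. -/
def crossCov (U V : ℤ → Ω → H) (s t : ℤ) : H →L[ℂ] H :=
  ∫ x, tensor (U s x) (V t x) ∂μ

/-- The terms `E (V_h ⊗ V_0) e^{-iωh}`, `h ∈ ℤ`, of the Fourier series of the spectral density. -/
def spectralTerm (V : ℤ → Ω → H) (ω : ℝ) (h : ℤ) : H →L[ℂ] H :=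
  Complex.exp (-(Complex.I * ω * h)) • crossCov μ V V h 0

/-- The spectral density operator `(2π)⁻¹ ∑_{h ∈ ℤ} E (V_h ⊗ V_0) e^{-iωh}`. -/
def spectralDensity (V : ℤ → Ω → H) (ω : ℝ) : H →L[ℂ] H :=
  ((2 * Real.pi)⁻¹ : ℂ) • ∑' h : ℤ, spectralTerm μ V ω h

/-- `(X_t, Y_t)_{t ∈ ℤ}` is a centered weakly stationary bivariate process in `L^p`: all four
blocks of `Cov((X,Y)_{t+h}, (X,Y)_t)` depend on the lag `h` only. -/
structure IsCenteredWeaklyStationaryPair [MeasurableSpace H] (X Y : ℤ → Ω → H) (p : ℝ) :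
    Prop where
  measurable_fst : ∀ t, Measurable (X t)
  measurable_snd : ∀ t, Measurable (Y t)
  memLp_fst : ∀ t, MemLp (X t) (ENNReal.ofReal p) μ
  memLp_snd : ∀ t, MemLp (Y t) (ENNReal.ofReal p) μ
  mean_fst : ∀ t, ∫ x, X t x ∂μ = 0
  mean_snd : ∀ t, ∫ x, Y t x ∂μ = 0
  cov_XX : ∀ t h, crossCov μ X X (t + h) t = crossCov μ X X h 0
  cov_XY : ∀ t h, crossCov μ X Y (t + h) t = crossCov μ X Y h 0
  cov_YX : ∀ t h, crossCov μ Y X (t + h) t = crossCov μ Y X h 0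
  cov_YY : ∀ t h, crossCov μ Y Y (t + h) t = crossCov μ Y Y h 0

end SecondOrder

/-! ### Physical dependence -/

section PhysicalDependence

variable {Ω : Type*} [MeasurableSpace Ω] (μ : Measure Ω)
variable {S : Type*} [MeasurableSpace S]
variable {H : Type*} [NormedAddCommGroup H] [InnerProductSpace ℂ H]

/-- The past `(ε_t, ε_{t-1}, ε_{t-2}, …)`. -/
def past (ε : ℤ → Ω → S) (t : ℤ) (x : Ω) : ℕ → S :=
  fun j => ε (t - j) x

/-- The σ-algebra `σ(ε_t, ε_{t-1}, …)` generated by the past. -/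
abbrev pastSigma (ε : ℤ → Ω → S) (t : ℤ) : MeasurableSpace Ω :=
  MeasurableSpace.comap (past ε t) inferInstance

/-- The dependence measure `ν_p(V_t) = ‖V_t - E[V_t | G_{t,{0}}]‖_{L^p}`, where `G_{t,{0}}` is
generated by the innovations up to time `t` with `ε_0` replaced by `ε'`. -/
def nu [CompleteSpace H] (ε : ℤ → Ω → S) (ε' : Ω → S) (V : ℤ → Ω → H) (p : ℝ) (t : ℤ) : ℝ≥0∞ :=
  eLpNorm (V t - μ[V t | pastSigma (Function.update ε 0 ε') t]) (ENNReal.ofReal p) μ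

/-- `V_t = g(ε_t, ε_{t-1}, …)` for an i.i.d. sequence `(ε_t)` and a measurable `g`, `ε'` is a copy
of `ε_0` that is independent of `(ε_t)`, and `∑_{j ≥ 0} ν_p(V_j) < ∞`. -/
structure HasPhysicalDependence [MeasurableSpace H] [CompleteSpace H] (ε : ℤ → Ω → S) (ε' : Ω → S)
    (g : (ℕ → S) → H) (V : ℤ → Ω → H) (p : ℝ) : Prop where
  measurable_innov : ∀ t, Measurable (ε t)
  indep_innov : iIndepFun ε μ
  identDistrib_innov : ∀ t, IdentDistrib (ε t) (ε 0) μ μ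
  measurable_copy : Measurable ε'
  identDistrib_copy : IdentDistrib ε' (ε 0) μ μ
  indep_copy : IndepFun ε' (fun x t => ε t x) μ
  measurable_repr : Measurable g
  eq_repr : ∀ t, ∀ᵐ x ∂μ, V t x = g (past ε t x)
  summable_nu : ∑' j : ℕ, nu μ ε ε' V p j < ∞

end PhysicalDependence

/-! ### Lag windows and bandwidths -/

/-- Lag window functions. Sums of nonnegative terms are taken in `[0, ∞]`. -/
structure IsLagWindow (w : ℝ → ℝ) : Prop where
  even : ∀ x, w (-x) = w x
  bounded : ∃ C, ∀ x, |w x| ≤ C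
  tendsto_one : Tendsto w (𝓝 0) (𝓝 1)
  finite_discontinuities : {x | ¬ ContinuousAt w x}.Finite
  sq_integrable : ∫⁻ x, ENNReal.ofReal (w x ^ 2) < ∞
  tendsto_sum_sq :
    Tendsto (fun b : ℝ => ENNReal.ofReal b * ∑' h : ℤ, ENNReal.ofReal (w (b * h) ^ 2)) (𝓝[>] 0)
      (𝓝 (∫⁻ x, ENNReal.ofReal (w x ^ 2)))
  tendsto_tail :
    Tendsto (fun L : ℝ => ⨆ b ∈ Set.Ioc (0 : ℝ) 1,
        ENNReal.ofReal b * ∑' h : {h : ℤ // L / b ≤ |(h : ℝ)|},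
          ENNReal.ofReal (w (b * (h : ℤ)) ^ 2)) atTop (𝓝 0)
  order_one : (fun x => w x - 1) =O[𝓝 0] fun x => x

/-- Bandwidths `b = b(T)` for a series with dependence measures `ν₂ h = ν₂(V_h)`, at memory index
`ℓ`. For `ℓ ≤ 2` the last field is `IsLagWindow.order_one`. -/
structure IsBandwidth (w : ℝ → ℝ) (ν₂ : ℤ → ℝ≥0∞) (b : ℕ → ℝ) (ℓ : ℝ) : Prop where
  one_le : 1 ≤ ℓ
  summable_nu : ∑' h : ℤ, ENNReal.ofReal (|(h : ℝ)| ^ ℓ) * ν₂ h < ∞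
  tendsto_zero : Tendsto b atTop (𝓝 0)
  tendsto_mul : Tendsto (fun T : ℕ => b T * T) atTop atTop
  tendsto_bias : Tendsto (fun T : ℕ => b T ^ (1 + 2 * ℓ) * T) atTop (𝓝 0)
  window_order : (fun x => w x - 1) =O[𝓝 0] fun x => |x| ^ max 1 (ℓ / 2)

/-! ### Sequential lag window estimators -/

section Estimators

variable {Ω : Type*} [MeasurableSpace Ω] (μ : Measure Ω)
variable {H : Type*} [NormedAddCommGroup H] [InnerProductSpace ℂ H]
variable {ι : Type*} (e : HilbertBasis ι ℂ H)
variable (w : ℝ → ℝ)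

/-- The weights `(2π)⁻¹ w(b(t-s)) e^{iω(t-s)}`. -/
def lagWeight (b ω : ℝ) (s t : ℕ) : ℂ :=
  ((2 * Real.pi)⁻¹ : ℂ) * (w (b * ((t : ℝ) - s)) : ℂ) *
    Complex.exp (Complex.I * ω * ((t : ℂ) - s))

/-- The sequential estimator
`⌊ηT⌋⁻¹ ∑_{s=1}^{⌊ηT⌋} ∑_{t=1}^{⌊ηT⌋} w̃_{b,s,t}^{(ω)} V_s ⊗ V_t`; it is `0` if `⌊ηT⌋ = 0`. -/
def seqEstimator (V : ℤ → Ω → H) (b : ℝ) (T : ℕ) (η ω : ℝ) (x : Ω) : H →L[ℂ] H :=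
  ((⌊η * T⌋₊ : ℂ)⁻¹) • ∑ s ∈ Finset.Icc 1 ⌊η * T⌋₊, ∑ t ∈ Finset.Icc 1 ⌊η * T⌋₊,
    lagWeight w b ω s t • tensor (V s x) (V t x)

/-- The partial sum process
`(√b/√T) ∑_{s=1}^{⌊ηT⌋} (∑_{t=1}^{⌊ηT⌋} w̃_{b,s,t}^{(ω)} V_s ⊗ V_t - F_V^{(ω)})`. -/
def partialSum (V : ℤ → Ω → H) (b : ℝ) (T : ℕ) (η ω : ℝ) (x : Ω) : H →L[ℂ] H :=
  ((√b / √T : ℝ) : ℂ) • ∑ s ∈ Finset.Icc 1 ⌊η * T⌋₊,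
    ((∑ t ∈ Finset.Icc 1 ⌊η * T⌋₊, lagWeight w b ω s t • tensor (V s x) (V t x)) -
      spectralDensity μ V ω)

/-- The population difference `M(ω) = F_X^{(ω)} - F_Y^{(ω)}`. -/
def popDiff (X Y : ℤ → Ω → H) (ω : ℝ) : H →L[ℂ] H :=
  spectralDensity μ X ω - spectralDensity μ Y ω

/-- The empirical difference `η (F̂_X^{(ω)}(η) - F̂_Y^{(ω)}(η))`. -/
def empDiff (X Y : ℤ → Ω → H) (b₁ b₂ : ℝ) (T₁ T₂ : ℕ) (η ω : ℝ) (x : Ω) : H →L[ℂ] H :=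
  (η : ℂ) • (seqEstimator w X b₁ T₁ η ω x - seqEstimator w Y b₂ T₂ η ω x)

/-- The integrand `⦀η (F̂_X(η) - F̂_Y(η))⦀₂² - η² ⦀F_X - F_Y⦀₂²` at frequency `ω`. -/
def distIntegrand (X Y : ℤ → Ω → H) (b₁ b₂ : ℝ) (T₁ T₂ : ℕ) (η : ℝ) (x : Ω) (ω : ℝ) : ℝ :=
  hsNorm e (empDiff w X Y b₁ b₂ T₁ T₂ η ω x) ^ 2 - η ^ 2 * hsNorm e (popDiff μ X Y ω) ^ 2

/-- The centered sequential squared distance over the frequency band `[a, c]`. -/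
def centeredDist (a c : ℝ) (X Y : ℤ → Ω → H) (b₁ b₂ : ℝ) (T₁ T₂ : ℕ) (η : ℝ) (x : Ω) : ℝ :=
  ∫ ω in a..c, distIntegrand μ e w X Y b₁ b₂ T₁ T₂ η x ω

/-- The integrand `(2/√(bT)) Re ⟨Z_{T,η}^{V,ω}, η M(ω)⟩_{S₂}`, where `M` is the difference of the
spectral density operators of `X` and `Y`. -/
def linIntegrand (X Y V : ℤ → Ω → H) (b : ℝ) (T : ℕ) (η : ℝ) (x : Ω) (ω : ℝ) : ℝ :=
  2 / √(b * T) *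
    (hsInner e (partialSum μ w V b T η ω x) ((η : ℂ) • popDiff μ X Y ω)).re

/-- The difference between `√(b₁T₁ + b₂T₂)` times the centered distance and its linear part. -/
def remainder (a c : ℝ) (X Y : ℤ → Ω → H) (b₁ b₂ : ℝ) (T₁ T₂ : ℕ) (η : ℝ) (x : Ω) : ℝ :=
  √(b₁ * T₁ + b₂ * T₂) * centeredDist μ e w a c X Y b₁ b₂ T₁ T₂ η x -
    (√(b₁ * T₁ + b₂ * T₂) * (∫ ω in a..c, linIntegrand μ e w X Y X b₁ T₁ η x ω) -
      √(b₁ * T₁ + b₂ * T₂) * (∫ ω in a..c, linIntegrand μ e w X Y Y b₂ T₂ η x ω))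

end Estimators

/-- `sup_{η ∈ [0,1]} |R n η| = o_P(1)` as `n → ∞` (in outer probability). -/
def UniformlyLittleOP {Ω : Type*} [MeasurableSpace Ω] (μ : Measure Ω) (R : ℕ → ℝ → Ω → ℝ) : Prop :=
  ∀ δ : ℝ, 0 < δ →
    Tendsto (fun n => μ {x | ∃ η ∈ Set.Icc (0 : ℝ) 1, δ < |R n η x|}) atTop (𝓝 0)

end

end SpectralTest

/-! For one series put N = ⌊ηT⌋ and Q_n = ∑_{s,t≤n} w̃ V_s ⊗ V_t − n F_V. For N ≥ 1 the error of the
scaled estimator is η(F̂_V(η) − F_V) = (η/N) Q_N, while the linear part of the expansion contains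
Q_N/T. With M = F_X − F_Y and Δ the difference of the two errors, ‖ηM + Δ‖² − η²‖M‖² = 2 Re⟨ηM, Δ⟩ +
‖Δ‖². Since η/N = O(1/T) and η|η/N − 1/T| = O(1/T²), the remainder at each frequency is at most the
sum over the two series of a constant times T⁻²(1 + max_{n≤T} ‖Q_n‖²), for all η at once
(`norm_sq_sub_linear_le`, `sequential_error_le`, `enorm_remainder_le`). By `exists_balance_le` the
factor √(b₁T₁ + b₂T₂) is comparable to each √(bT), so by Markov's inequality it suffices that
√(bT)/T² times the frequency integral of 1 + E max ‖Q_n‖² tends to 0.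

The required bound is E max_{n≤T} ‖Q_n‖² ≤ D (T ∑_h w²(bh) + (T b^β)² + 1) with β = max(1, ℓ/2), see
`IsCausal.exists_lintegral_max_quadDev_le`. As b ∑_h w²(bh) converges, the first term contributes
O(1/√(bT)); the second contributes √(b^{1+4β} T) ≤ √(b^{1+2ℓ} T); see `IsBandwidth.tendsto_rate`.

For the random part, the innovations are revealed one at a time, backwards from the latest.
Smoothness of powers of a Hilbert norm makes squared L^q norms of martingale differences add up, so
‖f − Ef‖_q² ≤ 560 ∑_k ‖f − f_k‖_q² for any f_k free of ε_k (`eLpNorm_sub_integral_sq_le`). Applied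
to linear forms and then to quadratic forms, it bounds the squared L^{p/2} norm of the centered
increment from m to n by a multiple of (n − m) ∑_h w²(bh). Because p/2 > 2, dyadic chaining turns
this into a bound for the maximum of the same order (`lintegral_max_sq_le`).

For the bias, orthogonality of martingale increments gives ‖Cov(V_k, V_0)‖ ≤ 4 ∑_j ν(k − j) ν(−j),
hence ∑_k |k|^ℓ ‖Cov(V_k, V_0)‖ < ∞, also in Hilbert-Schmidt norm.

Hilbert-Schmidt operators are represented by the ℓ² family of their values on the basis. This is a
Hilbert space, where the moment inequality applies, and `hsOperator` carries its norm and inner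
product to `hsNorm` and `hsInner`. -/

namespace SpectralTest

/-! ### Second order expansion of powers of a Hilbert norm. -/

section Smoothness

/-- The power is a weighted geometric mean of 1 + u and (1 + u)³, and the corresponding arithmetic
mean has linear coefficient exactly r. The cubic remainder is absorbed by u ≤ 3. The range r ≤ 3 is
the origin of the restriction q ≤ 6 below. -/
lemma one_add_rpow_le {r u : ℝ} (hr1 : 1 ≤ r) (hr3 : r ≤ 3) (hu : -1 ≤ u) (hu3 : u ≤ 3) :
    (1 + u) ^ r ≤ 1 + r * u + 6 * u ^ 2 := by
  have h0 : 0 ≤ 1 + u := by linarith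
  have key := Real.geom_mean_le_arith_mean2_weighted (w₁ := (3 - r) / 2) (w₂ := (r - 1) / 2)
    (p₁ := 1 + u) (p₂ := (1 + u) ^ 3) (by linarith) (by linarith) h0 (by positivity) (by ring)
  have e : (1 + u) ^ ((3 - r) / 2) * ((1 + u) ^ 3) ^ ((r - 1) / 2) = (1 + u) ^ r := by
    rw [← Real.rpow_natCast, ← Real.rpow_mul h0, ← Real.rpow_add' h0]
    · congr 1; push_cast; ring
    · push_cast; intro h; linarith
  rw [e] at key
  refine key.trans ?_
  nlinarith [mul_nonneg (sub_nonneg.2 hr1) (sq_nonneg u), mul_nonneg (sub_nonneg.2 hr3) (sq_nonneg u),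
    mul_nonneg (mul_nonneg (sub_nonneg.2 hr1) (sq_nonneg u)) (sub_nonneg.2 hu3)]

variable {K : Type*} [NormedAddCommGroup K] [InnerProductSpace ℝ K]

/-- If ‖d‖ ≤ ‖x‖, write ‖x + d‖² = ‖x‖²(1 + u) and use the scalar bound with r = q/2. Otherwise
every term is dominated by ‖d‖^q, and 70 = 2⁶ + 6 covers both the left side and the inner product
term. -/
lemma norm_add_rpow_le {q : ℝ} (hq2 : 2 < q) (hq6 : q ≤ 6) (x d : K) :
    ‖x + d‖ ^ q ≤ ‖x‖ ^ q + q * (‖x‖ ^ (q - 2) * inner ℝ x d) +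
      70 * (‖x‖ ^ (q - 2) * ‖d‖ ^ 2 + ‖d‖ ^ q) := by
  have hq0 : 0 < q := by linarith
  have hin : |inner ℝ x d| ≤ ‖x‖ * ‖d‖ := abs_real_inner_le_norm x d
  have hx0 := norm_nonneg x
  have hd0 := norm_nonneg d
  have split : ∀ z : ℝ, 0 ≤ z → z ^ q = z ^ (q - 2) * z ^ 2 := fun z hz => by
    rw [← Real.rpow_natCast z 2, ← Real.rpow_add' hz (by push_cast; linarith)]
    congr 1; push_cast; ring
  rcases le_or_gt ‖d‖ ‖x‖ with h | h
  · rcases hx0.eq_or_lt with hx | hx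
    · have hd : d = 0 := by rw [← norm_eq_zero]; linarith
      have hx : x = 0 := norm_eq_zero.1 hx.symm
      simp [hd, hx, hq0.ne']
    set u : ℝ := (2 * inner ℝ x d + ‖d‖ ^ 2) / ‖x‖ ^ 2 with hu
    have hx2 : 0 < ‖x‖ ^ 2 := by positivity
    have hsq : ‖x + d‖ ^ 2 = ‖x‖ ^ 2 * (1 + u) := by
      rw [norm_add_sq_real, hu]; field_simp; ring
    have hxu : ‖x‖ ^ 2 * u = 2 * inner ℝ x d + ‖d‖ ^ 2 := by rw [hu]; field_simp
    have hdd : ‖d‖ ^ 2 ≤ ‖x‖ * ‖d‖ := by nlinarith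
    have hdx : ‖x‖ * ‖d‖ ≤ ‖x‖ ^ 2 := by nlinarith
    have hu1 : -1 ≤ u := by nlinarith [sq_nonneg ‖x + d‖]
    obtain ⟨hin1, hin2⟩ := abs_le.1 hin
    have hu3 : u ≤ 3 := by rw [hu, div_le_iff₀ hx2]; nlinarith
    have hu2 : ‖x‖ ^ 2 * u ^ 2 ≤ 9 * ‖d‖ ^ 2 := by
      have h1 : |‖x‖ ^ 2 * u| ≤ 3 * (‖x‖ * ‖d‖) := by
        rw [hxu, abs_le]; constructor <;> linarith [sq_nonneg ‖d‖, mul_nonneg hx0 hd0]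
      have h2 : (‖x‖ ^ 2 * u) ^ 2 ≤ (3 * (‖x‖ * ‖d‖)) ^ 2 := sq_le_sq' (by linarith [(abs_le.1 h1).1]) (abs_le.1 h1).2
      have h3 : ‖x‖ ^ 2 * (‖x‖ ^ 2 * u ^ 2) ≤ ‖x‖ ^ 2 * (9 * ‖d‖ ^ 2) := by nlinarith
      exact le_of_mul_le_mul_left h3 hx2
    have hr := one_add_rpow_le (r := q / 2) (u := u) (by linarith) (by linarith) hu1 hu3
    have e1 : ‖x + d‖ ^ q = ‖x‖ ^ q * (1 + u) ^ (q / 2) := by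
      have : ∀ z : ℝ, 0 ≤ z → z ^ q = (z ^ 2) ^ (q / 2) := fun z hz => by
        rw [← Real.rpow_natCast, ← Real.rpow_mul hz]; congr 1; push_cast; ring
      rw [this _ (norm_nonneg _), hsq, Real.mul_rpow hx2.le (by linarith), ← this _ hx0]
    have hP : 0 ≤ ‖x‖ ^ (q - 2) := by positivity
    calc ‖x + d‖ ^ q ≤ ‖x‖ ^ q * (1 + q / 2 * u + 6 * u ^ 2) := by
          rw [e1]; gcongr
      _ = ‖x‖ ^ q + ‖x‖ ^ (q - 2) * (q / 2 * (‖x‖ ^ 2 * u) + 6 * (‖x‖ ^ 2 * u ^ 2)) := by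
          rw [split _ hx0]; ring
      _ ≤ ‖x‖ ^ q + ‖x‖ ^ (q - 2) * (q * inner ℝ x d + 70 * ‖d‖ ^ 2) := by
          refine add_le_add le_rfl (mul_le_mul_of_nonneg_left ?_ hP)
          rw [hxu]; nlinarith [sq_nonneg ‖d‖]
      _ ≤ _ := by nlinarith [Real.rpow_nonneg hd0 q]
  · have hd : 0 < ‖d‖ := hx0.trans_lt h
    have h1 : ‖x + d‖ ^ q ≤ 64 * ‖d‖ ^ q := by
      calc ‖x + d‖ ^ q ≤ (2 * ‖d‖) ^ q := by
            gcongr; linarith [norm_add_le x d]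
        _ = 2 ^ q * ‖d‖ ^ q := Real.mul_rpow (by norm_num) hd0
        _ ≤ 2 ^ (6 : ℝ) * ‖d‖ ^ q := by gcongr; norm_num
        _ = _ := by norm_num
    have h2 : -(‖d‖ ^ q) ≤ ‖x‖ ^ (q - 2) * inner ℝ x d := by
      have : |‖x‖ ^ (q - 2) * inner ℝ x d| ≤ ‖d‖ ^ q := by
        rw [abs_mul, abs_of_nonneg (by positivity), split _ hd0]
        have : ‖x‖ ^ (q - 2) ≤ ‖d‖ ^ (q - 2) := by gcongr
        gcongr
        nlinarith
      linarith [(abs_le.1 this).1]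
    have h3 : 0 ≤ ‖x‖ ^ q := by positivity
    have h4 : 0 ≤ ‖x‖ ^ (q - 2) * ‖d‖ ^ 2 := by positivity
    have h5 : 0 ≤ ‖d‖ ^ q := by positivity
    nlinarith

/-- Converts an additive bound for q-th moments into one for squared L^q norms, with r = q/2. Split
the right side as (a + 2Cd)^{r−1} times (a + Cd + Cd) and bound the power below by a^{r−1} on the
first two summands and by d^{r−1} on the last. -/
lemma rpow_add_smooth_le {r C a d : ℝ} (hr : 1 < r) (hC : 1 ≤ C) (ha : 0 ≤ a) (hd : 0 ≤ d) :
    a ^ r + C * (a ^ (r - 1) * d + d ^ r) ≤ (a + 2 * C * d) ^ r := by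
  have split : ∀ z : ℝ, 0 ≤ z → z ^ r = z ^ (r - 1) * z := fun z hz => by
    conv_rhs => rw [← Real.rpow_one z]
    rw [← Real.rpow_mul hz, one_mul, ← Real.rpow_add' hz (by linarith)]
    congr 1; ring
  have hB : d ≤ 2 * C * d := by nlinarith
  have h1 : a ^ (r - 1) ≤ (a + 2 * C * d) ^ (r - 1) := by gcongr; nlinarith
  have h2 : d ^ (r - 1) ≤ (a + 2 * C * d) ^ (r - 1) := by gcongr; nlinarith
  rw [split a ha, split d hd, split (a + _) (by nlinarith)]
  have h3 : 0 ≤ C * d := by nlinarith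
  nlinarith [mul_le_mul_of_nonneg_right h1 ha, mul_le_mul_of_nonneg_right h1 h3,
    mul_le_mul_of_nonneg_right h2 h3]

end Smoothness

/-! ### One martingale step in L^q. -/

section MartingaleMoments

variable {Ω : Type*} {m m0 : MeasurableSpace Ω} {μ : Measure Ω} [IsProbabilityMeasure μ]
variable {K : Type*} [NormedAddCommGroup K] [InnerProductSpace ℝ K] [CompleteSpace K]

/-- The first order term integrates to zero because S is known given m and D has conditional mean
zero. The second order term is handled by Hölder's inequality with exponents q/(q − 2) and q/2. -/
lemma integral_norm_add_rpow_le {q : ℝ} (hq2 : 2 < q) (hq6 : q ≤ 6) {S D : Ω → K}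
    (hS : MemLp S (ENNReal.ofReal q) μ) (hSm : AEStronglyMeasurable[m] S μ)
    (hD : MemLp D (ENNReal.ofReal q) μ) (hm : m ≤ m0) (hD0 : μ[D | m] =ᵐ[μ] 0) :
    ∫ x, ‖S x + D x‖ ^ q ∂μ ≤ ∫ x, ‖S x‖ ^ q ∂μ +
      70 * ((∫ x, ‖S x‖ ^ q ∂μ) ^ ((q - 2) / q) * (∫ x, ‖D x‖ ^ q ∂μ) ^ (2 / q) +
        ∫ x, ‖D x‖ ^ q ∂μ) := by
  have hq0 : 0 < q := by linarith
  have hq0' : ENNReal.ofReal q ≠ 0 := by simpa using hq0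
  have hqr : (ENNReal.ofReal q).toReal = q := ENNReal.toReal_ofReal hq0.le
  have int : ∀ {f : Ω → K}, MemLp f (ENNReal.ofReal q) μ → Integrable (fun x => ‖f x‖ ^ q) μ := by
    intro f hf
    have := hf.integrable_norm_rpow hq0' ENNReal.ofReal_ne_top
    rwa [hqr] at this
  have h1 : MemLp (fun x => ‖S x‖ ^ (q - 2)) (ENNReal.ofReal (q / (q - 2))) μ := by
    have := hS.norm_rpow_div (ENNReal.ofReal (q - 2))
    rwa [ENNReal.toReal_ofReal (by linarith), ← ENNReal.ofReal_div_of_pos (by linarith)] at this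
  have h2 : MemLp (fun x => ‖D x‖ ^ (2 : ℝ)) (ENNReal.ofReal (q / 2)) μ := by
    have := hD.norm_rpow_div (ENNReal.ofReal 2)
    rwa [ENNReal.toReal_ofReal (by norm_num), ← ENNReal.ofReal_div_of_pos (by norm_num)] at this
  have hconj : (q / (q - 2)).HolderConjugate (q / 2) := by
    rw [Real.holderConjugate_iff]
    refine ⟨by rw [lt_div_iff₀] <;> linarith, ?_⟩
    field_simp; ring
  have hol := integral_mul_le_Lp_mul_Lq_of_nonneg hconj
    (ae_of_all μ fun x => Real.rpow_nonneg (norm_nonneg (S x)) (q - 2))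
    (ae_of_all μ fun x => Real.rpow_nonneg (norm_nonneg (D x)) 2) h1 h2
  have e1 : ∀ x, (‖S x‖ ^ (q - 2)) ^ (q / (q - 2)) = ‖S x‖ ^ q := fun x => by
    rw [← Real.rpow_mul (norm_nonneg _)]; congr 1; field_simp [show q - 2 ≠ 0 by linarith]
  have e2 : ∀ x, (‖D x‖ ^ (2 : ℝ)) ^ (q / 2) = ‖D x‖ ^ q := fun x => by
    rw [← Real.rpow_mul (norm_nonneg _)]; congr 1; field_simp
  simp only [e1, e2, one_div_div] at hol
  have intSD : Integrable (fun x => ‖S x‖ ^ (q - 2) * ‖D x‖ ^ (2 : ℝ)) μ := by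
    have : ENNReal.HolderTriple (ENNReal.ofReal (q / (q - 2))) (ENNReal.ofReal (q / 2)) 1 :=
      ⟨by rw [← ENNReal.ofReal_inv_of_pos (by have := hconj.pos; linarith),
          ← ENNReal.ofReal_inv_of_pos (by linarith), ← ENNReal.ofReal_add (by have := hconj.pos; positivity)
          (by positivity), hconj.inv_add_inv_eq_one]; simp⟩
    exact memLp_one_iff_integrable.1 (h2.mul h1)
  have hm1 : AEStronglyMeasurable[m] (fun x => ‖S x‖ ^ (q - 2) • S x) μ := by
    have hc : Continuous fun z : K => ‖z‖ ^ (q - 2) :=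
      continuous_norm.rpow_const fun _ => Or.inr (by linarith)
    exact AEStronglyMeasurable.smul (hc.comp_aestronglyMeasurable hSm) hSm
  have intin : Integrable (fun x => inner ℝ (‖S x‖ ^ (q - 2) • S x) (D x)) μ := by
    refine ((int hS).add (int hD)).mono' ((hm1.mono hm).inner hD.1) (ae_of_all _ fun x => ?_)
    refine (norm_inner_le_norm _ _).trans ?_
    rw [norm_smul, Real.norm_of_nonneg (by positivity)]
    set a := ‖S x‖
    set d := ‖D x‖
    have ha : 0 ≤ a := norm_nonneg _
    have hd : 0 ≤ d := norm_nonneg _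
    have key : ∀ z : ℝ, 0 ≤ z → z ^ (q - 2) * z * z = z ^ q := fun z hz => by
      have : z ^ q = z ^ (q - 2) * z ^ (2 : ℕ) := by
        rw [← Real.rpow_natCast z 2, ← Real.rpow_add' hz (by push_cast; linarith)]
        congr 1; push_cast; ring
      rw [this]; ring
    show a ^ (q - 2) * a * d ≤ a ^ q + d ^ q
    rcases le_total a d with h | h
    · have : a ^ (q - 2) * a * d ≤ d ^ (q - 2) * d * d := by gcongr
      rw [key d hd] at this
      have := Real.rpow_nonneg ha q
      linarith
    · have : a ^ (q - 2) * a * d ≤ a ^ (q - 2) * a * a := by gcongr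
      rw [key a ha] at this
      have := Real.rpow_nonneg hd q
      linarith
  have hDint : Integrable D μ := hD.integrable (by
    rw [← ENNReal.ofReal_one]; exact ENNReal.ofReal_le_ofReal (by linarith))
  have hzero : ∫ x, inner ℝ (‖S x‖ ^ (q - 2) • S x) (D x) ∂μ = 0 := by
    have := condExp_bilin_of_aestronglyMeasurable_left (innerSL ℝ) hm1 intin hDint
    rw [← integral_condExp hm]
    refine integral_eq_zero_of_ae ?_
    filter_upwards [this, hD0] with x hx hx0
    exact hx.trans (by simp [hx0])
  calc ∫ x, ‖S x + D x‖ ^ q ∂μ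
      ≤ ∫ x, (‖S x‖ ^ q + q * inner ℝ (‖S x‖ ^ (q - 2) • S x) (D x) +
        70 * (‖S x‖ ^ (q - 2) * ‖D x‖ ^ (2 : ℝ) + ‖D x‖ ^ q)) ∂μ := by
        refine integral_mono (int (hS.add hD))
          (((int hS).add (intin.const_mul q)).add ((intSD.add (int hD)).const_mul 70)) fun x => ?_
        have := norm_add_rpow_le hq2 hq6 (S x) (D x)
        simpa only [inner_smul_left, conj_trivial, Real.rpow_ofNat] using this
    _ = ∫ x, ‖S x‖ ^ q ∂μ + 70 * (∫ x, ‖S x‖ ^ (q - 2) * ‖D x‖ ^ (2 : ℝ) ∂μ +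
          ∫ x, ‖D x‖ ^ q ∂μ) := by
        rw [integral_add (by exact (int hS).add (intin.const_mul q))
            (by exact (intSD.add (int hD)).const_mul 70), integral_add (int hS) (intin.const_mul q), integral_const_mul, integral_const_mul,
          integral_add intSD (int hD), hzero]
        ring
    _ ≤ _ := by gcongr

/-- The coefficient of the norm of S is exactly 1, so the estimate can be iterated along a
martingale without losing constants. The factor 140 is 2 · 70. -/
theorem eLpNorm_add_sq_le {q : ℝ} (hq2 : 2 < q) (hq6 : q ≤ 6) {S D : Ω → K}
    (hS : MemLp S (ENNReal.ofReal q) μ) (hSm : AEStronglyMeasurable[m] S μ)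
    (hD : MemLp D (ENNReal.ofReal q) μ) (hm : m ≤ m0) (hD0 : μ[D | m] =ᵐ[μ] 0) :
    eLpNorm (S + D) (ENNReal.ofReal q) μ ^ 2 ≤
      eLpNorm S (ENNReal.ofReal q) μ ^ 2 + 140 * eLpNorm D (ENNReal.ofReal q) μ ^ 2 := by
  have hq0 : 0 < q := by linarith
  have hq0' : ENNReal.ofReal q ≠ 0 := by simpa using hq0
  have hqr : (ENNReal.ofReal q).toReal = q := ENNReal.toReal_ofReal hq0.le
  have nn : ∀ f : Ω → K, 0 ≤ ∫ x, ‖f x‖ ^ q ∂μ := fun f =>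
    integral_nonneg fun x => by positivity
  have nrm : ∀ {f : Ω → K}, MemLp f (ENNReal.ofReal q) μ →
      eLpNorm f (ENNReal.ofReal q) μ ^ 2 = ENNReal.ofReal ((∫ x, ‖f x‖ ^ q ∂μ) ^ (2 / q)) := by
    intro f hf
    rw [hf.eLpNorm_eq_integral_rpow_norm hq0' ENNReal.ofReal_ne_top, hqr,
      ← ENNReal.ofReal_pow (Real.rpow_nonneg (nn f) _), ← Real.rpow_natCast,
      ← Real.rpow_mul (nn f)]
    congr 2; push_cast; field_simp
  rw [nrm (hS.add hD), nrm hS, nrm hD,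
    show (140 : ℝ≥0∞) = ENNReal.ofReal 140 by norm_num, ← ENNReal.ofReal_mul (by norm_num),
    ← ENNReal.ofReal_add (Real.rpow_nonneg (nn S) _)
      (mul_nonneg (by norm_num) (Real.rpow_nonneg (nn D) _))]
  refine ENNReal.ofReal_le_ofReal ?_
  have main := integral_norm_add_rpow_le hq2 hq6 hS hSm hD hm hD0
  have sm := rpow_add_smooth_le (r := q / 2) (C := 70) (a := (∫ x, ‖S x‖ ^ q ∂μ) ^ (2 / q))
    (d := (∫ x, ‖D x‖ ^ q ∂μ) ^ (2 / q)) (by linarith) (by norm_num)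
    (Real.rpow_nonneg (nn S) _) (Real.rpow_nonneg (nn D) _)
  rw [← Real.rpow_mul (nn S), ← Real.rpow_mul (nn S), ← Real.rpow_mul (nn D),
    show 2 / q * (q / 2) = 1 by field_simp, Real.rpow_one, Real.rpow_one,
    show 2 / q * (q / 2 - 1) = (q - 2) / q by field_simp] at sm
  have tot := main.trans sm
  have h0 : 0 ≤ (∫ x, ‖S x‖ ^ q ∂μ) ^ (2 / q) + 2 * 70 * (∫ x, ‖D x‖ ^ q ∂μ) ^ (2 / q) :=
    add_nonneg (Real.rpow_nonneg (nn S) _) (mul_nonneg (by norm_num) (Real.rpow_nonneg (nn D) _))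
  have := Real.rpow_le_rpow (nn (S + D)) tot (by positivity : 0 ≤ 2 / q)
  rw [← Real.rpow_mul h0, show q / 2 * (2 / q) = 1 by field_simp, Real.rpow_one] at this
  norm_num at this ⊢
  exact this

end MartingaleMoments

/-! ### Dyadic chaining. -/

section Chaining

variable {Ω : Type*} [MeasurableSpace Ω] {μ : Measure Ω}
variable {E : Type*} [NormedAddCommGroup E]

/-- Dyadic chaining: a sequence with increments of order `√(n - m)` in `L^q`, `q > 2`, has maxima
of the same order. -/
lemma exists_dyadic_max {q : ℝ} (hq : 2 < q) {A : ℝ≥0∞} (k : ℕ) (m : ℕ) (Q : ℕ → Ω → E)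
    (hQ : ∀ n, AEStronglyMeasurable (Q n) μ)
    (h : ∀ m n, m ≤ n → (∫⁻ x, ‖Q n x - Q m x‖ₑ ^ q ∂μ) ^ (1 / q) ≤
      A * ENNReal.ofReal (√((n : ℝ) - m))) :
    ∃ M : Ω → ℝ≥0∞, AEMeasurable M μ ∧
      (∀ n, m ≤ n → n ≤ m + 2 ^ k → ∀ x, ‖Q n x - Q m x‖ₑ ≤ M x) ∧
      (∫⁻ x, M x ^ q ∂μ) ^ (1 / q) ≤
        ENNReal.ofReal (1 / (√2 - 2 ^ (1 / q))) * A * ENNReal.ofReal (√(2 ^ k)) := by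
  have hq0 : 0 < q := by linarith
  have hlt : (2 : ℝ) ^ (1 / q) < √2 := by
    rw [Real.sqrt_eq_rpow]
    exact Real.rpow_lt_rpow_of_exponent_lt (by norm_num) (one_div_lt_one_div_of_lt (by norm_num) hq)
  have h1 : (1 : ℝ) ≤ 2 ^ (1 / q) := Real.one_le_rpow (by norm_num) (by positivity)
  -- C is the fixed point of the recursion in `hCe`: doubling the block costs one increment plus the
  -- maximum of two half-block maxima, and that maximum loses a factor 2^{1/q} in L^q. The fixed
  -- point is positive because q > 2.
  set C : ℝ := 1 / (√2 - 2 ^ (1 / q)) with hC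
  have hCpos : 0 < C := by rw [hC]; exact one_div_pos.2 (by linarith)
  have hC1 : 1 ≤ C := by
    rw [hC, le_div_iff₀ (by linarith)]
    have : √2 ≤ 2 := by rw [Real.sqrt_le_left (by norm_num)]; norm_num
    linarith
  have hCe : 1 + 2 ^ (1 / q) * C = √2 * C := by
    have : C * (√2 - 2 ^ (1 / q)) = 1 := by rw [hC]; exact one_div_mul_cancel (by linarith)
    linarith
  induction k generalizing m with
  | zero =>
    refine ⟨fun x => ‖Q (m + 1) x - Q m x‖ₑ, ((hQ _).sub (hQ _)).enorm, ?_, ?_⟩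
    · intro n hn hn' x
      rcases (show n = m ∨ n = m + 1 by simp at hn'; omega) with rfl | rfl
      · rw [sub_self, enorm_zero]; exact zero_le
      · exact le_rfl
    · refine (h m (m + 1) (by omega)).trans ?_
      simp only [pow_zero, Nat.cast_add, Nat.cast_one, add_sub_cancel_left, Real.sqrt_one,
        ENNReal.ofReal_one, mul_one]
      calc A = ENNReal.ofReal 1 * A := by simp
        _ ≤ _ := by gcongr
  | succ k ih =>
    obtain ⟨M₁, hM₁, hb₁, hn₁⟩ := ih m
    obtain ⟨M₂, hM₂, hb₂, hn₂⟩ := ih (m + 2 ^ k)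
    have hM0 : AEMeasurable (fun x => ‖Q (m + 2 ^ k) x - Q m x‖ₑ) μ := ((hQ _).sub (hQ _)).enorm
    refine ⟨fun x => ‖Q (m + 2 ^ k) x - Q m x‖ₑ + max (M₁ x) (M₂ x),
      hM0.add (hM₁.max hM₂), ?_, ?_⟩
    · intro n hn hn' x
      rcases le_total n (m + 2 ^ k) with h' | h'
      · exact (hb₁ n hn h' x).trans ((le_max_left _ _).trans le_add_self)
      · have : Q n x - Q m x = (Q (m + 2 ^ k) x - Q m x) + (Q n x - Q (m + 2 ^ k) x) := by abel
        rw [this]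
        refine (enorm_add_le _ _).trans (add_le_add le_rfl ?_)
        exact (hb₂ n h' (by rw [pow_succ] at hn'; omega) x).trans (le_max_right _ _)
    · refine (ENNReal.lintegral_Lp_add_le hM0 (hM₁.max hM₂) (by linarith)).trans ?_
      have e1 : (∫⁻ x, ‖Q (m + 2 ^ k) x - Q m x‖ₑ ^ q ∂μ) ^ (1 / q) ≤
          A * ENNReal.ofReal (√(2 ^ k)) := by
        refine (h m (m + 2 ^ k) (Nat.le_add_right _ _)).trans (le_of_eq ?_)
        congr 3; push_cast; ring
      have e2 : (∫⁻ x, max (M₁ x) (M₂ x) ^ q ∂μ) ^ (1 / q) ≤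
          ENNReal.ofReal (2 ^ (1 / q)) * (ENNReal.ofReal C * A * ENNReal.ofReal (√(2 ^ k))) := by
        set Z := ENNReal.ofReal C * A * ENNReal.ofReal (√(2 ^ k))
        have hz : ∀ {M : Ω → ℝ≥0∞}, (∫⁻ x, M x ^ q ∂μ) ^ (1 / q) ≤ Z → ∫⁻ x, M x ^ q ∂μ ≤ Z ^ q := by
          intro M hM
          have := ENNReal.rpow_le_rpow hM hq0.le
          rwa [← ENNReal.rpow_mul, one_div_mul_cancel hq0.ne', ENNReal.rpow_one] at this
        calc (∫⁻ x, max (M₁ x) (M₂ x) ^ q ∂μ) ^ (1 / q)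
            ≤ (∫⁻ x, (M₁ x ^ q + M₂ x ^ q) ∂μ) ^ (1 / q) := by
              gcongr with x
              rcases le_total (M₁ x) (M₂ x) with h | h
              · rw [max_eq_right h]; exact le_add_self
              · rw [max_eq_left h]; exact le_self_add
          _ = (∫⁻ x, M₁ x ^ q ∂μ + ∫⁻ x, M₂ x ^ q ∂μ) ^ (1 / q) := by
              rw [lintegral_add_left' (hM₁.pow_const q)]
          _ ≤ (Z ^ q + Z ^ q) ^ (1 / q) := by gcongr; exacts [hz hn₁, hz hn₂]
          _ = _ := by
              rw [← two_mul, ENNReal.mul_rpow_of_nonneg _ _ (by positivity), ← ENNReal.rpow_mul,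
                mul_one_div_cancel hq0.ne', ENNReal.rpow_one,
                ← ENNReal.ofReal_rpow_of_pos (by norm_num)]
              simp
      refine (add_le_add e1 e2).trans (le_of_eq ?_)
      have hs : √((2 : ℝ) ^ (k + 1)) = √2 * √(2 ^ k) := by
        rw [pow_succ, Real.sqrt_mul (by positivity), mul_comm]
      rw [hs]
      calc A * ENNReal.ofReal (√(2 ^ k)) +
          ENNReal.ofReal (2 ^ (1 / q)) * (ENNReal.ofReal C * A * ENNReal.ofReal (√(2 ^ k)))
          = (1 + ENNReal.ofReal (2 ^ (1 / q)) * ENNReal.ofReal C) * (A * ENNReal.ofReal (√(2 ^ k))) := by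
            ring
        _ = ENNReal.ofReal (√2 * C) * (A * ENNReal.ofReal (√(2 ^ k))) := by
            rw [← hCe, ENNReal.ofReal_add (by norm_num) (by positivity),
              ENNReal.ofReal_mul (by positivity), ENNReal.ofReal_one]
        _ = _ := by
            rw [ENNReal.ofReal_mul (by positivity), ENNReal.ofReal_mul (by positivity)]; ring

end Chaining

/-! ### Conditional expectations of vector valued functions. -/

section CondExp

variable {Ω : Type*} {m0 : MeasurableSpace Ω} {μ : Measure Ω} [IsProbabilityMeasure μ]
variable {K : Type*} [NormedAddCommGroup K] [NormedSpace ℝ K] [CompleteSpace K]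

lemma setIntegral_inter_of_indep {m' m₂ : MeasurableSpace Ω} (hm' : m' ≤ m0) (hm₂ : m₂ ≤ m0)
    (hind : Indep m' m₂ μ) {h : Ω → K} (hint : Integrable h μ) (hh : AEStronglyMeasurable[m'] h μ)
    {A B : Set Ω} (hA : MeasurableSet[m'] A) (hB : MeasurableSet[m₂] B) :
    ∫ x in A ∩ B, h x ∂μ = μ.real B • ∫ x in A, h x ∂μ := by
  have e : h =ᵐ[μ] hh.mk h := hh.ae_eq_mk
  have hsm : StronglyMeasurable[m'] (A.indicator (hh.mk h)) := hh.stronglyMeasurable_mk.indicator hA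
  have hint' : Integrable (A.indicator (hh.mk h)) μ := (hint.congr e).indicator (hm' _ hA)
  have h1 := condExp_indep_eq hm' hm₂ hsm hind
  have h2 := setIntegral_condExp hm₂ hint' hB
  rw [setIntegral_congr_ae (g := fun _ => ∫ x, A.indicator (hh.mk h) x ∂μ) (hm₂ _ hB)
    (h1.mono fun x hx _ => hx), setIntegral_const, integral_indicator (hm' _ hA),
    setIntegral_indicator (hm' _ hA)] at h2
  have e' : ∀ s, ∫ x in s, h x ∂μ = ∫ x in s, hh.mk h x ∂μ := fun s =>
    integral_congr_ae (ae_restrict_of_ae e)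
  rw [e', e', Set.inter_comm, ← h2]

/-- Conditioning on information that is independent of everything else has no effect. -/
theorem condExp_sup_of_indep {m₁ m₂ m' : MeasurableSpace Ω} (hm' : m' ≤ m0) (hm₂ : m₂ ≤ m0)
    (hm₁ : m₁ ≤ m') (hind : Indep m' m₂ μ) {f : Ω → K} (hint : Integrable f μ)
    (hf : AEStronglyMeasurable[m'] f μ) : μ[f | m₁ ⊔ m₂] =ᵐ[μ] μ[f | m₁] := by
  have hsup : m₁ ⊔ m₂ ≤ m0 := sup_le (hm₁.trans hm') hm₂
  have hsm : StronglyMeasurable[m₁ ⊔ m₂] (μ[f | m₁]) := stronglyMeasurable_condExp.mono le_sup_left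
  refine (ae_eq_condExp_of_forall_setIntegral_eq hsup hint
    (fun s _ _ => integrable_condExp.integrableOn) ?_
    hsm.aestronglyMeasurable).symm
  have heq : m₁ ⊔ m₂ = MeasurableSpace.generateFrom
      {s | ∃ A B, MeasurableSet[m₁] A ∧ MeasurableSet[m₂] B ∧ A ∩ B = s} := by
    apply le_antisymm
    · refine sup_le (fun A hA => ?_) (fun B hB => ?_)
      · exact MeasurableSpace.measurableSet_generateFrom ⟨A, Set.univ, hA, .univ, Set.inter_univ A⟩
      · exact MeasurableSpace.measurableSet_generateFrom ⟨Set.univ, B, .univ, hB, Set.univ_inter B⟩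
    · refine MeasurableSpace.generateFrom_le ?_
      rintro _ ⟨A, B, hA, hB, rfl⟩
      exact MeasurableSet.inter (le_sup_left (a := m₁) (b := m₂) A hA)
        (le_sup_right (a := m₁) (b := m₂) B hB)
  have hpi : IsPiSystem {s | ∃ A B, MeasurableSet[m₁] A ∧ MeasurableSet[m₂] B ∧ A ∩ B = s} := by
    rintro _ ⟨A, B, hA, hB, rfl⟩ _ ⟨A', B', hA', hB', rfl⟩ _
    exact ⟨A ∩ A', B ∩ B', hA.inter hA', hB.inter hB', by
      rw [Set.inter_inter_inter_comm]⟩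
  -- On the generating sets A ∩ B independence factors out the probability of B on both sides,
  -- leaving the defining property of the conditional expectation on A. Complements and disjoint
  -- unions extend this to the whole σ-algebra.
  have main : ∀ s, MeasurableSet[m₁ ⊔ m₂] s → ∫ x in s, (μ[f | m₁]) x ∂μ = ∫ x in s, f x ∂μ := by
    refine MeasurableSpace.induction_on_inter heq hpi ?_ ?_ ?_ ?_
    · simp
    · rintro _ ⟨A, B, hA, hB, rfl⟩
      rw [setIntegral_inter_of_indep hm' hm₂ hind integrable_condExp
          (stronglyMeasurable_condExp.mono hm₁).aestronglyMeasurable (hm₁ _ hA) hB,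
        setIntegral_inter_of_indep hm' hm₂ hind hint hf (hm₁ _ hA) hB,
        setIntegral_condExp (hm₁.trans hm') hint hA]
    · intro t ht h
      rw [setIntegral_compl (hsup _ ht) integrable_condExp, setIntegral_compl (hsup _ ht) hint, h,
        integral_condExp (hm₁.trans hm')]
    · intro g hd hg h
      rw [integral_iUnion (fun i => hsup _ (hg i)) hd integrable_condExp.integrableOn,
        integral_iUnion (fun i => hsup _ (hg i)) hd hint.integrableOn]
      exact tsum_congr h
  exact fun s hs _ => main s hs

/-- **Lévy's upward theorem** in `L²` for functions with values in a Banach space. -/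
theorem tendsto_eLpNorm_two_condExp_sub (G : Filtration ℕ m0) {f : Ω → K} (hf : MemLp f 2 μ)
    (hfm : AEStronglyMeasurable[⨆ n, G n] f μ) :
    Tendsto (fun n => eLpNorm (μ[f | G n] - f) 2 μ) atTop (𝓝 0) := by
  have hle : ⨆ n, G n ≤ m0 := iSup_le G.le
  refine MemLp.induction_stronglyMeasurable hle ENNReal.ofNat_ne_top
    (fun f => Tendsto (fun n => eLpNorm (μ[f | G n] - f) 2 μ) atTop (𝓝 0)) ?_ ?_ ?_ ?_ hf hfm
  -- For a vector times an indicator the claim reduces to the scalar L¹ theorem: the scalar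
  -- difference is bounded by 1, so its second moment is at most its first absolute moment.
  · intro c s hs _
    set u : Ω → ℝ := s.indicator fun _ => 1
    have hu : Integrable u μ := (integrable_const _).indicator (hle _ hs)
    have h1 := hu.tendsto_eLpNorm_condExp (ℱ := G) (stronglyMeasurable_const.indicator hs)
    have hT : (s.indicator fun _ => c) = (ContinuousLinearMap.toSpanSingleton ℝ c) ∘ u := by
      ext x; by_cases hx : x ∈ s <;> simp [u, hx]
    have hb : ∀ n, ∀ᵐ x ∂μ, ‖(μ[u | G n] - u) x‖ₑ ≤ 1 := by
      intro n
      have hu0 : 0 ≤ᵐ[μ] u := ae_of_all _ fun x => Set.indicator_nonneg (fun _ _ => zero_le_one) x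
      have hu1 : u ≤ᵐ[μ] fun _ => (1 : ℝ) := ae_of_all _ fun x =>
        Set.indicator_le_self' (f := fun _ => (1 : ℝ)) (fun _ _ => zero_le_one) x
      have c0 := condExp_nonneg (m := G n) hu0
      have c1 := condExp_mono (m := G n) hu (integrable_const (1 : ℝ)) hu1
      rw [condExp_const (G.le n)] at c1
      filter_upwards [hu0, hu1, c0, c1] with x a b c d
      simp only [Pi.zero_apply, Pi.sub_apply] at *
      rw [← ofReal_norm, ← ENNReal.ofReal_one]
      refine ENNReal.ofReal_le_ofReal ?_
      rw [Real.norm_eq_abs, abs_le]; constructor <;> linarith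
    have hlim : Tendsto (fun n => ‖c‖ₑ * eLpNorm (μ[u | G n] - u) 1 μ ^ (1 / 2 : ℝ)) atTop (𝓝 0) := by
      have := ENNReal.Tendsto.const_mul (a := ‖c‖ₑ) (h1.ennrpow_const (1 / 2 : ℝ))
        (Or.inr enorm_ne_top)
      simpa using this
    refine tendsto_of_tendsto_of_tendsto_of_le_of_le tendsto_const_nhds hlim
      (fun _ => zero_le) fun n => ?_
    have e : μ[s.indicator (fun _ => c) | G n] - s.indicator (fun _ => c) =ᵐ[μ]
        fun x => (μ[u | G n] - u) x • c := by
      have := (ContinuousLinearMap.toSpanSingleton ℝ c).comp_condExp_comm (m := G n) hu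
      rw [← hT] at this
      filter_upwards [this] with x hx
      rw [Pi.sub_apply, ← hx, hT]
      simp [sub_smul]
    show eLpNorm (μ[s.indicator (fun _ => c) | G n] - s.indicator (fun _ => c)) 2 μ ≤ _
    rw [eLpNorm_congr_ae e, eLpNorm_eq_lintegral_rpow_enorm_toReal (by norm_num) (by norm_num),
      eLpNorm_one_eq_lintegral_enorm]
    have : ∫⁻ x, ‖(μ[u | G n] - u) x • c‖ₑ ^ (2 : ℝ≥0∞).toReal ∂μ ≤
        ∫⁻ x, ‖c‖ₑ ^ (2 : ℝ) * ‖(μ[u | G n] - u) x‖ₑ ∂μ := by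
      refine lintegral_mono_ae ?_
      filter_upwards [hb n] with x hx
      rw [enorm_smul, ENNReal.toReal_ofNat, ENNReal.mul_rpow_of_nonneg _ _ (by norm_num), mul_comm]
      refine mul_le_mul_right ?_ _
      calc ‖(μ[u | G n] - u) x‖ₑ ^ (2 : ℝ) = ‖(μ[u | G n] - u) x‖ₑ * ‖(μ[u | G n] - u) x‖ₑ := by
            rw [ENNReal.rpow_ofNat, sq]
        _ ≤ ‖(μ[u | G n] - u) x‖ₑ * 1 := by gcongr
        _ = _ := mul_one _
    refine (ENNReal.rpow_le_rpow this (by positivity)).trans (le_of_eq ?_)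
    rw [lintegral_const_mul' _ _ (by finiteness), ENNReal.mul_rpow_of_nonneg _ _ (by positivity),
      ← ENNReal.rpow_mul]
    norm_num
  · intro f g _ hf hg _ _ h1 h2
    have := h1.add h2
    rw [add_zero] at this
    refine tendsto_of_tendsto_of_tendsto_of_le_of_le tendsto_const_nhds this
      (fun _ => zero_le) fun n => ?_
    have e : μ[f + g | G n] - (f + g) =ᵐ[μ] (μ[f | G n] - f) + (μ[g | G n] - g) := by
      filter_upwards [condExp_add (hf.integrable one_le_two) (hg.integrable one_le_two) (G n)]
        with x hx
      simp only [Pi.sub_apply, hx, Pi.add_apply]; abel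
    rw [eLpNorm_congr_ae e]
    exact eLpNorm_add_le ((integrable_condExp.1).sub hf.1) ((integrable_condExp.1).sub hg.1)
      one_le_two
  -- The set of good f is closed because conditional expectations are L² contractions, uniformly in
  -- n.
  · refine isClosed_of_closure_subset fun f hf => ?_
    rw [EMetric.mem_closure_iff] at hf
    rw [Set.mem_ofPred_eq, ENNReal.tendsto_nhds_zero]
    intro ε hε
    obtain ⟨g, hg, hfg⟩ := hf (ε / 4) (by simpa using hε.ne')
    rw [Set.mem_ofPred_eq, ENNReal.tendsto_nhds_zero] at hg
    filter_upwards [hg (ε / 4) (by simpa using hε.ne')] with n hn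
    have hF := Lp.memLp (f : Lp K 2 μ)
    have hG := Lp.memLp (g : Lp K 2 μ)
    set F : Ω → K := ((f : Lp K 2 μ) : Ω → K)
    set g' : Ω → K := ((g : Lp K 2 μ) : Ω → K)
    have hd : eLpNorm (F - g') 2 μ ≤ ε / 4 := by
      rw [← Lp.edist_def]; exact hfg.le
    have e : μ[F | G n] - F =ᵐ[μ] μ[F - g' | G n] + (μ[g' | G n] - g') - (F - g') := by
      filter_upwards [condExp_sub (hF.integrable one_le_two) (hG.integrable one_le_two) (G n)]
        with x hx
      simp only [Pi.sub_apply, hx, Pi.add_apply]; abel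
    rw [eLpNorm_congr_ae e]
    refine (eLpNorm_sub_le (integrable_condExp.1.add (integrable_condExp.1.sub hG.1))
      (hF.1.sub hG.1) one_le_two).trans ?_
    refine (add_le_add (eLpNorm_add_le integrable_condExp.1 (integrable_condExp.1.sub hG.1)
      one_le_two) hd).trans ?_
    refine (add_le_add (add_le_add ((eLpNorm_condExp_le_eLpNorm _ one_le_two).trans hd) hn)
      le_rfl).trans ?_
    have : ε / 4 + ε / 4 + ε / 4 ≤ ε / 4 + ε / 4 + ε / 4 + ε / 4 := le_self_add
    refine this.trans (le_of_eq ?_)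
    rw [show ε / 4 + ε / 4 + ε / 4 + ε / 4 = 4 * (ε / 4) by ring]
    exact ENNReal.mul_div_cancel (by norm_num) (by norm_num)
  · intro f g hfg _ h
    refine h.congr fun n => eLpNorm_congr_ae ?_
    exact (condExp_congr_ae hfg).sub hfg

lemma enorm_integral_bilin_le {E F : Type*} [NormedAddCommGroup E] [NormedAddCommGroup F]
    (b : E → F → K) (hb : ∀ x y, ‖b x y‖ ≤ ‖x‖ * ‖y‖) {f : Ω → E} {g : Ω → F}
    (hf : AEStronglyMeasurable f μ) (hg : AEStronglyMeasurable g μ) :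
    ‖∫ x, b (f x) (g x) ∂μ‖ₑ ≤ eLpNorm f 2 μ * eLpNorm g 2 μ := by
  refine (enorm_integral_le_lintegral_enorm _).trans ?_
  rw [← eLpNorm_one_eq_lintegral_enorm]
  have := eLpNorm_le_eLpNorm_mul_eLpNorm'_of_norm (p := 2) (q := 2) (r := 1) hf hg b 1
    (ae_of_all _ fun x => by simpa using hb (f x) (g x))
  simpa using this

end CondExp

/-! ### Independent innovations -/

section Innovations

variable {Ω : Type*} {m0 : MeasurableSpace Ω} {μ : Measure Ω} [IsProbabilityMeasure μ]
variable {S : Type*} [MeasurableSpace S] {I : Type*}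

/-- The σ-algebra generated by the innovations with index in `J`. -/
@[reducible] def innovSigma (ε : I → Ω → S) (J : Set I) : MeasurableSpace Ω :=
  ⨆ j ∈ J, MeasurableSpace.comap (ε j) inferInstance

lemma innovSigma_mono (ε : I → Ω → S) {J J' : Set I} (h : J ⊆ J') :
    innovSigma ε J ≤ innovSigma ε J' :=
  biSup_mono h

lemma innovSigma_le {ε : I → Ω → S} (hε : ∀ i, Measurable (ε i)) (J : Set I) :
    innovSigma ε J ≤ m0 :=
  iSup₂_le fun i _ => (hε i).comap_le

lemma innovSigma_union (ε : I → Ω → S) (J J' : Set I) :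
    innovSigma ε (J ∪ J') = innovSigma ε J ⊔ innovSigma ε J' :=
  iSup_union

variable {K : Type*} [NormedAddCommGroup K] [NormedSpace ℝ K] [CompleteSpace K]

/-- Split J' into J ∩ J' and J' \ J; the innovations of the second part are independent of all those
that f depends on, so conditioning on them changes nothing. -/
theorem condExp_innovSigma_inter {ε : I → Ω → S} (hε : ∀ i, Measurable (ε i))
    (hind : iIndepFun ε μ) {J J' : Set I} {f : Ω → K} (hint : Integrable f μ)
    (hf : AEStronglyMeasurable[innovSigma ε J] f μ) :
    μ[f | innovSigma ε J'] =ᵐ[μ] μ[f | innovSigma ε (J ∩ J')] := by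
  have hi : Indep (innovSigma ε J) (innovSigma ε (J' \ J)) μ :=
    indep_iSup_of_disjoint (fun i => (hε i).comap_le) hind Set.disjoint_sdiff_right
  have := condExp_sup_of_indep (m₁ := innovSigma ε (J ∩ J')) (innovSigma_le hε J)
    (innovSigma_le hε _) (innovSigma_mono ε Set.inter_subset_left) hi hint hf
  rwa [← innovSigma_union, Set.inter_comm, Set.inter_union_sdiff, Set.inter_comm] at this

/-- The filtration that reveals the innovations `ε_N, ε_{N-1}, …` one by one. -/
def backwardFiltration {ε : ℤ → Ω → S} (hε : ∀ i, Measurable (ε i)) (N : ℤ) : Filtration ℕ m0 where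
  seq r := innovSigma ε (Set.Ioc (N - r) N)
  mono' r r' h := innovSigma_mono ε (Set.Ioc_subset_Ioc_left (by lia))
  le' _ := innovSigma_le hε _

lemma backwardFiltration_apply {ε : ℤ → Ω → S} (hε : ∀ i, Measurable (ε i)) (N : ℤ) (r : ℕ) :
    backwardFiltration hε N r = innovSigma ε (Set.Ioc (N - r) N) := rfl

lemma backwardFiltration_zero {ε : ℤ → Ω → S} (hε : ∀ i, Measurable (ε i)) (N : ℤ) :
    backwardFiltration hε N 0 = ⊥ := by
  simp [backwardFiltration_apply, innovSigma]

lemma iSup_backwardFiltration {ε : ℤ → Ω → S} (hε : ∀ i, Measurable (ε i)) (N : ℤ) :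
    ⨆ r, backwardFiltration hε N r = innovSigma ε (Set.Iic N) := by
  apply le_antisymm
  · exact iSup_le fun r => innovSigma_mono ε Set.Ioc_subset_Iic_self
  · refine iSup₂_le fun i hi => ?_
    have : i ∈ Set.Ioc (N - ((N - i).toNat + 1 : ℕ)) N := by
      simp only [Set.mem_Iic, Set.mem_Ioc] at *; lia
    exact (le_iSup₂_of_le (f := fun j (_ : j ∈ Set.Ioc (N - ((N - i).toNat + 1 : ℕ)) N) =>
      MeasurableSpace.comap (ε j) inferInstance) i this le_rfl).trans
      (le_iSup (fun r => (backwardFiltration hε N r : MeasurableSpace Ω)) ((N - i).toNat + 1))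

/-- The step from r to r + 1 reveals exactly ε_{N−r}. Since `fk` does not involve it, its own
increment vanishes, so the increment of f is that of f − `fk`; two contractions give the factor 2.
-/
lemma eLpNorm_backward_increment_le {ε : ℤ → Ω → S} (hε : ∀ i, Measurable (ε i))
    (hind : iIndepFun ε μ) {p : ℝ≥0∞} (hp : 1 ≤ p) (N : ℤ) (r : ℕ) {f fk : Ω → K}
    (hf : Integrable f μ) (hfk : Integrable fk μ)
    (hfkm : AEStronglyMeasurable[innovSigma ε {N - r}ᶜ] fk μ) :
    eLpNorm (μ[f | backwardFiltration hε N (r + 1)] - μ[f | backwardFiltration hε N r]) p μ ≤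
      2 * eLpNorm (f - fk) p μ := by
  have h1 := condExp_innovSigma_inter hε hind (J' := Set.Ioc (N - (r + 1 : ℕ)) N) hfk hfkm
  have hJ : ({N - (r : ℤ)}ᶜ ∩ Set.Ioc (N - (r + 1 : ℕ)) N : Set ℤ) = Set.Ioc (N - r) N := by
    ext i; simp only [Set.mem_inter_iff, Set.mem_compl_iff, Set.mem_singleton_iff, Set.mem_Ioc]
    push_cast; lia
  rw [hJ] at h1
  have e : μ[f | backwardFiltration hε N (r + 1)] - μ[f | backwardFiltration hε N r] =ᵐ[μ]
      μ[f - fk | backwardFiltration hε N (r + 1)] - μ[f - fk | backwardFiltration hε N r] := by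
    filter_upwards [h1, condExp_sub hf hfk (backwardFiltration hε N (r + 1)),
      condExp_sub hf hfk (backwardFiltration hε N r)] with x a b c
    simp only [Pi.sub_apply, backwardFiltration_apply] at *
    rw [b, c, a]; abel
  rw [eLpNorm_congr_ae e, two_mul]
  exact (eLpNorm_sub_le integrable_condExp.1 integrable_condExp.1 hp).trans
    (add_le_add (eLpNorm_condExp_le_eLpNorm _ hp) (eLpNorm_condExp_le_eLpNorm _ hp))

lemma tsum_backward_le (N : ℤ) (u : ℤ → ℝ≥0∞) (R : ℕ) :
    ∑ r ∈ Finset.range R, u (N - r) ≤ ∑' k, u k :=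
  (ENNReal.sum_le_tsum _).trans
    (ENNReal.tsum_comp_le_tsum_of_injective (f := fun r : ℕ => N - (r : ℤ))
      (fun a b h => by simpa using h) u)

/-- The covariance of two functions of the innovations is controlled by their dependence on the
single innovations. -/
theorem enorm_integral_bilin_le_tsum {E F : Type*} [NormedAddCommGroup E] [NormedSpace ℝ E]
    [CompleteSpace E] [NormedAddCommGroup F] [NormedSpace ℝ F] [CompleteSpace F]
    (b : E →L[ℝ] F →L[ℝ] K) (hb : ∀ x y, ‖b x y‖ ≤ ‖x‖ * ‖y‖)
    {ε : ℤ → Ω → S} (hε : ∀ i, Measurable (ε i)) (hind : iIndepFun ε μ) (N : ℤ)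
    {f : Ω → E} {g : Ω → F} (hf : MemLp f 2 μ) (hg : MemLp g 2 μ)
    (hfm : AEStronglyMeasurable[innovSigma ε (Set.Iic N)] f μ)
    (hgm : AEStronglyMeasurable[innovSigma ε (Set.Iic N)] g μ)
    (hf0 : ∫ x, f x ∂μ = 0) (fk : ℤ → Ω → E) (gk : ℤ → Ω → F)
    (hfk : ∀ k, Integrable (fk k) μ) (hgk : ∀ k, Integrable (gk k) μ)
    (hfkm : ∀ k, AEStronglyMeasurable[innovSigma ε {k}ᶜ] (fk k) μ)
    (hgkm : ∀ k, AEStronglyMeasurable[innovSigma ε {k}ᶜ] (gk k) μ) :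
    ‖∫ x, b (f x) (g x) ∂μ‖ₑ ≤
      4 * ∑' k, eLpNorm (f - fk k) 2 μ * eLpNorm (g - gk k) 2 μ := by
  set G := backwardFiltration hε N with hG
  have hfi := hf.integrable one_le_two
  have hgi := hg.integrable one_le_two
  have hF : ∀ r, MemLp (μ[f | G r]) 2 μ := fun r => hf.condExp one_le_two
  have hGm : ∀ r, MemLp (μ[g | G r]) 2 μ := fun r => hg.condExp one_le_two
  have bint : ∀ {u : Ω → E} {v : Ω → F}, MemLp u 2 μ → MemLp v 2 μ →
      Integrable (fun x => b (u x) (v x)) μ := fun {u v} hu hv =>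
    memLp_one_iff_integrable.1 (MemLp.of_bilin (fun x y => b x y) 1 hu hv
      (b.aestronglyMeasurable_comp₂ hu.1 hv.1)
      (ae_of_all _ fun x => by simpa [← NNReal.coe_le_coe] using hb (u x) (v x)))
  -- Orthogonality of martingale increments for a bilinear pairing: the mixed terms `z1` and `z2`
  -- vanish after conditioning on `G r`.
  have step : ∀ r, ∫ x, b ((μ[f | G (r + 1)]) x) ((μ[g | G (r + 1)]) x) ∂μ =
      ∫ x, b ((μ[f | G r]) x) ((μ[g | G r]) x) ∂μ +
        ∫ x, b ((μ[f | G (r + 1)] - μ[f | G r]) x) ((μ[g | G (r + 1)] - μ[g | G r]) x) ∂μ := by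
    intro r
    have i1 := bint (hF r) ((hGm (r + 1)).sub (hGm r))
    have i2 := bint ((hF (r + 1)).sub (hF r)) (hGm r)
    have z1 : ∫ x, b ((μ[f | G r]) x) ((μ[g | G (r + 1)] - μ[g | G r]) x) ∂μ = 0 := by
      rw [← integral_condExp (G.le r)]
      refine integral_eq_zero_of_ae ?_
      have hD0 : μ[μ[g | G (r + 1)] - μ[g | G r] | G r] =ᵐ[μ] 0 := by
        filter_upwards [condExp_sub (integrable_condExp (f := g) (m := G (r + 1)) (μ := μ))
          (integrable_condExp (f := g) (m := G r) (μ := μ)) (G r),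
          condExp_condExp_of_le (f := g) (μ := μ) (G.mono (Nat.le_succ r)) (G.le (r + 1))] with x a b
        rw [a, Pi.sub_apply, b, condExp_of_stronglyMeasurable (G.le r) stronglyMeasurable_condExp
          integrable_condExp, sub_self, Pi.zero_apply]
      filter_upwards [condExp_bilin_of_stronglyMeasurable_left b
        (stronglyMeasurable_condExp (f := f) (m := G r) (μ := μ)) i1
        (((hGm (r + 1)).sub (hGm r)).integrable one_le_two), hD0] with x a c
      rw [a, c]; simp
    have z2 : ∫ x, b ((μ[f | G (r + 1)] - μ[f | G r]) x) ((μ[g | G r]) x) ∂μ = 0 := by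
      rw [← integral_condExp (G.le r)]
      refine integral_eq_zero_of_ae ?_
      have hD0 : μ[μ[f | G (r + 1)] - μ[f | G r] | G r] =ᵐ[μ] 0 := by
        filter_upwards [condExp_sub (integrable_condExp (f := f) (m := G (r + 1)) (μ := μ))
          (integrable_condExp (f := f) (m := G r) (μ := μ)) (G r),
          condExp_condExp_of_le (f := f) (μ := μ) (G.mono (Nat.le_succ r)) (G.le (r + 1))] with x a b
        rw [a, Pi.sub_apply, b, condExp_of_stronglyMeasurable (G.le r) stronglyMeasurable_condExp
          integrable_condExp, sub_self, Pi.zero_apply]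
      filter_upwards [condExp_bilin_of_stronglyMeasurable_right b
        (stronglyMeasurable_condExp (f := g) (m := G r) (μ := μ)) i2
        (((hF (r + 1)).sub (hF r)).integrable one_le_two), hD0] with x a c
      rw [a, c]; simp
    have i3 := bint ((hF (r + 1)).sub (hF r)) ((hGm (r + 1)).sub (hGm r))
    have e : ∀ x, b ((μ[f | G (r + 1)]) x) ((μ[g | G (r + 1)]) x) =
        b ((μ[f | G r]) x) ((μ[g | G r]) x) +
        b ((μ[f | G (r + 1)] - μ[f | G r]) x) ((μ[g | G (r + 1)] - μ[g | G r]) x) +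
        b ((μ[f | G r]) x) ((μ[g | G (r + 1)] - μ[g | G r]) x) +
        b ((μ[f | G (r + 1)] - μ[f | G r]) x) ((μ[g | G r]) x) := by
      intro x; simp only [Pi.sub_apply, map_sub, sub_apply]; abel
    simp_rw [e]
    rw [integral_add (by exact ((bint (hF r) (hGm r)).add i3).add i1) i2,
      integral_add (by exact (bint (hF r) (hGm r)).add i3) i1, integral_add (bint (hF r) (hGm r)) i3,
      z1, z2, add_zero, add_zero]
  -- `G 0` is trivial, so centering f alone removes the initial term; g need not be centered.
  have zero : ∫ x, b ((μ[f | G 0]) x) ((μ[g | G 0]) x) ∂μ = 0 := by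
    have : μ[f | G 0] = fun _ => 0 := by
      rw [hG, backwardFiltration_zero, condExp_bot, hf0]
    simp [this]
  have bound : ∀ R, ‖∫ x, b ((μ[f | G R]) x) ((μ[g | G R]) x) ∂μ‖ₑ ≤
      ∑ r ∈ Finset.range R, 4 * (eLpNorm (f - fk (N - r)) 2 μ * eLpNorm (g - gk (N - r)) 2 μ) := by
    intro R
    induction R with
    | zero => simp [zero]
    | succ R ih =>
      rw [step, Finset.sum_range_succ]
      refine (enorm_add_le _ _).trans (add_le_add ih ?_)
      refine (enorm_integral_bilin_le (fun x y => b x y) hb ((hF _).sub (hF _)).1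
        ((hGm _).sub (hGm _)).1).trans ?_
      refine (mul_le_mul' (eLpNorm_backward_increment_le hε hind one_le_two N R hfi (hfk _) (hfkm _))
        (eLpNorm_backward_increment_le hε hind one_le_two N R hgi (hgk _) (hgkm _))).trans
        (le_of_eq (by ring))
  have lim : Tendsto (fun R => ∫ x, b ((μ[f | G R]) x) ((μ[g | G R]) x) ∂μ) atTop
      (𝓝 (∫ x, b (f x) (g x) ∂μ)) := by
    rw [tendsto_iff_edist_tendsto_0]
    have l1 := tendsto_eLpNorm_two_condExp_sub G hf (by rwa [hG, iSup_backwardFiltration])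
    have l2 := tendsto_eLpNorm_two_condExp_sub G hg (by rwa [hG, iSup_backwardFiltration])
    have l3 := (ENNReal.Tendsto.mul_const (b := eLpNorm g 2 μ) l1 (Or.inr hg.2.ne)).add
      (ENNReal.Tendsto.const_mul (a := eLpNorm f 2 μ) l2 (Or.inr hf.2.ne))
    simp only [zero_mul, mul_zero, add_zero] at l3
    refine tendsto_of_tendsto_of_tendsto_of_le_of_le tendsto_const_nhds l3
      (fun _ => zero_le) fun R => ?_
    have e : ∫ x, b ((μ[f | G R]) x) ((μ[g | G R]) x) ∂μ - ∫ x, b (f x) (g x) ∂μ =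
        ∫ x, b ((μ[f | G R]) x) ((μ[g | G R] - g) x) ∂μ + ∫ x, b ((μ[f | G R] - f) x) (g x) ∂μ := by
      rw [← integral_sub (bint (hF R) (hGm R)) (bint hf hg),
        ← integral_add (bint (hF R) ((hGm R).sub hg)) (bint ((hF R).sub hf) hg)]
      refine integral_congr_ae (ae_of_all _ fun x => ?_)
      simp
    simp only
    rw [edist_eq_enorm_sub, e]
    refine (enorm_add_le _ _).trans ?_
    rw [add_comm]
    refine add_le_add (enorm_integral_bilin_le (fun x y => b x y) hb ((hF R).sub hf).1 hg.1) ?_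
    refine (enorm_integral_bilin_le (fun x y => b x y) hb (hF R).1 ((hGm R).sub hg).1).trans ?_
    gcongr
    exact eLpNorm_condExp_le_eLpNorm _ one_le_two
  refine le_of_tendsto lim.enorm (Eventually.of_forall fun R => (bound R).trans ?_)
  rw [← Finset.mul_sum]
  gcongr
  exact tsum_backward_le N (fun k => eLpNorm (f - fk k) 2 μ * eLpNorm (g - gk k) 2 μ) R

end Innovations

/-! ### Moment inequality for functions of independent innovations. -/

section MomentBound

variable {Ω : Type*} {m0 : MeasurableSpace Ω} {μ : Measure Ω} [IsProbabilityMeasure μ]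
variable {S : Type*} [MeasurableSpace S]
variable {K : Type*} [NormedAddCommGroup K] [InnerProductSpace ℝ K] [CompleteSpace K]

/-- Moments of a function of the innovations are controlled by its dependence on the single
innovations. -/
theorem eLpNorm_sub_integral_sq_le_real {q : ℝ} (hq2 : 2 < q) (hq6 : q ≤ 6)
    {ε : ℤ → Ω → S} (hε : ∀ i, Measurable (ε i)) (hind : iIndepFun ε μ) (N : ℤ)
    {f : Ω → K} (hf : MemLp f (ENNReal.ofReal q) μ)
    (hfm : AEStronglyMeasurable[innovSigma ε (Set.Iic N)] f μ) (fk : ℤ → Ω → K)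
    (hfk : ∀ k, Integrable (fk k) μ)
    (hfkm : ∀ k, AEStronglyMeasurable[innovSigma ε {k}ᶜ] (fk k) μ) :
    eLpNorm (fun x => f x - ∫ y, f y ∂μ) (ENNReal.ofReal q) μ ^ 2 ≤
      560 * ∑' k, eLpNorm (f - fk k) (ENNReal.ofReal q) μ ^ 2 := by
  set G := backwardFiltration hε N with hG
  have hq1 : 1 ≤ ENNReal.ofReal q := by
    rw [← ENNReal.ofReal_one]; exact ENNReal.ofReal_le_ofReal (by linarith)
  have hf2 : MemLp f 2 μ := hf.mono_exponent (by
    rw [← ENNReal.ofReal_ofNat]; exact ENNReal.ofReal_le_ofReal hq2.le)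
  have hfi := hf.integrable hq1
  have hF : ∀ r, MemLp (μ[f | G r]) (ENNReal.ofReal q) μ := fun r => hf.condExp hq1
  -- Each martingale step contributes 140 · 2² = 560 times a squared dependence coefficient.
  have bound : ∀ R, eLpNorm (μ[f | G R] - μ[f | G 0]) (ENNReal.ofReal q) μ ^ 2 ≤
      ∑ r ∈ Finset.range R, 560 * eLpNorm (f - fk (N - r)) (ENNReal.ofReal q) μ ^ 2 := by
    intro R
    induction R with
    | zero => simp
    | succ R ih =>
      have e : μ[f | G (R + 1)] - μ[f | G 0] =
          (μ[f | G R] - μ[f | G 0]) + (μ[f | G (R + 1)] - μ[f | G R]) := by abel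
      have hD0 : μ[μ[f | G (R + 1)] - μ[f | G R] | G R] =ᵐ[μ] 0 := by
        filter_upwards [condExp_sub (integrable_condExp (f := f) (m := G (R + 1)) (μ := μ))
          (integrable_condExp (f := f) (m := G R) (μ := μ)) (G R),
          condExp_condExp_of_le (f := f) (μ := μ) (G.mono (Nat.le_succ R)) (G.le (R + 1))] with x a b
        rw [a, Pi.sub_apply, b, condExp_of_stronglyMeasurable (G.le R) stronglyMeasurable_condExp
          integrable_condExp, sub_self, Pi.zero_apply]
      rw [e, Finset.sum_range_succ]
      refine (eLpNorm_add_sq_le hq2 hq6 (m := G R) ((hF R).sub (hF 0))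
        (stronglyMeasurable_condExp.sub
          (stronglyMeasurable_condExp.mono (G.mono (Nat.zero_le R)))).aestronglyMeasurable
        ((hF (R + 1)).sub (hF R)) (G.le R) hD0).trans (add_le_add ih ?_)
      have := eLpNorm_backward_increment_le hε hind hq1 N R hfi (hfk _) (hfkm _)
      calc 140 * eLpNorm (μ[f | G (R + 1)] - μ[f | G R]) (ENNReal.ofReal q) μ ^ 2
          ≤ 140 * (2 * eLpNorm (f - fk (N - R)) (ENNReal.ofReal q) μ) ^ 2 := by gcongr
        _ = _ := by ring
  have l1 := tendsto_eLpNorm_two_condExp_sub G hf2 (by rwa [hG, iSup_backwardFiltration])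
  have l2 := tendstoInMeasure_of_tendsto_eLpNorm (by norm_num : (2 : ℝ≥0∞) ≠ 0)
    (fun r => (hF r).1) hf2.1 l1
  -- Convergence is available only in L². An almost everywhere convergent subsequence and Fatou's
  -- lemma carry the uniform L^q bound over to the limit.
  obtain ⟨ns, -, hns⟩ := l2.exists_seq_tendsto_ae
  have h0 : μ[f | G 0] = fun _ => ∫ y, f y ∂μ := by
    rw [hG, backwardFiltration_zero, condExp_bot]
  have hl := Lp.eLpNorm_lim_le_liminf_eLpNorm (p := ENNReal.ofReal q)
    (f := fun i => μ[f | G (ns i)] - μ[f | G 0]) (fun i => ((hF _).sub (hF 0)).1)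
    (fun x => f x - ∫ y, f y ∂μ) (by
      filter_upwards [hns] with x hx
      simp only [Pi.sub_apply, h0]
      exact hx.sub_const _)
  set T := 560 * ∑' k, eLpNorm (f - fk k) (ENNReal.ofReal q) μ ^ 2 with hT
  have bT : ∀ R, eLpNorm (μ[f | G R] - μ[f | G 0]) (ENNReal.ofReal q) μ ≤ T ^ (1 / 2 : ℝ) := by
    intro R
    have : eLpNorm (μ[f | G R] - μ[f | G 0]) (ENNReal.ofReal q) μ ^ 2 ≤ T := by
      refine (bound R).trans ?_
      rw [← Finset.mul_sum, hT]
      gcongr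
      exact tsum_backward_le N (fun k => eLpNorm (f - fk k) (ENNReal.ofReal q) μ ^ 2) R
    rw [one_div, ENNReal.le_rpow_inv_iff (by norm_num)]
    simpa using this
  have : eLpNorm (fun x => f x - ∫ y, f y ∂μ) (ENNReal.ofReal q) μ ≤ T ^ (1 / 2 : ℝ) :=
    hl.trans (liminf_le_of_frequently_le' (Frequently.of_forall fun i => bT (ns i)))
  calc _ ≤ (T ^ (1 / 2 : ℝ)) ^ 2 := by gcongr
    _ = T := by rw [← ENNReal.rpow_natCast, ← ENNReal.rpow_mul]; norm_num

/-- Moments of a function of the innovations are controlled by its dependence on the single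
innovations: version for complex Hilbert spaces. -/
theorem eLpNorm_sub_integral_sq_le {K : Type*} [NormedAddCommGroup K] [InnerProductSpace ℂ K]
    [CompleteSpace K] {q : ℝ} (hq2 : 2 < q) (hq6 : q ≤ 6)
    {ε : ℤ → Ω → S} (hε : ∀ i, Measurable (ε i)) (hind : iIndepFun ε μ) (N : ℤ)
    {f : Ω → K} (hf : MemLp f (ENNReal.ofReal q) μ)
    (hfm : AEStronglyMeasurable[innovSigma ε (Set.Iic N)] f μ) (fk : ℤ → Ω → K)
    (hfk : ∀ k, Integrable (fk k) μ)
    (hfkm : ∀ k, AEStronglyMeasurable[innovSigma ε {k}ᶜ] (fk k) μ) :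
    eLpNorm (fun x => f x - ∫ y, f y ∂μ) (ENNReal.ofReal q) μ ^ 2 ≤
      560 * ∑' k, eLpNorm (f - fk k) (ENNReal.ofReal q) μ ^ 2 :=
  letI := InnerProductSpace.complexToReal (G := K)
  eLpNorm_sub_integral_sq_le_real hq2 hq6 hε hind N hf hfm fk hfk hfkm

lemma aestronglyMeasurable_finsetSum {ι E : Type*} [NormedAddCommGroup E] {m : MeasurableSpace Ω}
    (I : Finset ι) {f : ι → Ω → E} (hf : ∀ i ∈ I, AEStronglyMeasurable[m] (f i) μ) :
    AEStronglyMeasurable[m] (fun x => ∑ i ∈ I, f i x) μ := by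
  classical
  induction I using Finset.induction_on with
  | empty => simpa using aestronglyMeasurable_const
  | insert i I hi ih =>
    simp_rw [Finset.sum_insert hi]
    exact (hf i (Finset.mem_insert_self i I)).add
      (ih fun j hj => hf j (Finset.mem_insert_of_mem hj))

end MomentBound

/-! ### From the dependence measure to leaving out one innovation. -/

section PhysicalDependence

variable {Ω : Type*} {m0 : MeasurableSpace Ω} {μ : Measure Ω} [IsProbabilityMeasure μ]
variable {S : Type*} [MeasurableSpace S]
variable {H : Type*} [NormedAddCommGroup H] [InnerProductSpace ℂ H] [CompleteSpace H]

/-- Moves conditional expectations to the space of innovation sequences, where different times can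
be compared through the common law of the past. -/
lemma condExp_comp_comap {Ω' : Type*} {m m1 : MeasurableSpace Ω'} (hm : m ≤ m1) {φ : Ω → Ω'}
    (hφ : Measurable φ) {h : Ω' → H} (hh : Integrable h (μ.map φ)) :
    μ[h ∘ φ | m.comap φ] =ᵐ[μ] (μ.map φ)[h | m] ∘ φ := by
  have : IsProbabilityMeasure (μ.map φ) := Measure.isProbabilityMeasure_map hφ.aemeasurable
  have hle : m.comap φ ≤ m0 := (MeasurableSpace.comap_mono hm).trans hφ.comap_le
  have hsm : StronglyMeasurable[m.comap φ] ((μ.map φ)[h | m] ∘ φ) :=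
    stronglyMeasurable_condExp.comp_measurable (comap_measurable φ)
  refine (ae_eq_condExp_of_forall_setIntegral_eq hle (hh.comp_measurable hφ)
    (fun s _ _ => (integrable_condExp.comp_measurable hφ).integrableOn) ?_
    hsm.aestronglyMeasurable).symm
  rintro _ ⟨s, hs, rfl⟩ -
  have e : ∀ {u : Ω' → H}, Integrable u (μ.map φ) →
      ∫ x in φ ⁻¹' s, (u ∘ φ) x ∂μ = ∫ y in s, u y ∂(μ.map φ) := fun {u} hu =>
    (setIntegral_map (hm _ hs) hu.1 hφ.aemeasurable).symm
  rw [e integrable_condExp, e hh, setIntegral_condExp hm hh hs]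

lemma pastSigma_eq_innovSigma (ε : ℤ → Ω → S) (t : ℤ) :
    pastSigma ε t = innovSigma ε (Set.Iic t) := by
  rw [pastSigma, MeasurableSpace.pi, MeasurableSpace.comap_iSup]
  simp_rw [MeasurableSpace.comap_comp]
  apply le_antisymm
  · exact iSup_le fun j => le_iSup₂_of_le (t - (j : ℤ)) (by simp) le_rfl
  · refine iSup₂_le fun i hi => le_iSup_of_le (t - i).toNat (le_of_eq ?_)
    have : t - ((t - i).toNat : ℤ) = i := by simp only [Set.mem_Iic] at hi; lia
    congr 1
    ext x
    simp only [past, Function.comp_apply, this]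

lemma innovSigma_Iic_diff_eq_comap (ε : ℤ → Ω → S) (s k : ℤ) :
    innovSigma ε (Set.Iic s \ {k}) = (⨆ j : {j : ℕ // (j : ℤ) ≠ s - k},
      MeasurableSpace.comap (fun z : ℕ → S => z j) inferInstance).comap (past ε s) := by
  rw [MeasurableSpace.comap_iSup]
  simp_rw [MeasurableSpace.comap_comp]
  apply le_antisymm
  · refine iSup₂_le fun i hi => ?_
    have hi1 : i ≤ s := hi.1
    have hi2 : i ≠ k := hi.2
    refine le_iSup_of_le ⟨(s - i).toNat, by lia⟩ (le_of_eq ?_)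
    have : s - ((s - i).toNat : ℤ) = i := by lia
    congr 1
    ext x
    simp only [past, Function.comp_apply, this]
  · refine iSup_le fun j => le_iSup₂_of_le (s - (j : ℕ) : ℤ) ⟨by simp, ?_⟩ le_rfl
    have := j.2
    simp only [Set.mem_singleton_iff]
    lia

lemma measurable_past {ε : ℤ → Ω → S} (hε : ∀ t, Measurable (ε t)) (t : ℤ) :
    Measurable (past ε t) :=
  measurable_pi_lambda _ fun _ => hε _

lemma map_past_eq {ε : ℤ → Ω → S} (hε : ∀ t, Measurable (ε t)) (hind : iIndepFun ε μ)
    (hid : ∀ t, IdentDistrib (ε t) (ε 0) μ μ) (t : ℤ) :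
    μ.map (past ε t) = μ.map (past ε 0) := by
  have key : ∀ t : ℤ, μ.map (past ε t) = Measure.infinitePi fun _ : ℕ => μ.map (ε 0) := by
    intro t
    have h1 : iIndepFun (fun j : ℕ => ε (t - j)) μ :=
      hind.precomp (g := fun j : ℕ => t - (j : ℤ)) fun a b h => by simpa using h
    have h2 := (iIndepFun_iff_map_fun_eq_infinitePi_map (fun j => hε _)).1 h1
    simp_rw [fun j : ℕ => (hid (t - j)).map_eq] at h2
    exact h2
  rw [key, key]

/-- A centered process that is a causal function of independent innovations, whose dependence on
the innovation at lag `h` is at most `ν h` in `L^p`. -/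
structure IsCausal (μ : Measure Ω) (ε : ℤ → Ω → S) (V : ℤ → Ω → H) (p : ℝ) (ν : ℤ → ℝ≥0∞) :
    Prop where
  measurable_innov : ∀ t, Measurable (ε t)
  indep_innov : iIndepFun ε μ
  memLp : ∀ t, MemLp (V t) (ENNReal.ofReal p) μ
  mean : ∀ t, ∫ x, V t x ∂μ = 0
  adapted : ∀ t, AEStronglyMeasurable[innovSigma ε (Set.Iic t)] (V t) μ
  dep : ∀ s k, eLpNorm (V s - μ[V s | innovSigma ε {k}ᶜ]) (ENNReal.ofReal p) μ ≤ ν (s - k)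

variable [TopologicalSpace.SeparableSpace H] [MeasurableSpace H] [BorelSpace H]

namespace HasPhysicalDependence

variable {ε : ℤ → Ω → S} {ε' : Ω → S} {g : (ℕ → S) → H} {V : ℤ → Ω → H} {p : ℝ}

lemma adapted (h : HasPhysicalDependence μ ε ε' g V p) (t : ℤ) :
    AEStronglyMeasurable[innovSigma ε (Set.Iic t)] (V t) μ := by
  rw [← pastSigma_eq_innovSigma]
  exact ⟨g ∘ past ε t, (h.measurable_repr.comp (comap_measurable _)).stronglyMeasurable,
    h.eq_repr t⟩

/-- The copy ε' is independent of all original innovations, so conditioning on it adds no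
information about V_t. Replacing ε_0 by ε' therefore has the effect of deleting ε_0. -/
lemma nu_eq (h : HasPhysicalDependence μ ε ε' g V p) (hV : ∀ t, Integrable (V t) μ) (q : ℝ)
    (t : ℤ) : nu μ ε ε' V q t =
      eLpNorm (V t - μ[V t | innovSigma ε (Set.Iic t \ {0})]) (ENNReal.ofReal q) μ := by
  refine eLpNorm_congr_ae ((EventuallyEq.refl _ _).sub ?_)
  rw [pastSigma_eq_innovSigma]
  have e1 : innovSigma (Function.update ε 0 ε') (Set.Iic t \ {0}) =
      innovSigma ε (Set.Iic t \ {0}) := by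
    refine biSup_congr fun i hi => ?_
    rw [Function.update_of_ne hi.2]
  rcases lt_or_ge t 0 with ht | ht
  · have : Set.Iic t \ {(0 : ℤ)} = Set.Iic t := by
      ext i; simp only [Set.mem_sdiff, Set.mem_Iic, Set.mem_singleton_iff]; lia
    rw [this] at e1 ⊢
    rw [e1]
  · have : Set.Iic t = Set.Iic t \ {(0 : ℤ)} ∪ {0} := by
      ext i; simp only [Set.mem_sdiff, Set.mem_Iic, Set.mem_singleton_iff, Set.mem_union]; lia
    rw [this, innovSigma_union, ← this, e1]
    have e2 : innovSigma (Function.update ε 0 ε') {0} = MeasurableSpace.comap ε' inferInstance := by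
      simp [innovSigma]
    rw [e2]
    refine condExp_sup_of_indep (innovSigma_le h.measurable_innov (Set.Iic t))
      h.measurable_copy.comap_le (innovSigma_mono ε Set.sdiff_subset) ?_ (hV t) (h.adapted t)
    have hi := h.indep_copy.symm
    rw [IndepFun_iff_Indep] at hi
    refine indep_of_indep_of_le_left hi (iSup₂_le fun i _ => ?_)
    rintro _ ⟨s, hs, rfl⟩
    exact ⟨(fun z : ℤ → S => z i) ⁻¹' s, measurable_pi_apply i hs, rfl⟩

/-- Shift invariance. On sequence space the norm depends only on g, the law of the past (the same at
all times) and the position s − k of the deleted coordinate, so deleting ε_k from V_s is the same as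
deleting ε_0 from V_{s−k}. -/
lemma eLpNorm_sub_condExp (h : HasPhysicalDependence μ ε ε' g V p) (hV : ∀ t, Integrable (V t) μ)
    (q : ℝ) (s k : ℤ) :
    eLpNorm (V s - μ[V s | innovSigma ε {k}ᶜ]) (ENNReal.ofReal q) μ = nu μ ε ε' V q (s - k) := by
  set m : ℤ → MeasurableSpace (ℕ → S) := fun d => ⨆ j : {j : ℕ // (j : ℤ) ≠ d},
    MeasurableSpace.comap (fun z : ℕ → S => z j) inferInstance with hm
  have hmle : ∀ d, m d ≤ MeasurableSpace.pi := fun d =>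
    iSup_le fun j => (measurable_pi_apply (j : ℕ)).comap_le
  have key : ∀ s k, eLpNorm (V s - μ[V s | innovSigma ε (Set.Iic s \ {k})]) (ENNReal.ofReal q) μ =
      eLpNorm (g - (μ.map (past ε 0))[g | m (s - k)]) (ENNReal.ofReal q) (μ.map (past ε 0)) := by
    intro s k
    have hp := measurable_past h.measurable_innov s
    have hgm : AEStronglyMeasurable g (μ.map (past ε s)) :=
      h.measurable_repr.aestronglyMeasurable
    have hg : Integrable g (μ.map (past ε s)) :=
      (integrable_map_measure hgm hp.aemeasurable).2 ((hV s).congr (h.eq_repr s))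
    have hc := condExp_comp_comap (μ := μ) (hmle (s - k)) hp hg
    rw [← map_past_eq h.measurable_innov h.indep_innov h.identDistrib_innov s,
      eLpNorm_map_measure (hgm.sub integrable_condExp.1) hp.aemeasurable]
    refine eLpNorm_congr_ae ?_
    rw [innovSigma_Iic_diff_eq_comap]
    filter_upwards [h.eq_repr s, hc, condExp_congr_ae (m := (m (s - k)).comap (past ε s))
      (h.eq_repr s)] with x h1 h2 h3
    simp only [Pi.sub_apply, Function.comp_apply] at *
    rw [h1, h3, ← h2]
    rfl
  have e := condExp_innovSigma_inter h.measurable_innov h.indep_innov (J' := {k}ᶜ) (hV s)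
    (h.adapted s)
  rw [eLpNorm_congr_ae ((EventuallyEq.refl _ _).sub e), ← Set.sdiff_eq, key, h.nu_eq hV, key,
    sub_zero]

lemma nu_eq_zero (h : HasPhysicalDependence μ ε ε' g V p) (hV : ∀ t, Integrable (V t) μ) (q : ℝ)
    {t : ℤ} (ht : t < 0) : nu μ ε ε' V q t = 0 := by
  rw [h.nu_eq hV]
  have : Set.Iic t \ {(0 : ℤ)} = Set.Iic t := by
    ext i; simp only [Set.mem_sdiff, Set.mem_Iic, Set.mem_singleton_iff]; lia
  rw [this]
  have e := condExp_of_aestronglyMeasurable' (innovSigma_le h.measurable_innov _) (h.adapted t) (hV t)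
  rw [eLpNorm_congr_ae ((EventuallyEq.refl _ _).sub e), sub_self, eLpNorm_zero]

lemma tsum_nu (h : HasPhysicalDependence μ ε ε' g V p) (hV : ∀ t, Integrable (V t) μ) (q : ℝ)
    (u : ℤ → ℝ≥0∞) :
    ∑' t : ℤ, u t * nu μ ε ε' V q t = ∑' j : ℕ, u j * nu μ ε ε' V q j := by
  have hinj : Function.Injective (fun j : ℕ => (j : ℤ)) := Nat.cast_injective
  refine (hinj.tsum_eq fun t ht => ?_).symm
  by_contra hc
  apply ht
  have : t < 0 := by
    by_contra h'
    exact hc ⟨t.toNat, by simp; lia⟩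
  simp only [h.nu_eq_zero hV q this, mul_zero]

lemma nu_mono (h : HasPhysicalDependence μ ε ε' g V p) (hV : ∀ t, Integrable (V t) μ) {q r : ℝ}
    (hqr : q ≤ r) (t : ℤ) : nu μ ε ε' V q t ≤ nu μ ε ε' V r t :=
  eLpNorm_le_eLpNorm_of_exponent_le (ENNReal.ofReal_le_ofReal hqr)
    ((hV t).1.sub integrable_condExp.1)

lemma isCausal (h : HasPhysicalDependence μ ε ε' g V p)
    {q : ℝ} (hq : 1 ≤ q) (hV : ∀ t, MemLp (V t) (ENNReal.ofReal q) μ)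
    (hmean : ∀ t, ∫ x, V t x ∂μ = 0) : IsCausal μ ε V q (nu μ ε ε' V q) where
  measurable_innov := h.measurable_innov
  indep_innov := h.indep_innov
  memLp := hV
  mean := hmean
  adapted := h.adapted
  dep s k := (h.eLpNorm_sub_condExp (fun t => (hV t).integrable (by
    rw [← ENNReal.ofReal_one]; exact ENNReal.ofReal_le_ofReal hq)) q s k).le

end HasPhysicalDependence

end PhysicalDependence

/-! ### Linear and quadratic forms in a causal process. -/

section Moments

/-- Young's inequality for the convolution of ℓ² with ℓ¹, proved by Cauchy–Schwarz after splitting ν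
into two square roots. -/
lemma tsum_convolution_sq_le (I : Finset ℤ) (α ν : ℤ → ℝ≥0∞) :
    ∑' k, (∑ t ∈ I, α t * ν (t - k)) ^ 2 ≤ (∑ t ∈ I, α t ^ 2) * (∑' k, ν k) ^ 2 := by
  have cs : ∀ k, (∑ t ∈ I, α t * ν (t - k)) ^ 2 ≤
      (∑ t ∈ I, α t ^ 2 * ν (t - k)) * ∑' k, ν k := by
    intro k
    have h := ENNReal.inner_le_Lp_mul_Lq I (fun t => α t * ν (t - k) ^ (1 / 2 : ℝ))
      (fun t => ν (t - k) ^ (1 / 2 : ℝ)) Real.HolderConjugate.two_two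
    have e1 : ∀ t, α t * ν (t - k) ^ (1 / 2 : ℝ) * ν (t - k) ^ (1 / 2 : ℝ) = α t * ν (t - k) :=
      fun t => by
        rw [mul_assoc, ← ENNReal.rpow_add_of_nonneg _ _ (by norm_num) (by norm_num)]; norm_num
    have e2 : ∀ t, (α t * ν (t - k) ^ (1 / 2 : ℝ)) ^ (2 : ℝ) = α t ^ 2 * ν (t - k) := fun t => by
      rw [ENNReal.mul_rpow_of_nonneg _ _ (by norm_num), ← ENNReal.rpow_mul]; norm_num
    have e3 : ∀ t, (ν (t - k) ^ (1 / 2 : ℝ)) ^ (2 : ℝ) = ν (t - k) := fun t => by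
      rw [← ENNReal.rpow_mul]; norm_num
    simp only [e1, e2, e3] at h
    have hsum : ∑ t ∈ I, ν (t - k) ≤ ∑' k, ν k :=
      (ENNReal.sum_le_tsum I).trans
        (ENNReal.tsum_comp_le_tsum_of_injective (sub_left_injective (b := k)) ν)
    calc (∑ t ∈ I, α t * ν (t - k)) ^ 2
        ≤ ((∑ t ∈ I, α t ^ 2 * ν (t - k)) ^ (1 / 2 : ℝ) *
          (∑ t ∈ I, ν (t - k)) ^ (1 / 2 : ℝ)) ^ 2 := by gcongr
      _ = (∑ t ∈ I, α t ^ 2 * ν (t - k)) * ∑ t ∈ I, ν (t - k) := by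
          rw [mul_pow, ← ENNReal.rpow_mul_natCast, ← ENNReal.rpow_mul_natCast]; norm_num
      _ ≤ _ := by gcongr
  refine (ENNReal.tsum_le_tsum cs).trans (le_of_eq ?_)
  rw [ENNReal.tsum_mul_right, Summable.tsum_finsetSum (fun _ _ => ENNReal.summable)]
  have : ∀ t, ∑' k, α t ^ 2 * ν (t - k) = α t ^ 2 * ∑' k, ν k := fun t => by
    rw [ENNReal.tsum_mul_left, ← (Equiv.subLeft t).tsum_eq ν]; rfl
  simp_rw [this]
  rw [← Finset.sum_mul]; ring

variable {Ω : Type*} {m0 : MeasurableSpace Ω} {μ : Measure Ω} [IsProbabilityMeasure μ]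
variable {S : Type*} [MeasurableSpace S]
variable {H : Type*} [NormedAddCommGroup H] [InnerProductSpace ℂ H] [CompleteSpace H]
variable {ε : ℤ → Ω → S} {V : ℤ → Ω → H} {p : ℝ} {ν : ℤ → ℝ≥0∞}

lemma IsCausal.integrable (h : IsCausal μ ε V p ν) (hp : 1 ≤ p) (t : ℤ) : Integrable (V t) μ :=
  (h.memLp t).integrable (by rw [← ENNReal.ofReal_one]; exact ENNReal.ofReal_le_ofReal hp)

lemma IsCausal.adapted_of_le (h : IsCausal μ ε V p ν) {t N : ℤ} (ht : t ≤ N) :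
    AEStronglyMeasurable[innovSigma ε (Set.Iic N)] (V t) μ :=
  (h.adapted t).mono (innovSigma_mono ε (Set.Iic_subset_Iic.2 ht))

/-- Moments of linear combinations of a causal process. -/
theorem IsCausal.eLpNorm_sum_smul_sq_le (h : IsCausal μ ε V p ν) (hp2 : 2 < p) (hp6 : p ≤ 6)
    (I : Finset ℤ) (a : ℤ → ℂ) :
    eLpNorm (fun x => ∑ t ∈ I, a t • V t x) (ENNReal.ofReal p) μ ^ 2 ≤
      560 * ((∑ t ∈ I, ‖a t‖ₑ ^ 2) * (∑' k, ν k) ^ 2) := by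
  have hp1 : 1 ≤ ENNReal.ofReal p := by
    rw [← ENNReal.ofReal_one]; exact ENNReal.ofReal_le_ofReal (by linarith)
  obtain ⟨N, hN⟩ : ∃ N, ∀ t ∈ I, t ≤ N := I.bddAbove
  have hmem : MemLp (fun x => ∑ t ∈ I, a t • V t x) (ENNReal.ofReal p) μ :=
    memLp_finsetSum I fun t _ => (h.memLp t).const_smul (a t)
  have hmean : ∫ x, ∑ t ∈ I, a t • V t x ∂μ = 0 := by
    rw [integral_finsetSum _ fun t _ => by exact (h.integrable (by linarith) t).smul (a t)]
    refine Finset.sum_eq_zero fun t _ => ?_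
    rw [integral_smul, h.mean, smul_zero]
  -- The comparison variable replaces each V_t by its conditional expectation without ε_k. The k-th
  -- dependence coefficient is then at most a convolution of |a| with ν.
  have key := eLpNorm_sub_integral_sq_le hp2 hp6 h.measurable_innov h.indep_innov N hmem
    (aestronglyMeasurable_finsetSum I fun t ht => (h.adapted_of_le (hN t ht)).const_smul (a t))
    (fun k => fun x => ∑ t ∈ I, a t • (μ[V t | innovSigma ε {k}ᶜ]) x)
    (fun k => integrable_finsetSum _ fun t _ => integrable_condExp.smul (a t))
    (fun k => by
      refine aestronglyMeasurable_finsetSum I fun t _ => ?_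
      exact (stronglyMeasurable_condExp (m := innovSigma ε {k}ᶜ)).aestronglyMeasurable.const_smul (a t))
  simp only [hmean, sub_zero] at key
  refine key.trans ?_
  gcongr
  refine le_trans (ENNReal.tsum_le_tsum fun k => ?_) (tsum_convolution_sq_le I (fun t => ‖a t‖ₑ) ν)
  gcongr
  have e : ((fun x => ∑ t ∈ I, a t • V t x) -
      fun x => ∑ t ∈ I, a t • (μ[V t | innovSigma ε {k}ᶜ]) x) =
      ∑ t ∈ I, a t • (V t - μ[V t | innovSigma ε {k}ᶜ]) := by
    ext x
    simp [smul_sub, Finset.sum_sub_distrib]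
  rw [e]
  refine (eLpNorm_sum_le (fun t _ => ((h.memLp t).1.sub integrable_condExp.1).const_smul (a t))
    hp1).trans (Finset.sum_le_sum fun t _ => ?_)
  rw [eLpNorm_const_smul]
  gcongr
  exact h.dep t k

variable {K : Type*} [NormedAddCommGroup K] [InnerProductSpace ℂ K] [CompleteSpace K]

lemma memLp_bilin (B : H →L[ℝ] H →L[ℝ] K) (hB : ∀ x y, ‖B x y‖ ≤ ‖x‖ * ‖y‖) {f g : Ω → H}
    (hf : MemLp f (ENNReal.ofReal p) μ) (hg : MemLp g (ENNReal.ofReal p) μ) :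
    MemLp (fun x => B (f x) (g x)) (ENNReal.ofReal (p / 2)) μ ∧
    eLpNorm (fun x => B (f x) (g x)) (ENNReal.ofReal (p / 2)) μ ≤
      eLpNorm f (ENNReal.ofReal p) μ * eLpNorm g (ENNReal.ofReal p) μ := by
  have : ENNReal.HolderTriple (ENNReal.ofReal p) (ENNReal.ofReal p) (ENNReal.ofReal (p / 2)) := by
    constructor
    rw [ENNReal.ofReal_div_of_pos two_pos, ENNReal.ofReal_ofNat, ENNReal.inv_div (by simp) (by simp),
      ← two_mul, div_eq_mul_inv]
  have hm := B.aestronglyMeasurable_comp₂ hf.1 hg.1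
  refine ⟨MemLp.of_bilin (fun x y => B x y) 1 hf hg hm
    (ae_of_all _ fun x => by simpa [← NNReal.coe_le_coe] using hB (f x) (g x)), ?_⟩
  have := eLpNorm_le_eLpNorm_mul_eLpNorm'_of_norm (p := ENNReal.ofReal p) (q := ENNReal.ofReal p)
    (r := ENNReal.ofReal (p / 2)) hf.1 hg.1 (fun x y => B x y) 1
    (ae_of_all _ fun x => by simpa using hB (f x) (g x))
  simpa using this

/-- Moments of quadratic forms in a causal process. -/
theorem IsCausal.eLpNorm_quadratic_sq_le (h : IsCausal μ ε V p ν) (hp4 : 4 < p) (hp6 : p ≤ 6)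
    (B : H →L[ℝ] H →L[ℝ] K) (hB : ∀ x y, ‖B x y‖ ≤ ‖x‖ * ‖y‖)
    (hBl : ∀ (c : ℂ) x y, B (c • x) y = c • B x y)
    (hBr : ∀ (c : ℂ) x y, B x (c • y) = starRingEnd ℂ c • B x y)
    (I : Finset ℤ) (c : ℤ → ℤ → ℂ) :
    eLpNorm (fun x => ∑ s ∈ I, ∑ t ∈ I, c s t • B (V s x) (V t x) -
      ∫ y, ∑ s ∈ I, ∑ t ∈ I, c s t • B (V s y) (V t y) ∂μ) (ENNReal.ofReal (p / 2)) μ ^ 2 ≤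
      1254400 * ((∑' k, ν k) ^ 4 * ∑ s ∈ I, ∑ t ∈ I, ‖c s t‖ₑ ^ 2) := by
  set q := ENNReal.ofReal (p / 2) with hq
  have hp1 : 1 ≤ ENNReal.ofReal p := by
    rw [← ENNReal.ofReal_one]; exact ENNReal.ofReal_le_ofReal (by linarith)
  have hq1 : 1 ≤ q := by
    rw [hq, ← ENNReal.ofReal_one]; exact ENNReal.ofReal_le_ofReal (by linarith)
  obtain ⟨N, hN⟩ : ∃ N, ∀ t ∈ I, t ≤ N := I.bddAbove
  set E : ℤ → ℤ → Ω → H := fun k t => μ[V t | innovSigma ε {k}ᶜ] with hE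
  have hEm : ∀ k t, MemLp (E k t) (ENNReal.ofReal p) μ := fun k t => (h.memLp t).condExp hp1
  have hsub : ∀ k t, MemLp (V t - E k t) (ENNReal.ofReal p) μ := fun k t => (h.memLp t).sub (hEm k t)
  have hterm : ∀ (U W : ℤ → Ω → H), (∀ t, MemLp (U t) (ENNReal.ofReal p) μ) →
      (∀ t, MemLp (W t) (ENNReal.ofReal p) μ) →
      MemLp (fun x => ∑ s ∈ I, ∑ t ∈ I, c s t • B (U s x) (W t x)) q μ := fun U W hU hW =>
    memLp_finsetSum I fun s _ => memLp_finsetSum I fun t _ =>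
      ((memLp_bilin B hB (hU s) (hW t)).1.const_smul (c s t))
  have hmeas : ∀ {m : MeasurableSpace Ω} (U : ℤ → Ω → H),
      (∀ t ∈ I, AEStronglyMeasurable[m] (U t) μ) →
      AEStronglyMeasurable[m] (fun x => ∑ s ∈ I, ∑ t ∈ I, c s t • B (U s x) (U t x)) μ := by
    intro m U hU
    refine aestronglyMeasurable_finsetSum I fun s hs => ?_
    refine aestronglyMeasurable_finsetSum I fun t ht => ?_
    exact (B.continuous₂.comp_aestronglyMeasurable₂ (hU s hs) (hU t ht)).const_smul (c s t)
  have key := eLpNorm_sub_integral_sq_le (q := p / 2) (by linarith) (by linarith)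
    h.measurable_innov h.indep_innov N (hterm V V h.memLp h.memLp)
    (hmeas V fun t ht => h.adapted_of_le (hN t ht))
    (fun k => fun x => ∑ s ∈ I, ∑ t ∈ I, c s t • B (E k s x) (E k t x))
    (fun k => (hterm (E k) (E k) (hEm k) (hEm k)).integrable hq1)
    (fun k => hmeas (E k) fun t _ => stronglyMeasurable_condExp.aestronglyMeasurable)
  refine key.trans ?_
  set Θ := ∑' k, ν k with hΘ
  -- β and γ are norms of linear forms along rows and columns of the coefficients. The conjugate
  -- appears because B is conjugate linear in its second argument.
  set β : ℤ → ℝ≥0∞ := fun s =>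
    eLpNorm (fun x => ∑ t ∈ I, starRingEnd ℂ (c s t) • V t x) (ENNReal.ofReal p) μ with hβ
  set γ : ℤ → ℝ≥0∞ := fun t =>
    eLpNorm (fun x => ∑ s ∈ I, c s t • V s x) (ENNReal.ofReal p) μ with hγ
  have hβ2 : ∀ s, β s ^ 2 ≤ 560 * ((∑ t ∈ I, ‖c s t‖ₑ ^ 2) * Θ ^ 2) := fun s => by
    have := h.eLpNorm_sum_smul_sq_le (by linarith) hp6 I (fun t => starRingEnd ℂ (c s t))
    simpa only [RCLike.enorm_conj] using this
  have hγ2 : ∀ t, γ t ^ 2 ≤ 560 * ((∑ s ∈ I, ‖c s t‖ₑ ^ 2) * Θ ^ 2) := fun t =>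
    h.eLpNorm_sum_smul_sq_le (by linarith) hp6 I (fun s => c s t)
  have hk : ∀ k, eLpNorm ((fun x => ∑ s ∈ I, ∑ t ∈ I, c s t • B (V s x) (V t x)) -
      fun x => ∑ s ∈ I, ∑ t ∈ I, c s t • B (E k s x) (E k t x)) q μ ≤
      ∑ s ∈ I, β s * ν (s - k) + ∑ t ∈ I, γ t * ν (t - k) := by
    intro k
    -- Replace one factor at a time: B(V_s, V_t) − B(E_s, E_t) = B(V_s − E_s, V_t) + B(E_s, V_t −
    -- E_t). Summing the undisturbed factor first, before taking norms, keeps the ℓ² size of the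
    -- coefficients.
    have e : ((fun x => ∑ s ∈ I, ∑ t ∈ I, c s t • B (V s x) (V t x)) -
        fun x => ∑ s ∈ I, ∑ t ∈ I, c s t • B (E k s x) (E k t x)) =
        (∑ s ∈ I, fun x => B ((V s - E k s) x) (∑ t ∈ I, starRingEnd ℂ (c s t) • V t x)) +
        ∑ t ∈ I, fun x => B (∑ s ∈ I, c s t • E k s x) ((V t - E k t) x) := by
      ext x
      simp only [Pi.sub_apply, Pi.add_apply, Finset.sum_apply, map_sum, hBr, hBl,
        sum_apply, map_sub, sub_apply,
        RingHomCompTriple.comp_apply, RingHom.id_apply]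
      simp_rw [Finset.sum_sub_distrib]
      rw [Finset.sum_comm (f := fun t s => c s t • B (E k s x) (V t x)),
        Finset.sum_comm (f := fun t s => c s t • B (E k s x) (E k t x))]
      abel
    have hlin : ∀ (U : ℤ → Ω → H), (∀ t, MemLp (U t) (ENNReal.ofReal p) μ) → ∀ a : ℤ → ℂ,
        MemLp (fun x => ∑ t ∈ I, a t • U t x) (ENNReal.ofReal p) μ := fun U hU a =>
      memLp_finsetSum I fun t _ => (hU t).const_smul (a t)
    have b1 := fun s => memLp_bilin B hB (hsub k s) (hlin V h.memLp fun t => starRingEnd ℂ (c s t))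
    have b2 := fun t => memLp_bilin B hB (hlin (E k) (hEm k) fun s => c s t) (hsub k t)
    rw [e]
    refine (eLpNorm_add_le (Finset.aestronglyMeasurable_sum I fun s _ => (b1 s).1.1)
      (Finset.aestronglyMeasurable_sum I fun t _ => (b2 t).1.1) hq1).trans (add_le_add ?_ ?_)
    · refine (eLpNorm_sum_le (fun s _ => (b1 s).1.1) hq1).trans (Finset.sum_le_sum fun s _ => ?_)
      refine (b1 s).2.trans ?_
      rw [mul_comm]
      exact mul_le_mul' le_rfl (h.dep s k)
    · refine (eLpNorm_sum_le (fun s _ => (b2 s).1.1) hq1).trans (Finset.sum_le_sum fun t _ => ?_)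
      refine (b2 t).2.trans (mul_le_mul' ?_ (h.dep t k))
      -- This linear form is the conditional expectation of the one in V, so by contraction its norm
      -- is at most γ t.
      have ec : (fun x => ∑ s ∈ I, c s t • E k s x) =ᵐ[μ]
          μ[fun x => ∑ s ∈ I, c s t • V s x | innovSigma ε {k}ᶜ] := by
        have h1 := condExp_finsetSum (μ := μ) (s := I) (f := fun s => c s t • V s)
          (fun s _ => (h.integrable (by linarith) s).smul (c s t)) (innovSigma ε {k}ᶜ)
        have h2 : ∀ s ∈ I, μ[c s t • V s | innovSigma ε {k}ᶜ] =ᵐ[μ] c s t • E k s := fun s _ =>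
          condExp_smul (c s t) (V s) _
        have h3 := (Finset.eventually_all I).2 h2
        have e3 : (fun x => ∑ s ∈ I, c s t • V s x) = ∑ s ∈ I, c s t • V s := by
          ext x; simp
        rw [e3]
        filter_upwards [h1, h3] with x hx1 hx3
        rw [hx1, Finset.sum_apply]
        exact Finset.sum_congr rfl fun s hs => (hx3 s hs).symm
      rw [eLpNorm_congr_ae ec]
      exact eLpNorm_condExp_le_eLpNorm _ hp1
  have hsq : ∀ a b : ℝ≥0∞, (a + b) ^ 2 ≤ 2 * a ^ 2 + 2 * b ^ 2 := fun a b => by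
    have := ENNReal.rpow_add_le_mul_rpow_add_rpow a b (p := 2) (by norm_num)
    norm_num at this
    rwa [mul_add] at this
  calc 560 * ∑' k, eLpNorm ((fun x => ∑ s ∈ I, ∑ t ∈ I, c s t • B (V s x) (V t x)) -
          fun x => ∑ s ∈ I, ∑ t ∈ I, c s t • B (E k s x) (E k t x)) q μ ^ 2
      ≤ 560 * ∑' k, (2 * (∑ s ∈ I, β s * ν (s - k)) ^ 2 + 2 * (∑ t ∈ I, γ t * ν (t - k)) ^ 2) := by
        gcongr with k
        exact (pow_le_pow_left' (hk k) 2).trans (hsq _ _)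
    _ ≤ 560 * (2 * ((∑ s ∈ I, β s ^ 2) * Θ ^ 2) + 2 * ((∑ t ∈ I, γ t ^ 2) * Θ ^ 2)) := by
        rw [ENNReal.tsum_add, ENNReal.tsum_mul_left, ENNReal.tsum_mul_left]
        gcongr
        · exact tsum_convolution_sq_le I β ν
        · exact tsum_convolution_sq_le I γ ν
    _ ≤ 560 * (2 * ((∑ s ∈ I, 560 * ((∑ t ∈ I, ‖c s t‖ₑ ^ 2) * Θ ^ 2)) * Θ ^ 2) +
          2 * ((∑ t ∈ I, 560 * ((∑ s ∈ I, ‖c s t‖ₑ ^ 2) * Θ ^ 2)) * Θ ^ 2)) := by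
        gcongr with s _ t _
        · exact hβ2 s
        · exact hγ2 t
    _ = _ := by
        simp_rw [← Finset.mul_sum, ← Finset.sum_mul]
        rw [Finset.sum_comm (f := fun t s => ‖c s t‖ₑ ^ 2)]
        ring

end Moments

/-! ### Hilbert-Schmidt operators as square summable families of vectors. -/

noncomputable section HilbertSchmidtSpace

variable {H : Type*} [NormedAddCommGroup H] [InnerProductSpace ℂ H]
variable {ι : Type*} (e : HilbertBasis ι ℂ H)

lemma lp_two_summable_norm_sq {G : ι → Type*} [∀ i, NormedAddCommGroup (G i)] (k : lp G 2) :
    Summable fun i => ‖k i‖ ^ 2 := by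
  have := (memℓp_gen_iff (p := 2) (by norm_num)).1 (lp.memℓp k)
  simpa using this

lemma lp_two_norm_sq {G : ι → Type*} [∀ i, NormedAddCommGroup (G i)] (k : lp G 2) :
    ‖k‖ ^ 2 = ∑' i, ‖k i‖ ^ 2 := by
  have := lp.norm_rpow_eq_tsum (p := 2) (by norm_num) k
  simpa using this

lemma hasSum_basis_pairing_bound (k : lp (fun _ : ι => H) 2) (v : H) :
    Summable (fun i => ‖e.repr v i‖ * ‖k i‖) ∧ ∑' i, ‖e.repr v i‖ * ‖k i‖ ≤ ‖k‖ * ‖v‖ := by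
  have h1 := lp_two_summable_norm_sq (e.repr v)
  have h2 := lp_two_summable_norm_sq k
  have e1 := lp_two_norm_sq (e.repr v)
  have e2 := lp_two_norm_sq k
  rw [LinearIsometryEquiv.norm_map] at e1
  have := Real.summable_and_inner_le_Lp_mul_Lq_tsum_of_nonneg Real.HolderConjugate.two_two
    (f := fun i => ‖e.repr v i‖) (g := fun i => ‖k i‖) (fun _ => norm_nonneg _)
    (fun _ => norm_nonneg _) (by simpa using h1) (by simpa using h2)
  refine ⟨this.1, this.2.trans (le_of_eq ?_)⟩
  simp only [Real.rpow_ofNat, ← e1, ← e2, ← Real.sqrt_eq_rpow]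
  rw [Real.sqrt_sq (norm_nonneg _), Real.sqrt_sq (norm_nonneg _), mul_comm]

variable [CompleteSpace H]

lemma summable_basis_pairing (k : lp (fun _ : ι => H) 2) (v : H) :
    Summable fun i => e.repr v i • k i :=
  Summable.of_norm (by simpa only [norm_smul] using (hasSum_basis_pairing_bound e k v).1)

/-- The operator whose values on the basis vectors are the entries of a square summable family. -/
def hsOperator : lp (fun _ : ι => H) 2 →L[ℂ] H →L[ℂ] H :=
  LinearMap.mkContinuous₂
    (LinearMap.mk₂ ℂ (fun (k : lp (fun _ : ι => H) 2) v => ∑' i, e.repr v i • k i)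
      (fun k l v => by
        rw [← (summable_basis_pairing e k v).tsum_add (summable_basis_pairing e l v)]
        exact tsum_congr fun i => by rw [lp.coeFn_add, Pi.add_apply, smul_add])
      (fun c k v => by
        rw [← tsum_const_smul'']
        exact tsum_congr fun i => by rw [lp.coeFn_smul, Pi.smul_apply, smul_comm])
      (fun k v v' => by
        rw [← (summable_basis_pairing e k v).tsum_add (summable_basis_pairing e k v')]
        exact tsum_congr fun i => by rw [map_add, lp.coeFn_add, Pi.add_apply, add_smul])
      (fun c k v => by
        rw [← tsum_const_smul'']
        exact tsum_congr fun i => by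
          rw [map_smul, lp.coeFn_smul, Pi.smul_apply, smul_eq_mul, mul_smul])) 1
    (fun k v => by
      rw [one_mul]
      refine (norm_tsum_le_tsum_norm ?_).trans (le_trans (le_of_eq ?_)
        (hasSum_basis_pairing_bound e k v).2)
      · simpa only [norm_smul] using (hasSum_basis_pairing_bound e k v).1
      · simp only [norm_smul])

lemma hsOperator_apply (k : lp (fun _ : ι => H) 2) (v : H) :
    hsOperator e k v = ∑' i, e.repr v i • k i := rfl

lemma hsOperator_apply_basis (k : lp (fun _ : ι => H) 2) (j : ι) :
    hsOperator e k (e j) = k j := by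
  classical
  rw [hsOperator_apply, tsum_eq_single j]
  · simp [e.repr_self]
  · intro i hi
    simp [e.repr_self, Pi.single_eq_of_ne hi]

lemma isHilbertSchmidt_hsOperator (k : lp (fun _ : ι => H) 2) :
    IsHilbertSchmidt e (hsOperator e k) := by
  simp only [IsHilbertSchmidt, hsOperator_apply_basis]
  exact lp_two_summable_norm_sq k

lemma hsNorm_hsOperator (k : lp (fun _ : ι => H) 2) : hsNorm e (hsOperator e k) = ‖k‖ := by
  simp only [hsNorm, hsOperator_apply_basis]
  rw [← lp_two_norm_sq, Real.sqrt_sq (norm_nonneg k)]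

lemma hsInner_hsOperator (k l : lp (fun _ : ι => H) 2) :
    hsInner e (hsOperator e k) (hsOperator e l) = inner ℂ l k := by
  simp only [hsInner, hsOperator_apply_basis]
  exact (lp.inner_eq_tsum l k).symm

/-- The rank one operator `f ⊗ g` as a square summable family. -/
def hsTensorFun (f g : H) : lp (fun _ : ι => H) 2 :=
  ⟨fun i => starRingEnd ℂ (e.repr g i) • f, by
    refine memℓp_gen ?_
    have := (lp_two_summable_norm_sq (e.repr g)).mul_right (‖f‖ ^ 2)
    simpa [norm_smul, mul_pow] using this⟩

lemma hsTensorFun_apply (f g : H) (i : ι) :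
    hsTensorFun e f g i = starRingEnd ℂ (e.repr g i) • f := rfl

lemma norm_hsTensorFun (f g : H) : ‖hsTensorFun e f g‖ = ‖f‖ * ‖g‖ := by
  have h : ‖hsTensorFun e f g‖ ^ 2 = (‖f‖ * ‖g‖) ^ 2 := by
    rw [lp_two_norm_sq]
    simp only [hsTensorFun_apply, norm_smul, RCLike.norm_conj, mul_pow]
    rw [tsum_mul_right, ← lp_two_norm_sq, LinearIsometryEquiv.norm_map, mul_comm]
  exact (sq_eq_sq₀ (norm_nonneg _) (by positivity)).1 h

/-- The tensor product `(f, g) ↦ f ⊗ g` as a continuous real bilinear map. -/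
def hsTensor : H →L[ℝ] H →L[ℝ] lp (fun _ : ι => H) 2 :=
  LinearMap.mkContinuous₂
    (LinearMap.mk₂ ℝ (hsTensorFun e)
      (fun f f' g => by ext i; simp [hsTensorFun_apply])
      (fun c f g => by
        ext i
        simp only [hsTensorFun_apply, lp.coeFn_smul, Pi.smul_apply]
        rw [smul_comm])
      (fun f g g' => by ext i; simp [hsTensorFun_apply, add_smul])
      (fun c f g => by
        ext i
        simp only [hsTensorFun_apply, lp.coeFn_smul, Pi.smul_apply, e.repr_apply_apply,
          inner_smul_right_eq_smul]
        rw [← Complex.coe_smul, smul_eq_mul, map_mul, Complex.conj_ofReal, mul_smul,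
          Complex.coe_smul])) 1
    (fun f g => by
      rw [LinearMap.mk₂_apply, norm_hsTensorFun, one_mul])

lemma hsTensor_apply (f g : H) (i : ι) :
    hsTensor e f g i = starRingEnd ℂ (e.repr g i) • f := rfl

lemma norm_hsTensor (f g : H) : ‖hsTensor e f g‖ = ‖f‖ * ‖g‖ := norm_hsTensorFun e f g

lemma hsTensor_smul_left (c : ℂ) (f g : H) : hsTensor e (c • f) g = c • hsTensor e f g := by
  ext i
  simp only [hsTensor_apply, lp.coeFn_smul, Pi.smul_apply]
  rw [smul_comm]

lemma hsTensor_smul_right (c : ℂ) (f g : H) :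
    hsTensor e f (c • g) = starRingEnd ℂ c • hsTensor e f g := by
  ext i
  simp only [hsTensor_apply, lp.coeFn_smul, Pi.smul_apply, map_smul, smul_eq_mul, map_mul, mul_smul]

lemma ext_basis {A B : H →L[ℂ] H} (h : ∀ i, A (e i) = B (e i)) : A = B := by
  refine ContinuousLinearMap.ext_on (s := Set.range e) ?_ ?_
  · rw [Submodule.dense_iff_topologicalClosure_eq_top]
    exact e.dense_span
  · rintro _ ⟨i, rfl⟩
    exact h i

lemma hsOperator_hsTensor (f g : H) : hsOperator e (hsTensor e f g) = tensor f g := by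
  refine ext_basis e fun i => ?_
  rw [hsOperator_apply_basis, hsTensor_apply, tensor, InnerProductSpace.rankOne_apply,
    e.repr_apply_apply, inner_conj_symm]

end HilbertSchmidtSpace

/-! ### Second moments of maxima over an initial segment. -/

section Chaining

variable {Ω : Type*} [MeasurableSpace Ω] {μ : Measure Ω} [IsProbabilityMeasure μ]
variable {E : Type*} [NormedAddCommGroup E]

lemma lintegral_rpow_two_le {q : ℝ} (hq : 2 < q) {M : Ω → ℝ≥0∞} (hM : AEMeasurable M μ) :
    ∫⁻ x, M x ^ 2 ∂μ ≤ ((∫⁻ x, M x ^ q ∂μ) ^ (1 / q)) ^ 2 := by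
  have hq0 : 0 < q := by linarith
  have h := ENNReal.lintegral_mul_le_Lp_mul_Lq μ (p := q / 2) (q := q / (q - 2)) (by
    rw [Real.holderConjugate_iff]
    refine ⟨by linarith, ?_⟩
    field_simp [show q - 2 ≠ 0 by linarith]; ring) (hM.pow_const 2) (aemeasurable_const (b := 1))
  simp only [Pi.mul_apply, mul_one, ENNReal.one_rpow, lintegral_const, measure_univ] at h
  refine h.trans (le_of_eq ?_)
  rw [← ENNReal.rpow_natCast, ← ENNReal.rpow_mul]
  congr 1
  · refine lintegral_congr fun x => ?_
    rw [← ENNReal.rpow_natCast, ← ENNReal.rpow_mul]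
    congr 1; push_cast; ring
  · push_cast; field_simp

/-- Chaining runs over the dyadic block of length 2^{⌈log₂ T⌉} ≤ 2T, which accounts for the factor
2. The passage from L^q to L² is Jensen's inequality. As A bounds squared norms, chaining is applied
with its square root. -/
theorem lintegral_max_sq_le {q : ℝ} (hq : 2 < q) {A : ℝ≥0∞} (Q : ℕ → Ω → E)
    (hQ : ∀ n, AEStronglyMeasurable (Q n) μ) (hQ0 : Q 0 = 0)
    (h : ∀ m n, m ≤ n → eLpNorm (Q n - Q m) (ENNReal.ofReal q) μ ^ 2 ≤
      A * ENNReal.ofReal ((n : ℝ) - m)) {T : ℕ} (hT : 1 ≤ T) :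
    ∫⁻ x, ⨆ n ∈ Finset.range (T + 1), ‖Q n x‖ₑ ^ 2 ∂μ ≤
      ENNReal.ofReal (2 * (1 / (√2 - 2 ^ (1 / q))) ^ 2) * (A * T) := by
  have hq0 : 0 < q := by linarith
  have hqr : (ENNReal.ofReal q).toReal = q := ENNReal.toReal_ofReal hq0.le
  have hlt : (2 : ℝ) ^ (1 / q) < √2 := by
    rw [Real.sqrt_eq_rpow]
    exact Real.rpow_lt_rpow_of_exponent_lt (by norm_num) (one_div_lt_one_div_of_lt (by norm_num) hq)
  obtain ⟨M, hM, hb, hn⟩ := exists_dyadic_max (μ := μ) hq (A := A ^ (1 / 2 : ℝ)) (Nat.clog 2 T) 0 Q hQ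
    (fun m n hmn => by
      have h1 := ENNReal.rpow_le_rpow (h m n hmn) (by norm_num : (0 : ℝ) ≤ 1 / 2)
      rw [← ENNReal.rpow_natCast, ← ENNReal.rpow_mul, ENNReal.mul_rpow_of_nonneg _ _ (by norm_num),
        ENNReal.ofReal_rpow_of_nonneg (by simpa using hmn) (by norm_num), ← Real.sqrt_eq_rpow,
        eLpNorm_eq_lintegral_rpow_enorm_toReal (by simpa using hq0) ENNReal.ofReal_ne_top, hqr] at h1
      norm_num at h1 ⊢
      exact h1)
  have h2k : (2 : ℝ) ^ Nat.clog 2 T ≤ 2 * T := by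
    rcases hT.eq_or_lt with rfl | hT'
    · norm_num
    · have := Nat.pow_pred_clog_lt_self (b := 2) (by norm_num) hT'
      have hpos : 0 < Nat.clog 2 T := Nat.clog_pos (by norm_num) (by omega)
      have e : 2 ^ Nat.clog 2 T = 2 * 2 ^ (Nat.clog 2 T).pred := by
        rw [← pow_succ']; congr 1; rw [← Nat.succ_eq_add_one, Nat.succ_pred hpos.ne']
      have : 2 ^ Nat.clog 2 T ≤ 2 * T := by omega
      exact_mod_cast this
  calc ∫⁻ x, ⨆ n ∈ Finset.range (T + 1), ‖Q n x‖ₑ ^ 2 ∂μ ≤ ∫⁻ x, M x ^ 2 ∂μ := by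
        refine lintegral_mono fun x => iSup₂_le fun n hn => ?_
        have h1 := hb n (Nat.zero_le n) (by
          rw [zero_add]
          exact (Nat.lt_succ_iff.1 (Finset.mem_range.1 hn)).trans
            (Nat.le_pow_clog (by norm_num) T)) x
        rw [hQ0, Pi.zero_apply, sub_zero] at h1
        gcongr
    _ ≤ ((∫⁻ x, M x ^ q ∂μ) ^ (1 / q)) ^ 2 := lintegral_rpow_two_le hq hM
    _ ≤ (ENNReal.ofReal (1 / (√2 - 2 ^ (1 / q))) * A ^ (1 / 2 : ℝ) *
          ENNReal.ofReal (√(2 ^ Nat.clog 2 T))) ^ 2 := by gcongr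
    _ = ENNReal.ofReal ((1 / (√2 - 2 ^ (1 / q))) ^ 2) * A * ENNReal.ofReal (2 ^ Nat.clog 2 T) := by
        rw [mul_pow, mul_pow, ← ENNReal.ofReal_pow (one_div_nonneg.2 (by linarith)),
          ← ENNReal.ofReal_pow (Real.sqrt_nonneg _), Real.sq_sqrt (by positivity),
          ← ENNReal.rpow_natCast, ← ENNReal.rpow_mul]
        norm_num
    _ ≤ ENNReal.ofReal ((1 / (√2 - 2 ^ (1 / q))) ^ 2) * A * ENNReal.ofReal (2 * T) := by gcongr
    _ = _ := by
        rw [ENNReal.ofReal_mul two_pos.le, ENNReal.ofReal_mul two_pos.le, ENNReal.ofReal_natCast]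
        ring

end Chaining

/-! ### Sequential lag window sums. -/

section QuadraticSums

variable {Ω : Type*} {m0 : MeasurableSpace Ω} {μ : Measure Ω} [IsProbabilityMeasure μ]
variable {S : Type*} [MeasurableSpace S]
variable {H : Type*} [NormedAddCommGroup H] [InnerProductSpace ℂ H] [CompleteSpace H]
variable {ι : Type*} (e : HilbertBasis ι ℂ H)
variable {ε : ℤ → Ω → S} {V : ℤ → Ω → H} {p : ℝ} {ν : ℤ → ℝ≥0∞}

/-- The sum `∑_{s,t=1}^n w̃_{b,s,t}^{(ω)} V_s ⊗ V_t` in the space of Hilbert-Schmidt operators. -/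
noncomputable def quadSum (w : ℝ → ℝ) (V : ℤ → Ω → H) (b ω : ℝ) (n : ℕ) (x : Ω) :
    lp (fun _ : ι => H) 2 :=
  ∑ s ∈ Finset.Icc 1 n, ∑ t ∈ Finset.Icc 1 n,
    lagWeight w b ω s t • hsTensor e (V s x) (V t x)

lemma enorm_lagWeight_sq_le (w : ℝ → ℝ) (b ω : ℝ) (s t : ℕ) :
    ‖lagWeight w b ω s t‖ₑ ^ 2 ≤ ENNReal.ofReal (w (b * ((t - s : ℤ) : ℝ)) ^ 2) := by
  have h1 : ‖lagWeight w b ω s t‖ ≤ |w (b * ((t : ℝ) - s))| := by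
    have he : ‖Complex.exp (Complex.I * ω * ((t : ℂ) - s))‖ = 1 := by
      rw [show Complex.I * ω * ((t : ℂ) - s) = ((ω * ((t : ℝ) - s) : ℝ) : ℂ) * Complex.I by
        push_cast; ring, Complex.norm_exp_ofReal_mul_I]
    have hpi : ‖((2 * Real.pi)⁻¹ : ℂ)‖ ≤ 1 := by
      rw [norm_inv, norm_mul, Complex.norm_real, Complex.norm_ofNat, Real.norm_of_nonneg Real.pi_pos.le]
      exact inv_le_one_of_one_le₀ (by linarith [Real.pi_gt_three])
    rw [lagWeight, norm_mul, norm_mul, he, mul_one, Complex.norm_real, Real.norm_eq_abs]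
    exact mul_le_of_le_one_left (abs_nonneg _) hpi
  rw [← ofReal_norm, ← ENNReal.ofReal_pow (norm_nonneg _)]
  refine ENNReal.ofReal_le_ofReal ?_
  rw [← sq_abs (w _)]
  push_cast
  gcongr

lemma sum_Icc_eq_sum_ite {M : Type*} [AddCommMonoid M] {m n : ℕ} (h : m ≤ n) (g : ℕ → M) :
    ∑ s ∈ Finset.Icc 1 m, g s = ∑ s ∈ Finset.Icc 1 n, if s ≤ m then g s else 0 := by
  rw [← Finset.sum_filter]
  congr 1
  ext i
  simp only [Finset.mem_Icc, Finset.mem_filter]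
  omega

/-- In the L-shaped region [1,n]² \ [1,m]² one of the indices exceeds m, which leaves n − m choices
for it. For each choice the sum over the other index is at most the full sum of f. -/
lemma sum_sum_ite_le {m n : ℕ} (h : m ≤ n) (f : ℤ → ℝ≥0∞) :
    ∑ s ∈ Finset.Icc 1 n, ∑ t ∈ Finset.Icc 1 n, (if s ≤ m ∧ t ≤ m then 0 else f (t - s : ℤ)) ≤
      2 * (ENNReal.ofReal ((n : ℝ) - m) * ∑' k, f k) := by
  have hle : ∀ s t : ℕ, (if s ≤ m ∧ t ≤ m then 0 else f (t - s : ℤ)) ≤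
      (if s ≤ m then 0 else f (t - s : ℤ)) + if t ≤ m then 0 else f (t - s : ℤ) := by
    intro s t
    by_cases hs : s ≤ m <;> by_cases ht : t ≤ m <;> simp [hs, ht]
  have hcard : ∑ s ∈ Finset.Icc 1 n, (if s ≤ m then 0 else ∑' k, f k) =
      ENNReal.ofReal ((n : ℝ) - m) * ∑' k, f k := by
    rw [← Nat.cast_sub h, ENNReal.ofReal_natCast]
    simp_rw [← not_lt, ite_not]
    rw [← Finset.sum_filter, Finset.sum_const, nsmul_eq_mul]
    congr 2
    have : (Finset.Icc 1 n).filter (fun s => m < s) = Finset.Ioc m n := by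
      ext i; simp only [Finset.mem_Icc, Finset.mem_filter, Finset.mem_Ioc]; omega
    rw [this, Nat.card_Ioc]
  have h1 : ∀ s : ℕ, ∑ t ∈ Finset.Icc 1 n, f (t - s : ℤ) ≤ ∑' k, f k := fun s =>
    (ENNReal.sum_le_tsum _).trans (ENNReal.tsum_comp_le_tsum_of_injective
      (f := fun t : ℕ => (t - s : ℤ)) (fun a b h => by simpa using h) f)
  have h2 : ∀ t : ℕ, ∑ s ∈ Finset.Icc 1 n, f (t - s : ℤ) ≤ ∑' k, f k := fun t =>
    (ENNReal.sum_le_tsum _).trans (ENNReal.tsum_comp_le_tsum_of_injective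
      (f := fun s : ℕ => (t - s : ℤ)) (fun a b h => by simpa using h) f)
  calc _ ≤ ∑ s ∈ Finset.Icc 1 n, ∑ t ∈ Finset.Icc 1 n,
        ((if s ≤ m then 0 else f (t - s : ℤ)) + if t ≤ m then 0 else f (t - s : ℤ)) :=
        Finset.sum_le_sum fun s _ => Finset.sum_le_sum fun t _ => hle s t
    _ = ∑ s ∈ Finset.Icc 1 n, (if s ≤ m then 0 else ∑ t ∈ Finset.Icc 1 n, f (t - s : ℤ)) +
        ∑ t ∈ Finset.Icc 1 n, (if t ≤ m then 0 else ∑ s ∈ Finset.Icc 1 n, f (t - s : ℤ)) := by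
        simp_rw [Finset.sum_add_distrib]
        congr 1
        · refine Finset.sum_congr rfl fun s _ => ?_
          by_cases hs : s ≤ m <;> simp [hs]
        · rw [Finset.sum_comm]
          refine Finset.sum_congr rfl fun s _ => ?_
          by_cases hs : s ≤ m <;> simp [hs]
    _ ≤ ∑ s ∈ Finset.Icc 1 n, (if s ≤ m then 0 else ∑' k, f k) +
        ∑ t ∈ Finset.Icc 1 n, (if t ≤ m then 0 else ∑' k, f k) := by
        gcongr with s _ t _
        · split_ifs
          exacts [le_rfl, h1 s]
        · split_ifs
          exacts [le_rfl, h2 t]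
    _ = _ := by rw [hcard, two_mul]

lemma IsCausal.memLp_quadSum (h : IsCausal μ ε V p ν) (w : ℝ → ℝ) (b ω : ℝ) (n : ℕ) :
    MemLp (quadSum e w V b ω n) (ENNReal.ofReal (p / 2)) μ :=
  memLp_finsetSum _ fun s _ => memLp_finsetSum _ fun t _ =>
    ((memLp_bilin (hsTensor e) (fun x y => (norm_hsTensor e x y).le) (h.memLp s)
      (h.memLp t)).1.const_smul (lagWeight w b ω s t))

lemma IsCausal.integrable_quadSum (h : IsCausal μ ε V p ν) (hp : 2 ≤ p) (w : ℝ → ℝ) (b ω : ℝ)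
    (n : ℕ) : Integrable (quadSum e w V b ω n) μ :=
  (h.memLp_quadSum e w b ω n).integrable (by
    rw [← ENNReal.ofReal_one]; exact ENNReal.ofReal_le_ofReal (by linarith))

/-- The increment from m to n is a quadratic form with coefficients set to zero on [1,m]². The bound
is linear in n − m, as the chaining argument requires. -/
theorem IsCausal.eLpNorm_quadSum_increment_sq_le (h : IsCausal μ ε V p ν) (hp4 : 4 < p)
    (hp6 : p ≤ 6) (w : ℝ → ℝ) (b ω : ℝ) {m n : ℕ} (hmn : m ≤ n) :
    eLpNorm ((fun x => quadSum e w V b ω n x - ∫ y, quadSum e w V b ω n y ∂μ) -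
      fun x => quadSum e w V b ω m x - ∫ y, quadSum e w V b ω m y ∂μ)
      (ENNReal.ofReal (p / 2)) μ ^ 2 ≤
      2508800 * (∑' k, ν k) ^ 4 * (∑' k : ℤ, ENNReal.ofReal (w (b * k) ^ 2)) *
        ENNReal.ofReal ((n : ℝ) - m) := by
  set I : Finset ℤ := (Finset.Icc 1 n).map Nat.castEmbedding with hI
  set c : ℤ → ℤ → ℂ := fun s t => if s.toNat ≤ m ∧ t.toNat ≤ m then 0 else
    lagWeight w b ω s.toNat t.toNat with hc
  have key := h.eLpNorm_quadratic_sq_le hp4 hp6 (hsTensor e) (fun x y => (norm_hsTensor e x y).le)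
    (hsTensor_smul_left e) (hsTensor_smul_right e) I c
  have hdiff : ∀ x, ∑ s ∈ I, ∑ t ∈ I, c s t • hsTensor e (V s x) (V t x) =
      quadSum e w V b ω n x - quadSum e w V b ω m x := by
    intro x
    simp only [hI, hc, Finset.sum_map, Nat.castEmbedding_apply, Int.toNat_natCast, quadSum]
    rw [sum_Icc_eq_sum_ite hmn (fun s => ∑ t ∈ Finset.Icc 1 m, _), ← Finset.sum_sub_distrib]
    refine Finset.sum_congr rfl fun s _ => ?_
    by_cases hs : s ≤ m
    · rw [if_pos hs, sum_Icc_eq_sum_ite hmn, ← Finset.sum_sub_distrib]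
      refine Finset.sum_congr rfl fun t _ => ?_
      by_cases ht : t ≤ m <;> simp [hs, ht]
    · simp [hs]
  have e1 : ((fun x => quadSum e w V b ω n x - ∫ y, quadSum e w V b ω n y ∂μ) -
      fun x => quadSum e w V b ω m x - ∫ y, quadSum e w V b ω m y ∂μ) =
      fun x => quadSum e w V b ω n x - quadSum e w V b ω m x -
        (∫ y, quadSum e w V b ω n y ∂μ - ∫ y, quadSum e w V b ω m y ∂μ) := by
    ext1 x; simp only [Pi.sub_apply]; abel
  rw [e1, ← integral_sub (h.integrable_quadSum e (by linarith) w b ω n)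
    (h.integrable_quadSum e (by linarith) w b ω m)]
  simp_rw [← hdiff]
  refine key.trans ?_
  have hsum : ∑ s ∈ I, ∑ t ∈ I, ‖c s t‖ₑ ^ 2 ≤ 2 * (ENNReal.ofReal ((n : ℝ) - m) *
      ∑' k : ℤ, ENNReal.ofReal (w (b * k) ^ 2)) := by
    refine le_trans ?_ (sum_sum_ite_le hmn fun k : ℤ => ENNReal.ofReal (w (b * k) ^ 2))
    simp only [hI, hc, Finset.sum_map, Nat.castEmbedding_apply, Int.toNat_natCast]
    refine Finset.sum_le_sum fun s _ => Finset.sum_le_sum fun t _ => ?_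
    by_cases hst : s ≤ m ∧ t ≤ m
    · simp [hst]
    · rw [if_neg hst, if_neg hst]
      exact enorm_lagWeight_sq_le w b ω s t
  calc _ ≤ 1254400 * ((∑' k, ν k) ^ 4 * (2 * (ENNReal.ofReal ((n : ℝ) - m) *
      ∑' k : ℤ, ENNReal.ofReal (w (b * k) ^ 2)))) := by gcongr
    _ = _ := by ring

/-- Maximal inequality for the centered sequential lag window sums. -/
theorem IsCausal.lintegral_max_quadSum_le (h : IsCausal μ ε V p ν) (hp4 : 4 < p) (hp6 : p ≤ 6)
    (w : ℝ → ℝ) (b ω : ℝ) {T : ℕ} (hT : 1 ≤ T) :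
    ∫⁻ x, ⨆ n ∈ Finset.range (T + 1),
        ‖quadSum e w V b ω n x - ∫ y, quadSum e w V b ω n y ∂μ‖ₑ ^ 2 ∂μ ≤
      ENNReal.ofReal (2 * (1 / (√2 - 2 ^ (1 / (p / 2)))) ^ 2) *
        (2508800 * (∑' k, ν k) ^ 4 * (∑' k : ℤ, ENNReal.ofReal (w (b * k) ^ 2)) * T) :=
  lintegral_max_sq_le (by linarith)
    (fun n x => quadSum e w V b ω n x - ∫ y, quadSum e w V b ω n y ∂μ)
    (fun n => (h.memLp_quadSum e w b ω n).1.sub aestronglyMeasurable_const)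
    (by ext1 x; simp [quadSum])
    (fun m n hmn => h.eLpNorm_quadSum_increment_sq_le e hp4 hp6 w b ω hmn) hT

end QuadraticSums

/-! ### Summability of covariances and the spectral density. -/

section Covariances

variable {Ω : Type*} {m0 : MeasurableSpace Ω} {μ : Measure Ω} [IsProbabilityMeasure μ]
variable {S : Type*} [MeasurableSpace S]
variable {H : Type*} [NormedAddCommGroup H] [InnerProductSpace ℂ H] [CompleteSpace H]
variable {ι : Type*} (e : HilbertBasis ι ℂ H)
variable {ε : ℤ → Ω → S} {V : ℤ → Ω → H} {p : ℝ} {ν : ℤ → ℝ≥0∞}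

/-- The covariance operator `E (V_s ⊗ V_t)` as a Hilbert-Schmidt operator. -/
noncomputable def hsCov (μ : Measure Ω) (V : ℤ → Ω → H) (s t : ℤ) : lp (fun _ : ι => H) 2 :=
  ∫ x, hsTensor e (V s x) (V t x) ∂μ

lemma hsOperator_injective : Function.Injective (hsOperator e) := by
  intro k l h
  ext i
  rw [← hsOperator_apply_basis e k, ← hsOperator_apply_basis e l, h]

lemma IsCausal.integrable_hsTensor (h : IsCausal μ ε V p ν) (hp : 2 ≤ p) (s t : ℤ) :
    Integrable (fun x => hsTensor e (V s x) (V t x)) μ :=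
  (memLp_bilin (hsTensor e) (fun x y => (norm_hsTensor e x y).le) (h.memLp s)
    (h.memLp t)).1.integrable (by
      rw [← ENNReal.ofReal_one]; exact ENNReal.ofReal_le_ofReal (by linarith))

lemma IsCausal.hsOperator_hsCov (h : IsCausal μ ε V p ν) (hp : 2 ≤ p) (s t : ℤ) :
    hsOperator e (hsCov e μ V s t) = crossCov μ V V s t := by
  rw [hsCov, crossCov, ← ContinuousLinearMap.integral_comp_comm _ (h.integrable_hsTensor e hp s t)]
  simp_rw [hsOperator_hsTensor]

lemma IsCausal.hsCov_eq (h : IsCausal μ ε V p ν) (hp : 2 ≤ p)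
    (hst : ∀ t h, crossCov μ V V (t + h) t = crossCov μ V V h 0) (s t : ℤ) :
    hsCov e μ V s t = hsCov e μ V (s - t) 0 := by
  apply hsOperator_injective e
  rw [h.hsOperator_hsCov e hp, h.hsOperator_hsCov e hp, ← hst t (s - t), add_sub_cancel]

lemma IsCausal.enorm_hsCov_le (h : IsCausal μ ε V 2 ν) (s t : ℤ) :
    ‖hsCov e μ V s t‖ₑ ≤ 4 * ∑' k, ν (s - k) * ν (t - k) := by
  have hm : ∀ t, MemLp (V t) 2 μ := fun t => by
    have := h.memLp t
    rwa [ENNReal.ofReal_ofNat] at this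
  refine (enorm_integral_bilin_le_tsum (hsTensor e) (fun x y => (norm_hsTensor e x y).le)
    h.measurable_innov h.indep_innov (max s t) (hm s) (hm t) (h.adapted_of_le (le_max_left s t))
    (h.adapted_of_le (le_max_right s t)) (h.mean s) (fun k => μ[V s | innovSigma ε {k}ᶜ])
    (fun k => μ[V t | innovSigma ε {k}ᶜ]) (fun k => integrable_condExp)
    (fun k => integrable_condExp) (fun k => stronglyMeasurable_condExp.aestronglyMeasurable)
    (fun k => stronglyMeasurable_condExp.aestronglyMeasurable)).trans ?_
  gcongr with k
  · have := h.dep s k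
    rwa [ENNReal.ofReal_ofNat] at this
  · have := h.dep t k
    rwa [ENNReal.ofReal_ofNat] at this

/-- The weight `|h|^ℓ` as an extended nonnegative real. -/
noncomputable def absPow (ℓ : ℝ) (h : ℤ) : ℝ≥0∞ := ENNReal.ofReal (|(h : ℝ)| ^ ℓ)

lemma absPow_sub_le {ℓ : ℝ} (hℓ : 0 ≤ ℓ) (u v : ℤ) :
    absPow ℓ (u - v) ≤ ENNReal.ofReal (2 ^ ℓ) * (absPow ℓ u + absPow ℓ v) := by
  rw [absPow, absPow, absPow, ← ENNReal.ofReal_add (by positivity) (by positivity),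
    ← ENNReal.ofReal_mul (by positivity)]
  refine ENNReal.ofReal_le_ofReal ?_
  have h1 : |((u - v : ℤ) : ℝ)| ≤ 2 * max |(u : ℝ)| |(v : ℝ)| := by
    push_cast
    refine (abs_sub _ _).trans ?_
    linarith [le_max_left |(u : ℝ)| |(v : ℝ)|, le_max_right |(u : ℝ)| |(v : ℝ)|]
  calc |((u - v : ℤ) : ℝ)| ^ ℓ ≤ (2 * max |(u : ℝ)| |(v : ℝ)|) ^ ℓ := by gcongr
    _ = 2 ^ ℓ * max |(u : ℝ)| |(v : ℝ)| ^ ℓ := Real.mul_rpow (by norm_num) (by positivity)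
    _ ≤ _ := by
      gcongr
      rcases max_choice |(u : ℝ)| |(v : ℝ)| with h | h <;> rw [h]
      · have : 0 ≤ |(v : ℝ)| ^ ℓ := by positivity
        linarith
      · have : 0 ≤ |(u : ℝ)| ^ ℓ := by positivity
        linarith

lemma absPow_mono {r ℓ : ℝ} (hr : 0 < r) (h : r ≤ ℓ) (u : ℤ) : absPow r u ≤ absPow ℓ u := by
  refine ENNReal.ofReal_le_ofReal ?_
  rcases eq_or_ne u 0 with rfl | hu
  · simp [Real.zero_rpow hr.ne', Real.zero_rpow (hr.trans_le h).ne']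
  · exact Real.rpow_le_rpow_of_exponent_le (by exact_mod_cast Int.one_le_abs hu) h

/-- The weight is at least 1 away from lag zero but vanishes at lag zero, so finiteness of ν 0 has
to be supplied separately. -/
lemma tsum_lt_top_of_absPow {ℓ : ℝ} (hℓ : 0 < ℓ) {ν : ℤ → ℝ≥0∞} (h0 : ν 0 < ∞)
    (h : ∑' k, absPow ℓ k * ν k < ∞) : ∑' k, ν k < ∞ := by
  have hle : ∀ k, ν k ≤ (if k = 0 then ν 0 else 0) + absPow ℓ k * ν k := by
    intro k
    rcases eq_or_ne k 0 with rfl | hk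
    · simp
    · have : 1 ≤ absPow ℓ k := by
        rw [absPow, ENNReal.one_le_ofReal]
        exact Real.one_le_rpow (by exact_mod_cast Int.one_le_abs hk) hℓ.le
      simp only [hk, if_false, zero_add]
      exact le_mul_of_one_le_left zero_le this
  refine (ENNReal.tsum_le_tsum hle).trans_lt ?_
  rw [ENNReal.tsum_add, tsum_ite_eq]
  exact ENNReal.add_lt_top.2 ⟨h0, h⟩

/-- Covariances are dominated by a correlation of ν with itself. Writing k = (k − j) − (0 − j)
distributes the weight |k|^ℓ over the two factors, and the double sum then factorizes. -/
theorem IsCausal.tsum_absPow_hsCov_lt_top (h : IsCausal μ ε V 2 ν) {ℓ : ℝ} (hℓ : 0 < ℓ)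
    (hν0 : ν 0 < ∞) (hν : ∑' k, absPow ℓ k * ν k < ∞) :
    ∑' k, absPow ℓ k * ‖hsCov e μ V k 0‖ₑ < ∞ := by
  have hΘ := tsum_lt_top_of_absPow hℓ hν0 hν
  calc ∑' k, absPow ℓ k * ‖hsCov e μ V k 0‖ₑ
      ≤ ∑' k, absPow ℓ k * (4 * ∑' j, ν (k - j) * ν (0 - j)) :=
        ENNReal.tsum_le_tsum fun k => mul_le_mul' le_rfl (h.enorm_hsCov_le e k 0)
    _ ≤ ∑' k, ∑' j, 4 * ENNReal.ofReal (2 ^ ℓ) *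
          (absPow ℓ (k - j) * ν (k - j) * ν (0 - j) + ν (k - j) * (absPow ℓ (0 - j) * ν (0 - j))) := by
        refine ENNReal.tsum_le_tsum fun k => ?_
        rw [← ENNReal.tsum_mul_left, ← ENNReal.tsum_mul_left]
        refine ENNReal.tsum_le_tsum fun j => ?_
        have := absPow_sub_le hℓ.le (k - j) (0 - j)
        rw [sub_sub_sub_cancel_right, sub_zero] at this
        calc absPow ℓ k * (4 * (ν (k - j) * ν (0 - j)))
            ≤ ENNReal.ofReal (2 ^ ℓ) * (absPow ℓ (k - j) + absPow ℓ (0 - j)) *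
              (4 * (ν (k - j) * ν (0 - j))) := by gcongr
          _ = _ := by ring
    _ = 4 * ENNReal.ofReal (2 ^ ℓ) * (2 * ((∑' k, absPow ℓ k * ν k) * ∑' k, ν k)) := by
        rw [ENNReal.tsum_comm]
        have e1 : ∀ (F : ℤ → ℝ≥0∞) (j : ℤ), ∑' k, F (k - j) = ∑' k, F k := fun F j =>
          (Equiv.subRight j).tsum_eq F
        have e2 : ∀ F : ℤ → ℝ≥0∞, ∑' j, F (0 - j) = ∑' k, F k := fun F =>
          (Equiv.subLeft 0).tsum_eq F
        simp_rw [ENNReal.tsum_mul_left, ENNReal.tsum_add, ENNReal.tsum_mul_right,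
          e1 (fun k => absPow ℓ k * ν k), e1 ν, ENNReal.tsum_mul_left, e2 ν,
          e2 (fun k => absPow ℓ k * ν k)]
        ring
    _ < ∞ := by
        have := hν.ne
        have := hΘ.ne
        exact lt_top_iff_ne_top.2 (by finiteness)

/-- The spectral density operator in the space of Hilbert-Schmidt operators. -/
noncomputable def hsSpectral (μ : Measure Ω) (V : ℤ → Ω → H) (ω : ℝ) : lp (fun _ : ι => H) 2 :=
  ∑' k : ℤ, (((2 * Real.pi)⁻¹ : ℂ) * Complex.exp (-(Complex.I * ω * k))) • hsCov e μ V k 0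

lemma enorm_spectral_weight_le (ω : ℝ) (k : ℤ) :
    ‖((2 * Real.pi)⁻¹ : ℂ) * Complex.exp (-(Complex.I * ω * k))‖ ≤ 1 := by
  have he : ‖Complex.exp (-(Complex.I * ω * k))‖ = 1 := by
    rw [show -(Complex.I * ω * k) = ((-(ω * k) : ℝ) : ℂ) * Complex.I by push_cast; ring,
      Complex.norm_exp_ofReal_mul_I]
  rw [norm_mul, he, mul_one, norm_inv, norm_mul, Complex.norm_real, Complex.norm_ofNat,
    Real.norm_of_nonneg Real.pi_pos.le]
  exact inv_le_one_of_one_le₀ (by linarith [Real.pi_gt_three])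

section Summable

variable (hC : ∑' k, ‖hsCov e μ V k 0‖ₑ < ∞)
include hC

lemma summable_norm_hsCov : Summable fun k => ‖hsCov e μ V k 0‖ := by
  have := ENNReal.summable_toReal hC.ne
  simpa only [toReal_enorm] using this

lemma summable_hsSpectral (ω : ℝ) : Summable fun k : ℤ =>
    (((2 * Real.pi)⁻¹ : ℂ) * Complex.exp (-(Complex.I * ω * k))) • hsCov e μ V k 0 := by
  refine Summable.of_norm_bounded (summable_norm_hsCov e hC) fun k => ?_
  rw [norm_smul]
  exact mul_le_of_le_one_left (norm_nonneg _) (enorm_spectral_weight_le ω k)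

lemma norm_hsSpectral_le (ω : ℝ) : ‖hsSpectral e μ V ω‖ ≤ ∑' k, ‖hsCov e μ V k 0‖ := by
  refine tsum_of_norm_bounded (summable_norm_hsCov e hC).hasSum fun k => ?_
  rw [norm_smul]
  exact mul_le_of_le_one_left (norm_nonneg _) (enorm_spectral_weight_le ω k)

lemma continuous_hsSpectral : Continuous (hsSpectral e μ V) := by
  refine continuous_tsum (fun k => ?_) (summable_norm_hsCov e hC) fun k ω => ?_
  · fun_prop
  · rw [norm_smul]
    exact mul_le_of_le_one_left (norm_nonneg _) (enorm_spectral_weight_le ω k)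

lemma summable_spectralTerm (hcov : ∀ k, hsOperator e (hsCov e μ V k 0) = crossCov μ V V k 0)
    (ω : ℝ) : Summable (spectralTerm μ V ω) := by
  have h1 := ((summable_hsSpectral e hC ω).map (hsOperator e) (hsOperator e).continuous).const_smul
    (2 * Real.pi : ℂ)
  refine h1.congr fun k => ?_
  simp only [Function.comp_apply, map_smul, hcov, spectralTerm, smul_smul]
  congr 1
  have : (Real.pi : ℂ) ≠ 0 := by exact_mod_cast Real.pi_ne_zero
  field_simp

lemma hsOperator_hsSpectral
    (hcov : ∀ k, hsOperator e (hsCov e μ V k 0) = crossCov μ V V k 0) (ω : ℝ) :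
    hsOperator e (hsSpectral e μ V ω) = spectralDensity μ V ω := by
  rw [hsSpectral, ContinuousLinearMap.map_tsum _ (summable_hsSpectral e hC ω), spectralDensity,
    ← (summable_spectralTerm e hC hcov ω).tsum_const_smul]
  refine tsum_congr fun k => ?_
  rw [map_smul, hcov, spectralTerm, mul_smul]

end Summable

end Covariances

/-! ### Bias of the lag window sums. -/

section Bias

variable {Ω : Type*} {m0 : MeasurableSpace Ω} {μ : Measure Ω} [IsProbabilityMeasure μ]
variable {S : Type*} [MeasurableSpace S]
variable {H : Type*} [NormedAddCommGroup H] [InnerProductSpace ℂ H] [CompleteSpace H]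
variable {ι : Type*} (e : HilbertBasis ι ℂ H)
variable {ε : ℤ → Ω → S} {V : ℤ → Ω → H} {p : ℝ} {ν : ℤ → ℝ≥0∞}

/-- A shift by h moves a point of [1,N] out of the interval only if it is among the first h, or, for
negative h, the last |h| points. -/
lemma sum_ite_notMem_Icc_le (N : ℕ) (h : ℤ) :
    ∑ s ∈ Finset.Icc (1 : ℤ) N, (if s - h ∈ Finset.Icc (1 : ℤ) N then (0 : ℝ≥0∞) else 1) ≤
      absPow 1 h := by
  simp_rw [← ite_not (p := _ ∈ _)]
  rw [Finset.sum_boole]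
  have hc : ((Finset.Icc (1 : ℤ) N).filter fun s => s - h ∉ Finset.Icc (1 : ℤ) N).card ≤
      h.natAbs := by
    rcases le_total 0 h with hh | hh
    · refine (Finset.card_le_card (t := Finset.Icc 1 h) fun s hs => ?_).trans ?_
      · simp only [Finset.mem_filter, Finset.mem_Icc] at hs ⊢
        lia
      · rw [Int.card_Icc]; lia
    · refine (Finset.card_le_card (t := Finset.Icc (N + h + 1) N) fun s hs => ?_).trans ?_
      · simp only [Finset.mem_filter, Finset.mem_Icc] at hs ⊢
        lia
      · rw [Int.card_Icc]; lia
  have : absPow 1 h = (h.natAbs : ℝ≥0∞) := by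
    rw [absPow, Real.rpow_one, ← ENNReal.ofReal_natCast, Nat.cast_natAbs, Int.cast_abs]
  rw [this]
  exact_mod_cast hc

lemma IsCausal.integral_quadSum (h : IsCausal μ ε V p ν) (hp : 2 ≤ p)
    (hst : ∀ t h, crossCov μ V V (t + h) t = crossCov μ V V h 0) {w : ℝ → ℝ}
    (hw : ∀ x, w (-x) = w x) (b ω : ℝ) (N : ℕ) :
    ∫ x, quadSum e w V b ω N x ∂μ =
      ∑ s ∈ Finset.Icc (1 : ℤ) N, ∑ t ∈ Finset.Icc (1 : ℤ) N, (w (b * ((s - t : ℤ) : ℝ)) : ℂ) •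
        (((2 * Real.pi)⁻¹ : ℂ) * Complex.exp (-(Complex.I * ω * (s - t : ℤ)))) •
          hsCov e μ V (s - t) 0 := by
  have hcast : ∀ F : ℤ → lp (fun _ : ι => H) 2,
      ∑ s ∈ Finset.Icc (1 : ℤ) N, F s = ∑ s ∈ Finset.Icc 1 N, F (s : ℕ) := by
    intro F
    have := Nat.image_cast_int_Icc 1 N
    have h2 : Finset.Icc (1 : ℤ) N = (Finset.Icc 1 N).map Nat.castEmbedding := by
      ext i
      simp only [Finset.mem_Icc, Finset.mem_map, Nat.castEmbedding_apply]
      constructor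
      · intro hi; exact ⟨i.toNat, by lia, by lia⟩
      · rintro ⟨j, hj, rfl⟩; lia
    rw [h2, Finset.sum_map]
    rfl
  rw [hcast]
  simp_rw [hcast]
  unfold quadSum
  have hi : ∀ s t : ℕ, Integrable
      (fun x => lagWeight w b ω s t • hsTensor e (V s x) (V t x)) μ := fun s t =>
    (h.integrable_hsTensor e hp s t).smul (lagWeight w b ω s t)
  rw [integral_finsetSum _ fun s _ => integrable_finsetSum _ fun t _ => hi s t]
  refine Finset.sum_congr rfl fun s _ => ?_
  rw [integral_finsetSum _ fun t _ => hi s t]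
  refine Finset.sum_congr rfl fun t _ => ?_
  rw [integral_smul]
  change lagWeight w b ω s t • hsCov e μ V s t = _
  rw [h.hsCov_eq e hp hst, smul_smul, lagWeight]
  congr 1
  rw [← hw]
  push_cast
  rw [show -(b * ((t : ℝ) - s)) = b * ((s : ℝ) - t) by ring,
    show Complex.I * ω * ((t : ℂ) - s) = -(Complex.I * ω * ((s : ℂ) - t)) by ring]
  ring

lemma enorm_sum_smul_sub_le {E : Type*} [NormedAddCommGroup E] [NormedSpace ℂ E] {G : ℤ → E} {g : E}
    (hG : HasSum G g) (I : Finset ℤ) (c : ℤ → ℂ) :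
    ‖∑ t ∈ I, c t • G t - g‖ₑ ≤ ∑' t, (‖c t - 1‖ₑ + if t ∈ I then 0 else 1) * ‖G t‖ₑ := by
  have h2 : HasSum (fun t => if t ∈ I then c t • G t else 0) (∑ t ∈ I, c t • G t) := by
    have : HasSum (fun t => if t ∈ I then c t • G t else 0)
        (∑ t ∈ I, if t ∈ I then c t • G t else 0) :=
      hasSum_sum_of_ne_finset_zero fun t ht => if_neg ht
    rwa [Finset.sum_congr rfl fun t ht => if_pos ht] at this
  rw [← (h2.sub hG).tsum_eq]
  refine enorm_tsum_le_tsum_enorm.trans (ENNReal.tsum_le_tsum fun t => ?_)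
  by_cases ht : t ∈ I
  · rw [if_pos ht, if_pos ht, add_zero, ← enorm_smul, sub_smul, one_smul]
  · rw [if_neg ht, if_neg ht, zero_sub, enorm_neg]
    exact le_mul_of_one_le_left zero_le le_add_self

lemma hasSum_comp_subLeft {E : Type*} [NormedAddCommGroup E] {G : ℤ → E} {g : E}
    (hG : HasSum G g) (s : ℤ) : HasSum (fun t => G (s - t)) g :=
  (Equiv.hasSum_iff (f := G) (Equiv.subLeft s)).2 hG

/-- The bias of the sequential lag window sums. -/
theorem IsCausal.enorm_integral_quadSum_sub_le (h : IsCausal μ ε V p ν) (hp : 2 ≤ p)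
    (hst : ∀ t h, crossCov μ V V (t + h) t = crossCov μ V V h 0) {w : ℝ → ℝ}
    (hw : ∀ x, w (-x) = w x) (hC : ∑' k, ‖hsCov e μ V k 0‖ₑ < ∞) (b ω : ℝ) (N : ℕ) :
    ‖∫ x, quadSum e w V b ω N x ∂μ - (N : ℂ) • hsSpectral e μ V ω‖ₑ ≤
      N * ∑' k : ℤ, ‖w (b * k) - 1‖ₑ * ‖hsCov e μ V k 0‖ₑ +
        ∑' k : ℤ, absPow 1 k * ‖hsCov e μ V k 0‖ₑ := by
  set I := Finset.Icc (1 : ℤ) N with hI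
  set G : ℤ → lp (fun _ : ι => H) 2 := fun k =>
    (((2 * Real.pi)⁻¹ : ℂ) * Complex.exp (-(Complex.I * ω * k))) • hsCov e μ V k 0 with hG
  have hGs' : HasSum G (hsSpectral e μ V ω) := (summable_hsSpectral e hC ω).hasSum
  have hGn : ∀ k, ‖G k‖ₑ ≤ ‖hsCov e μ V k 0‖ₑ := fun k => by
    rw [enorm_le_iff_norm_le, hG, norm_smul]
    exact mul_le_of_le_one_left (norm_nonneg _) (enorm_spectral_weight_le ω k)
  -- Each row is compared with the full Fourier series: a lag that is present costs |w − 1|, a lag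
  -- cut off by the sample boundary costs at most 1 more. Over all rows, lag k is cut off at most
  -- |k| times.
  have hterm : ∀ s, ‖∑ t ∈ I, (w (b * ((s - t : ℤ) : ℝ)) : ℂ) • G (s - t) - hsSpectral e μ V ω‖ₑ ≤
      ∑' k : ℤ, (‖w (b * k) - 1‖ₑ + if s - k ∈ I then 0 else 1) * ‖hsCov e μ V k 0‖ₑ := by
    intro s
    have h1 := hasSum_comp_subLeft hGs' s
    refine (enorm_sum_smul_sub_le h1 I fun t => (w (b * ((s - t : ℤ) : ℝ)) : ℂ)).trans ?_
    rw [← (Equiv.subLeft s).tsum_eq (fun k : ℤ =>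
      (‖w (b * k) - 1‖ₑ + if s - k ∈ I then 0 else 1) * ‖hsCov e μ V k 0‖ₑ)]
    refine ENNReal.tsum_le_tsum fun t => ?_
    simp only [Equiv.subLeft_apply, sub_sub_cancel]
    refine mul_le_mul' (add_le_add (le_of_eq ?_) le_rfl) (hGn (s - t))
    rw [← ofReal_norm, ← ofReal_norm, ← Complex.norm_real]
    push_cast
    rfl
  have hN : (N : ℂ) • hsSpectral e μ V ω = ∑ s ∈ I, hsSpectral e μ V ω := by
    rw [Finset.sum_const, hI, Int.card_Icc]
    simp [Nat.cast_smul_eq_nsmul]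
  rw [h.integral_quadSum e hp hst hw, hN, ← Finset.sum_sub_distrib]
  refine (enorm_sum_le _ _).trans ((Finset.sum_le_sum fun s _ => hterm s).trans ?_)
  rw [← Summable.tsum_finsetSum (fun _ _ => ENNReal.summable), ← ENNReal.tsum_mul_left,
    ← ENNReal.tsum_add]
  refine ENNReal.tsum_le_tsum fun k => ?_
  rw [← Finset.sum_mul, Finset.sum_add_distrib, Finset.sum_const, ← mul_assoc, ← add_mul, hI,
    Int.card_Icc]
  gcongr
  · simp
  · exact sum_ite_notMem_Icc_le N k

/-- Boundedness of w makes the local order at 0 global: for |x| ≥ δ, C₁ + 1 ≤ (C₁ + 1) δ^{−β} |x|^β.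
-/
lemma IsLagWindow.exists_abs_sub_one_le {w : ℝ → ℝ} (hw : IsLagWindow w) {β : ℝ} (hβ : 0 ≤ β)
    (h : (fun x => w x - 1) =O[𝓝 0] fun x => |x| ^ β) :
    ∃ C, 0 ≤ C ∧ ∀ x, |w x - 1| ≤ C * |x| ^ β := by
  obtain ⟨C₁, hC₁⟩ := hw.bounded
  obtain ⟨C₂, hC₂0, hC₂⟩ := h.exists_pos
  rw [IsBigOWith, Metric.eventually_nhds_iff] at hC₂
  obtain ⟨δ, hδ, hC₂⟩ := hC₂
  have hC₁0 : 0 ≤ C₁ := (abs_nonneg _).trans (hC₁ 0)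
  refine ⟨max C₂ ((C₁ + 1) / δ ^ β), by positivity, fun x => ?_⟩
  rcases lt_or_ge |x| δ with hx | hx
  · have := hC₂ (y := x) (by simpa using hx)
    rw [Real.norm_eq_abs, Real.norm_of_nonneg (by positivity)] at this
    exact this.trans (by gcongr; exact le_max_left _ _)
  · calc |w x - 1| ≤ C₁ + 1 := by
          refine (abs_sub _ _).trans ?_
          rw [abs_one]; linarith [hC₁ x]
      _ = (C₁ + 1) / δ ^ β * δ ^ β := by field_simp
      _ ≤ max C₂ ((C₁ + 1) / δ ^ β) * |x| ^ β := by
          gcongr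
          exact le_max_right _ _

end Bias

/-! ### Deterministic rates and the reduction to expectations. -/

section Rates

/-- The deterministic rate that governs the quadratic part of the remainder. -/
lemma IsBandwidth.tendsto_rate {w : ℝ → ℝ} (hw : IsLagWindow w) {ν₂ : ℤ → ℝ≥0∞} {b : ℕ → ℝ} {ℓ : ℝ}
    (hb : IsBandwidth w ν₂ b ℓ) : Tendsto (fun T : ℕ => ENNReal.ofReal (√(b T * T) / T ^ 2) *
      ((∑' h : ℤ, ENNReal.ofReal (w (b T * h) ^ 2)) * T +
        (T * ENNReal.ofReal (b T ^ max 1 (ℓ / 2))) ^ 2 + 1)) atTop (𝓝 0) := by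
  have hpos : ∀ᶠ T : ℕ in atTop, 0 < b T := by
    filter_upwards [hb.tendsto_mul.eventually_gt_atTop 0, eventually_gt_atTop 0] with T hT hT0
    exact pos_of_mul_pos_left hT (Nat.cast_nonneg T)
  -- Variance term: one factor b makes ∑ w²(bh) convergent, and 1/√(bT) is left over.
  have h1 : Tendsto (fun T : ℕ => ENNReal.ofReal (1 / √(b T * T)) *
      (ENNReal.ofReal (b T) * ∑' h : ℤ, ENNReal.ofReal (w (b T * h) ^ 2))) atTop (𝓝 0) := by
    have hs : Tendsto (fun T : ℕ => ENNReal.ofReal (1 / √(b T * T))) atTop (𝓝 0) := by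
      have := (tendsto_inv_atTop_zero.comp (Real.tendsto_sqrt_atTop.comp hb.tendsto_mul))
      simpa using ENNReal.tendsto_ofReal this
    have hk := hw.tendsto_sum_sq.comp
      (tendsto_nhdsWithin_iff.2 ⟨hb.tendsto_zero, hpos⟩)
    have := ENNReal.Tendsto.mul hs (Or.inr hw.sq_integrable.ne) hk (Or.inr ENNReal.zero_ne_top)
    simpa using this
  -- Bias term: the square of √(bT) b^{2β} is b^{1+4β} T, at most b^{1+2ℓ} T once b ≤ 1, because β ≥
  -- ℓ/2.
  have h2 : Tendsto (fun T : ℕ => ENNReal.ofReal (√(b T ^ (1 + 2 * ℓ) * T))) atTop (𝓝 0) := by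
    have := (Real.continuous_sqrt.tendsto 0).comp hb.tendsto_bias
    simpa using ENNReal.tendsto_ofReal this
  have h3 : Tendsto (fun T : ℕ => ENNReal.ofReal ((T : ℝ)⁻¹)) atTop (𝓝 0) := by
    simpa using ENNReal.tendsto_ofReal (tendsto_inv_atTop_nhds_zero_nat (𝕜 := ℝ))
  have h := (h1.add h2).add h3
  rw [add_zero, add_zero] at h
  refine tendsto_of_tendsto_of_tendsto_of_le_of_le' tendsto_const_nhds h
    (Eventually.of_forall fun _ => zero_le) ?_
  filter_upwards [hpos, eventually_ge_atTop 1, hb.tendsto_zero.eventually_le_const one_pos] with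
    T hT hT1 hb1
  have hT1' : (1 : ℝ) ≤ T := by exact_mod_cast hT1
  have hT0 : (0 : ℝ) < T := by linarith
  have hbT : 0 < b T * T := by positivity
  rw [mul_add, mul_add, mul_one]
  refine add_le_add (add_le_add (le_of_eq ?_) ?_) ?_
  · rw [mul_comm (∑' h : ℤ, _) (T : ℝ≥0∞), ← mul_assoc, ← mul_assoc, ← ENNReal.ofReal_natCast,
      ← ENNReal.ofReal_mul (by positivity), ← ENNReal.ofReal_mul (by positivity)]
    congr 2
    have hs := Real.mul_self_sqrt hbT.le
    have : 0 < √(b T * T) := Real.sqrt_pos.2 hbT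
    field_simp
    rw [sq, hs]
  · rw [← ENNReal.ofReal_natCast, ← ENNReal.ofReal_mul hT0.le,
      ← ENNReal.ofReal_pow (by positivity), ← ENNReal.ofReal_mul (by positivity)]
    refine ENNReal.ofReal_le_ofReal (Real.le_sqrt_of_sq_le ?_)
    set β := max 1 (ℓ / 2) with hβ
    have hβℓ : ℓ / 2 ≤ β := le_max_right _ _
    have e1 : (√(b T * T) / T ^ 2 * (T * b T ^ β) ^ 2) ^ 2 = b T * (b T ^ β) ^ 4 * T := by
      have hs := Real.sq_sqrt hbT.le
      have e2 : √(b T * T) / T ^ 2 * (T * b T ^ β) ^ 2 = √(b T * T) * (b T ^ β) ^ 2 := by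
        field_simp
      rw [e2, mul_pow, hs]; ring
    have e3 : b T * (b T ^ β) ^ 4 = b T ^ (1 + 4 * β) := by
      rw [Real.rpow_add hT, Real.rpow_one, ← Real.rpow_natCast, ← Real.rpow_mul hT.le]
      congr 2; push_cast; ring
    rw [e1, e3]
    gcongr ?_ * _
    exact Real.rpow_le_rpow_of_exponent_ge hT hb1 (by linarith)
  · refine ENNReal.ofReal_le_ofReal ?_
    have : √(b T * T) ≤ T := by
      rw [Real.sqrt_le_left hT0.le]
      nlinarith
    rw [div_le_iff₀ (by positivity)]
    field_simp
    exact this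

/-- The total bandwidth-adjusted sample size is comparable to both of its summands. -/
lemma exists_balance_le {b₁ b₂ : ℕ → ℝ} {T₁ T₂ : ℕ → ℕ} (hT₁ : Tendsto T₁ atTop atTop)
    (h₁ : ∀ᶠ n in atTop, 0 < b₁ (T₁ n) * T₁ n) (h₂ : ∀ᶠ n in atTop, 0 < b₂ (T₂ n) * T₂ n)
    (hbal : (∃ θ ∈ Set.Ioo (0 : ℝ) 1,
        Tendsto (fun n => b₁ (T₁ n) * T₁ n / (b₁ (T₁ n) * T₁ n + b₂ (T₂ n) * T₂ n)) atTop (𝓝 θ)) ∨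
      (T₁ = T₂ ∧ b₁ ~[atTop] b₂)) :
    ∃ K, 0 ≤ K ∧ ∀ᶠ n in atTop,
      b₁ (T₁ n) * T₁ n + b₂ (T₂ n) * T₂ n ≤ K * (b₁ (T₁ n) * T₁ n) ∧
      b₁ (T₁ n) * T₁ n + b₂ (T₂ n) * T₂ n ≤ K * (b₂ (T₂ n) * T₂ n) := by
  rcases hbal with ⟨θ, ⟨hθ0, hθ1⟩, hθ⟩ | ⟨rfl, hb⟩
  -- Eventually the share of the first summand lies between θ/2 and (1 + θ)/2, so the two shares are
  -- at least θ/2 and (1 − θ)/2.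
  · refine ⟨max (2 / θ) (2 / (1 - θ)), by positivity, ?_⟩
    filter_upwards [h₁, h₂, hθ.eventually_const_lt (show θ / 2 < θ by linarith),
      hθ.eventually_lt_const (show θ < (1 + θ) / 2 by linarith)] with n hn1 hn2 hl hu
    set u := b₁ (T₁ n) * T₁ n
    set v := b₂ (T₂ n) * T₂ n
    rw [lt_div_iff₀ (by linarith)] at hl
    rw [div_lt_iff₀ (by linarith)] at hu
    have h1θ : 0 < 1 - θ := by linarith
    constructor
    · calc u + v ≤ 2 / θ * u := by
            rw [div_mul_eq_mul_div, le_div_iff₀ hθ0]; linarith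
        _ ≤ _ := by gcongr; exact le_max_left _ _
    · calc u + v ≤ 2 / (1 - θ) * v := by
            rw [div_mul_eq_mul_div, le_div_iff₀ h1θ]; linarith
        _ ≤ _ := by gcongr; exact le_max_right _ _
  -- The ratio of the bandwidths is eventually between 1/2 and 2, so each summand is at most twice
  -- the other.
  · refine ⟨3, by norm_num, ?_⟩
    obtain ⟨φ, hφ, hbφ⟩ := hb.exists_eq_mul
    filter_upwards [h₁, h₂, hT₁.eventually hbφ,
      (hφ.comp hT₁).eventually_lt_const (show (1 : ℝ) < 2 by norm_num),
      (hφ.comp hT₁).eventually_const_lt (show (1 / 2 : ℝ) < 1 by norm_num)] with n hn1 hn2 he hu hl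
    simp only [Pi.mul_apply, Function.comp_apply] at he hu hl
    rw [he, mul_assoc]
    constructor <;> nlinarith

/-- Markov's inequality is applied to a measurable dominating function, so the supremum over η need
not be measurable. -/
lemma uniformlyLittleOP_of_lintegral {Ω : Type*} [MeasurableSpace Ω] {μ : Measure Ω}
    {R : ℕ → ℝ → Ω → ℝ} {G : ℕ → Ω → ℝ≥0∞} (hG : ∀ n, AEMeasurable (G n) μ)
    (hR : ∀ᶠ n in atTop, ∀ η ∈ Set.Icc (0 : ℝ) 1, ∀ x, ‖R n η x‖ₑ ≤ G n x)
    (h : Tendsto (fun n => ∫⁻ x, G n x ∂μ) atTop (𝓝 0)) : UniformlyLittleOP μ R := by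
  intro δ hδ
  have hδ' : ENNReal.ofReal δ ≠ 0 := by simpa using hδ
  have h2 := ENNReal.Tendsto.div_const h (b := ENNReal.ofReal δ) (Or.inr hδ')
  rw [ENNReal.zero_div] at h2
  refine tendsto_of_tendsto_of_tendsto_of_le_of_le' tendsto_const_nhds h2
    (Eventually.of_forall fun _ => zero_le) ?_
  filter_upwards [hR] with n hn
  refine (measure_mono ?_).trans (meas_ge_le_lintegral_div (hG n) hδ' ENNReal.ofReal_ne_top)
  rintro x ⟨η, hη, hx⟩
  refine le_trans ?_ (hn η hη x)
  rw [Real.enorm_eq_ofReal_abs]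
  exact ENNReal.ofReal_le_ofReal hx.le

end Rates

/-! ### Pointwise expansion of the squared distance. -/

section Algebra

variable {E : Type*} [NormedAddCommGroup E] [InnerProductSpace ℂ E]

/-- Expand the square around η(F₁ − F₂) and replace Δ by P in the linear term. The factor η of the
center is kept in front of ‖Δ − P‖; the sequential bound relies on it. -/
lemma norm_sq_sub_linear_le {L η : ℝ} {F₁ F₂ Δ₁ Δ₂ P₁ P₂ : E} (hη : 0 ≤ η) (h₁ : ‖F₁‖ ≤ L)
    (h₂ : ‖F₂‖ ≤ L) :
    |‖(η : ℂ) • (F₁ - F₂) + (Δ₁ - Δ₂)‖ ^ 2 - η ^ 2 * ‖F₁ - F₂‖ ^ 2 -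
      (2 * (inner ℂ ((η : ℂ) • (F₁ - F₂)) P₁ : ℂ).re -
        2 * (inner ℂ ((η : ℂ) • (F₁ - F₂)) P₂ : ℂ).re)| ≤
      (4 * L * (η * ‖Δ₁ - P₁‖) + 2 * ‖Δ₁‖ ^ 2) + (4 * L * (η * ‖Δ₂ - P₂‖) + 2 * ‖Δ₂‖ ^ 2) := by
  set M := (η : ℂ) • (F₁ - F₂) with hM
  have hMn : ‖M‖ = η * ‖F₁ - F₂‖ := by
    rw [hM, norm_smul, Complex.norm_real, Real.norm_of_nonneg hη]
  have hML : ‖M‖ ≤ η * (2 * L) := by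
    rw [hMn]; gcongr; exact (norm_sub_le _ _).trans (by linarith)
  have e1 : ‖M + (Δ₁ - Δ₂)‖ ^ 2 - η ^ 2 * ‖F₁ - F₂‖ ^ 2 -
      (2 * (inner ℂ M P₁ : ℂ).re - 2 * (inner ℂ M P₂ : ℂ).re) =
      2 * (inner ℂ M (Δ₁ - P₁) : ℂ).re - 2 * (inner ℂ M (Δ₂ - P₂) : ℂ).re + ‖Δ₁ - Δ₂‖ ^ 2 := by
    have := norm_add_sq (𝕜 := ℂ) M (Δ₁ - Δ₂)
    rw [this, ← mul_pow, ← hMn]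
    simp only [inner_sub_right, map_sub, Complex.sub_re, RCLike.re_to_complex]
    ring
  have hin : ∀ z : E, |(inner ℂ M z : ℂ).re| ≤ η * (2 * L) * ‖z‖ := fun z =>
    (Complex.abs_re_le_norm _).trans ((norm_inner_le_norm M z).trans (by gcongr))
  have hsq : ‖Δ₁ - Δ₂‖ ^ 2 ≤ 2 * ‖Δ₁‖ ^ 2 + 2 * ‖Δ₂‖ ^ 2 := by
    have := norm_sub_le Δ₁ Δ₂
    nlinarith [norm_nonneg (Δ₁ - Δ₂), sq_nonneg (‖Δ₁‖ - ‖Δ₂‖)]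
  rw [e1]
  have a1 := abs_le.1 (hin (Δ₁ - P₁))
  have a2 := abs_le.1 (hin (Δ₂ - P₂))
  rw [abs_le]
  constructor <;> nlinarith [sq_nonneg ‖Δ₁ - Δ₂‖, sq_nonneg ‖Δ₁‖, sq_nonneg ‖Δ₂‖]

/-- The estimator normalizes by η/N, the linear part by 1/T. Their difference is only O(1/(NT)),
which is not O(T⁻²) for small N; the extra factor η = O(N/T) repairs this uniformly in η. The
summand 1 on the right absorbs the terms not involving the deviation. -/
lemma sequential_error_le {L η : ℝ} {T : ℕ} (hη : η ∈ Set.Icc (0 : ℝ) 1) (hT : 1 ≤ T) {F S : E}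
    (hF : ‖F‖ ≤ L) (hS : ⌊η * T⌋₊ = 0 → S = 0) :
    4 * L * (η * ‖(η : ℂ) • ((⌊η * T⌋₊ : ℂ)⁻¹ • S - F) -
        ((T : ℝ)⁻¹ : ℂ) • (S - (⌊η * T⌋₊ : ℂ) • F)‖) +
      2 * ‖(η : ℂ) • ((⌊η * T⌋₊ : ℂ)⁻¹ • S - F)‖ ^ 2 ≤
      (20 + 12 * L ^ 2) / T ^ 2 * (1 + ‖S - (⌊η * T⌋₊ : ℂ) • F‖ ^ 2) := by
  have hT0 : (0 : ℝ) < T := by exact_mod_cast hT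
  have hL : 0 ≤ L := (norm_nonneg _).trans hF
  have hlt := Nat.lt_floor_add_one (η * T)
  have hle := Nat.floor_le (mul_nonneg hη.1 hT0.le)
  set N := ⌊η * T⌋₊
  set Q := S - (N : ℂ) • F with hQ
  suffices h : ‖(η : ℂ) • ((N : ℂ)⁻¹ • S - F)‖ ≤ (2 * ‖Q‖ + L) / T ∧
      η * ‖(η : ℂ) • ((N : ℂ)⁻¹ • S - F) - ((T : ℝ)⁻¹ : ℂ) • Q‖ ≤ (2 * ‖Q‖ + L) / T ^ 2 by
    calc _ ≤ 4 * L * ((2 * ‖Q‖ + L) / T ^ 2) + 2 * ((2 * ‖Q‖ + L) / T) ^ 2 := by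
          gcongr
          exacts [h.2, h.1]
      _ = (4 * L * (2 * ‖Q‖ + L) + 2 * (2 * ‖Q‖ + L) ^ 2) / T ^ 2 := by field_simp
      _ ≤ (20 + 12 * L ^ 2) * (1 + ‖Q‖ ^ 2) / T ^ 2 := by
          gcongr
          nlinarith [sq_nonneg (L - ‖Q‖), sq_nonneg (L * ‖Q‖), sq_nonneg (2 * ‖Q‖ - L)]
      _ = _ := by ring
  -- For N = 0 the inverse of zero is zero, so the estimator vanishes and the error is −ηF, with η ≤
  -- 1/T.
  rcases Nat.eq_zero_or_pos N with hN | hN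
  · have hη1 : η ≤ 1 / T := by
      rw [le_div_iff₀ hT0]; rw [hN] at hlt; push_cast at hlt; linarith
    have hQ0 : Q = 0 := by rw [hQ, hS hN, hN]; simp
    have hD : ‖(η : ℂ) • ((N : ℂ)⁻¹ • S - F)‖ ≤ 1 / T * L := by
      rw [hS hN, smul_zero, zero_sub, norm_smul, norm_neg, Complex.norm_real,
        Real.norm_of_nonneg hη.1]
      exact mul_le_mul hη1 hF (norm_nonneg _) (by positivity)
    rw [hQ0, smul_zero, sub_zero, norm_zero]
    refine ⟨hD.trans (le_of_eq (by ring)), ?_⟩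
    calc _ ≤ 1 / T * (1 / T * L) := mul_le_mul hη1 hD (norm_nonneg _) (by positivity)
      _ = _ := by ring
  · have hN0 : (0 : ℝ) < N := by exact_mod_cast hN
    have hN1 : (1 : ℝ) ≤ N := by exact_mod_cast hN
    have hNC : (N : ℂ) ≠ 0 := by exact_mod_cast hN.ne'
    -- ηT < N + 1 ≤ 2N since N ≥ 1. The same bound ηT < N + 1 yields `hr2`.
    have hη2 : η ≤ 2 * N / T := by rw [le_div_iff₀ hT0]; linarith
    have e1 : (η : ℂ) • ((N : ℂ)⁻¹ • S - F) = ((η / N : ℝ) : ℂ) • Q := by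
      rw [hQ, smul_sub, smul_sub, smul_smul, smul_smul]
      push_cast
      rw [div_mul_cancel₀ _ hNC, div_eq_mul_inv]
    have e2 : (η : ℂ) • ((N : ℂ)⁻¹ • S - F) - ((T : ℝ)⁻¹ : ℂ) • Q =
        ((η / N - (T : ℝ)⁻¹ : ℝ) : ℂ) • Q := by
      rw [e1, ← sub_smul]; push_cast; rfl
    have hr : 0 ≤ η / N - (T : ℝ)⁻¹ := by
      rw [sub_nonneg, inv_le_iff_one_le_mul₀ hT0, div_mul_eq_mul_div, le_div_iff₀ hN0]; linarith
    have hr2 : η / N - (T : ℝ)⁻¹ ≤ 1 / (N * T) := by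
      have : η / N - (T : ℝ)⁻¹ = (η * T - N) / (N * T) := by field_simp
      rw [this]
      gcongr
      linarith
    constructor
    · rw [e1, norm_smul, Complex.norm_real, Real.norm_of_nonneg (by have := hη.1; positivity)]
      calc η / N * ‖Q‖ ≤ (2 * N / T) / N * ‖Q‖ := by gcongr
        _ = 2 * ‖Q‖ / T := by field_simp
        _ ≤ _ := by gcongr; linarith
    · rw [e2, norm_smul, Complex.norm_real, Real.norm_of_nonneg hr]
      calc η * ((η / N - (T : ℝ)⁻¹) * ‖Q‖) ≤ (2 * N / T) * (1 / (N * T) * ‖Q‖) := by gcongr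
        _ = 2 * ‖Q‖ / T ^ 2 := by field_simp
        _ ≤ _ := by gcongr; linarith

end Algebra

/-! ### Deviations from the spectral density. -/

section Deviation

variable {Ω : Type*} {m0 : MeasurableSpace Ω} {μ : Measure Ω} [IsProbabilityMeasure μ]
variable {H : Type*} [NormedAddCommGroup H] [InnerProductSpace ℂ H] [CompleteSpace H]
variable {ι : Type*} (e : HilbertBasis ι ℂ H)

/-- The deviation `∑_{s=1}^n (∑_{t=1}^n w̃_{b,s,t}^{(ω)} V_s ⊗ V_t - F_V^{(ω)})` in the space of
Hilbert-Schmidt operators. -/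
noncomputable def quadDev (μ : Measure Ω) (w : ℝ → ℝ) (V : ℤ → Ω → H) (b ω : ℝ) (n : ℕ) (x : Ω) :
    lp (fun _ : ι => H) 2 :=
  quadSum e w V b ω n x - (n : ℂ) • hsSpectral e μ V ω

variable {V : ℤ → Ω → H}

lemma continuous_quadSum (w : ℝ → ℝ) (V : ℤ → Ω → H) (b : ℝ) (n : ℕ) (x : Ω) :
    Continuous fun ω => quadSum e w V b ω n x := by
  unfold quadSum lagWeight
  fun_prop

/-- Joint measurability in the sample point and the frequency, for exchanging expectation and
frequency integral. -/
lemma stronglyMeasurable_quadDev [TopologicalSpace.SeparableSpace H] [MeasurableSpace H]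
    [BorelSpace H] (hm : ∀ t, Measurable (V t)) (hC : ∑' k, ‖hsCov e μ V k 0‖ₑ < ∞) (w : ℝ → ℝ)
    (b : ℝ) (n : ℕ) :
    StronglyMeasurable fun z : Ω × ℝ => quadDev e μ w V b z.2 n z.1 := by
  unfold quadDev quadSum
  have hV : ∀ t, StronglyMeasurable (V t) := fun t => (hm t).stronglyMeasurable
  refine StronglyMeasurable.sub ?_ ?_
  · refine Finset.stronglyMeasurable_fun_sum _ fun s _ =>
      Finset.stronglyMeasurable_fun_sum _ fun t _ =>
        continuous_smul.comp_stronglyMeasurable (StronglyMeasurable.prodMk ?_ ?_)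
    · have : Continuous fun ω : ℝ => lagWeight w b ω s t := by unfold lagWeight; fun_prop
      exact this.stronglyMeasurable.comp_measurable measurable_snd
    · have := (hsTensor e).continuous₂.comp_stronglyMeasurable
        ((hV s).prodMk (hV t))
      exact this.comp_measurable measurable_fst
  · exact ((continuous_hsSpectral e hC).stronglyMeasurable.comp_measurable
      measurable_snd).const_smul (n : ℂ)

end Deviation

/-! ### Expected maximal deviation over the frequency band. -/

section Moments

variable {Ω : Type*} {m0 : MeasurableSpace Ω} {μ : Measure Ω} [IsProbabilityMeasure μ]
variable {S : Type*} [MeasurableSpace S]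
variable {H : Type*} [NormedAddCommGroup H] [InnerProductSpace ℂ H] [CompleteSpace H]
variable {ι : Type*} (e : HilbertBasis ι ℂ H)
variable {ε : ℤ → Ω → S} {V : ℤ → Ω → H} {p : ℝ} {ν : ℤ → ℝ≥0∞}

lemma enorm_add_sq_le {E : Type*} [SeminormedAddCommGroup E] (x y : E) :
    ‖x + y‖ₑ ^ 2 ≤ 2 * ‖x‖ₑ ^ 2 + 2 * ‖y‖ₑ ^ 2 := by
  have h : ‖x + y‖ ^ 2 ≤ 2 * ‖x‖ ^ 2 + 2 * ‖y‖ ^ 2 := by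
    nlinarith [norm_add_le x y, norm_nonneg (x + y), sq_nonneg (‖x‖ - ‖y‖)]
  simp only [← ofReal_norm]
  rw [← ENNReal.ofReal_pow (norm_nonneg _), ← ENNReal.ofReal_pow (norm_nonneg _),
    ← ENNReal.ofReal_pow (norm_nonneg _), ← ENNReal.ofReal_ofNat 2,
    ← ENNReal.ofReal_mul (by norm_num), ← ENNReal.ofReal_mul (by norm_num),
    ← ENNReal.ofReal_add (by positivity) (by positivity)]
  exact ENNReal.ofReal_le_ofReal h

/-- Second moment of the maximal deviation, with the bias of the lag window. -/
theorem IsCausal.exists_lintegral_max_quadDev_le (h : IsCausal μ ε V p ν) (hp4 : 4 < p) (hp6 : p ≤ 6)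
    (hν : ∑' k, ν k < ∞) (hst : ∀ t h, crossCov μ V V (t + h) t = crossCov μ V V h 0)
    {w : ℝ → ℝ} (hw : IsLagWindow w) {β : ℝ} (hβ : 1 ≤ β)
    (hwβ : (fun x => w x - 1) =O[𝓝 0] fun x => |x| ^ β)
    (hC : ∑' k, ‖hsCov e μ V k 0‖ₑ < ∞) (hCβ : ∑' k, absPow β k * ‖hsCov e μ V k 0‖ₑ < ∞) :
    ∃ D : ℝ≥0∞, D ≠ ∞ ∧ ∀ b : ℝ, 0 ≤ b → ∀ ω : ℝ, ∀ T : ℕ, 1 ≤ T →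
      ∫⁻ x, ⨆ n ∈ Finset.range (T + 1), ‖quadDev e μ w V b ω n x‖ₑ ^ 2 ∂μ ≤
        D * ((∑' k : ℤ, ENNReal.ofReal (w (b * k) ^ 2)) * T + (T * ENNReal.ofReal (b ^ β)) ^ 2 + 1) := by
  obtain ⟨C, hC0, hCw⟩ := hw.exists_abs_sub_one_le (by linarith) hwβ
  set A := ∑' k, absPow β k * ‖hsCov e μ V k 0‖ₑ with hA
  set D₁ := ENNReal.ofReal (2 * (1 / (√2 - 2 ^ (1 / (p / 2)))) ^ 2) * (2508800 * (∑' k, ν k) ^ 4)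
    with hD₁
  have hD₁t : D₁ ≠ ∞ := by have := hν.ne; finiteness
  set D₂ := (ENNReal.ofReal C + 1) * A with hD₂
  have hD₂t : D₂ ≠ ∞ := by have := hCβ.ne; finiteness
  -- Splitting into random part and bias costs a factor 2 in each square; the bias (T c + 1) D₂
  -- costs a further factor 3 when squared. The final 1 in the bound comes from the boundary terms ∑
  -- |k| ‖Cov(V_k, V_0)‖.
  refine ⟨2 * D₁ + 6 * D₂ ^ 2, by finiteness, fun b hb ω T hT => ?_⟩
  set W := ∑' k : ℤ, ENNReal.ofReal (w (b * k) ^ 2)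
  set c := ENNReal.ofReal (b ^ β)
  have hbias : ∀ n ∈ Finset.range (T + 1),
      ‖∫ y, quadSum e w V b ω n y ∂μ - (n : ℂ) • hsSpectral e μ V ω‖ₑ ≤ (T * c + 1) * D₂ := by
    intro n hn
    refine (h.enorm_integral_quadSum_sub_le e (by linarith) hst hw.even hC b ω n).trans ?_
    have h1 : ∑' k : ℤ, ‖w (b * k) - 1‖ₑ * ‖hsCov e μ V k 0‖ₑ ≤ ENNReal.ofReal C * c * A := by
      rw [hA, ← ENNReal.tsum_mul_left]
      refine ENNReal.tsum_le_tsum fun k => ?_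
      rw [← mul_assoc]
      gcongr
      rw [absPow, ← ENNReal.ofReal_mul hC0, ← ENNReal.ofReal_mul (by positivity),
        Real.enorm_eq_ofReal_abs]
      refine ENNReal.ofReal_le_ofReal ((hCw _).trans (le_of_eq ?_))
      rw [abs_mul, Real.mul_rpow (abs_nonneg _) (abs_nonneg _), abs_of_nonneg hb, mul_assoc]
    have h2 : ∑' k : ℤ, absPow 1 k * ‖hsCov e μ V k 0‖ₑ ≤ A :=
      ENNReal.tsum_le_tsum fun k => by gcongr; exact absPow_mono one_pos hβ k
    have hnT : (n : ℝ≥0∞) ≤ T := by exact_mod_cast Nat.lt_succ_iff.1 (Finset.mem_range.1 hn)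
    calc _ ≤ T * (ENNReal.ofReal C * c * A) + A := by gcongr
      _ ≤ T * (ENNReal.ofReal C * c * A) + A + (ENNReal.ofReal C * A + T * c * A) := le_self_add
      _ = (T * c + 1) * D₂ := by rw [hD₂]; ring
  have hpt : ∀ x, ⨆ n ∈ Finset.range (T + 1), ‖quadDev e μ w V b ω n x‖ₑ ^ 2 ≤
      2 * (⨆ n ∈ Finset.range (T + 1),
        ‖quadSum e w V b ω n x - ∫ y, quadSum e w V b ω n y ∂μ‖ₑ ^ 2) +
        2 * ((T * c + 1) * D₂) ^ 2 := by
    intro x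
    refine iSup₂_le fun n hn => ?_
    have hsplit : quadDev e μ w V b ω n x = (quadSum e w V b ω n x - ∫ y, quadSum e w V b ω n y ∂μ) +
        (∫ y, quadSum e w V b ω n y ∂μ - (n : ℂ) • hsSpectral e μ V ω) :=
      (sub_add_sub_cancel _ _ _).symm
    rw [hsplit]
    refine (enorm_add_sq_le _ _).trans ?_
    gcongr
    · exact le_iSup₂ (f := fun n (_ : n ∈ Finset.range (T + 1)) =>
        ‖quadSum e w V b ω n x - ∫ y, quadSum e w V b ω n y ∂μ‖ₑ ^ 2) n hn
    · exact hbias n hn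
  refine (lintegral_mono hpt).trans ?_
  rw [lintegral_add_right _ measurable_const, lintegral_const_mul' _ _ (by simp), lintegral_const,
    measure_univ, mul_one]
  have h2 := h.lintegral_max_quadSum_le e hp4 hp6 w b ω hT
  have h3 : ((T * c + 1) * D₂) ^ 2 ≤ 3 * D₂ ^ 2 * ((T * c) ^ 2 + 1) := by
    have hle : (T : ℝ≥0∞) * c ≤ (T * c) ^ 2 + 1 := by
      rcases le_total ((T : ℝ≥0∞) * c) 1 with h1 | h1
      · exact h1.trans le_add_self
      · rw [sq]
        exact (le_mul_of_one_le_left zero_le h1).trans le_self_add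
    calc ((T * c + 1) * D₂) ^ 2 = ((T * c) ^ 2 + 1 + 2 * (T * c)) * D₂ ^ 2 := by ring
      _ ≤ ((T * c) ^ 2 + 1 + 2 * ((T * c) ^ 2 + 1)) * D₂ ^ 2 := by gcongr
      _ = _ := by ring
  calc _ ≤ 2 * (D₁ * (W * T)) + 2 * (3 * D₂ ^ 2 * ((T * c) ^ 2 + 1)) := by
        gcongr
        refine h2.trans (le_of_eq ?_)
        rw [hD₁]; ring
    _ = 2 * D₁ * (W * T) + 6 * D₂ ^ 2 * ((T * c) ^ 2 + 1) := by ring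
    _ ≤ (2 * D₁ * (W * T) + 6 * D₂ ^ 2 * ((T * c) ^ 2 + 1)) +
        (2 * D₁ * ((T * c) ^ 2 + 1) + 6 * D₂ ^ 2 * (W * T)) := le_self_add
    _ = _ := by ring

/-- The maximal squared deviation, integrated over the frequencies in `(a, c]`. -/
noncomputable def bandDev (μ : Measure Ω) (w : ℝ → ℝ) (V : ℤ → Ω → H) (a c b : ℝ) (T : ℕ) (x : Ω) :
    ℝ≥0∞ :=
  ∫⁻ ω in Set.Ioc a c, 1 + ⨆ n ∈ Finset.range (T + 1), ‖quadDev e μ w V b ω n x‖ₑ ^ 2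

variable [TopologicalSpace.SeparableSpace H] [MeasurableSpace H] [BorelSpace H]

lemma measurable_one_add_iSup_quadDev (hm : ∀ t, Measurable (V t))
    (hC : ∑' k, ‖hsCov e μ V k 0‖ₑ < ∞) (w : ℝ → ℝ) (b : ℝ) (T : ℕ) :
    Measurable fun z : Ω × ℝ =>
      1 + ⨆ n ∈ Finset.range (T + 1), ‖quadDev e μ w V b z.2 n z.1‖ₑ ^ 2 :=
  measurable_const.add (Measurable.biSup _ (Finset.countable_toSet _) fun n _ =>
    (stronglyMeasurable_quadDev e hm hC w b n).enorm.pow_const 2)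

lemma measurable_bandDev (hm : ∀ t, Measurable (V t)) (hC : ∑' k, ‖hsCov e μ V k 0‖ₑ < ∞)
    (w : ℝ → ℝ) (a c b : ℝ) (T : ℕ) : Measurable (bandDev e μ w V a c b T) :=
  (measurable_one_add_iSup_quadDev e hm hC w b T).lintegral_prod_right'

lemma lintegral_bandDev_le (hm : ∀ t, Measurable (V t)) (hC : ∑' k, ‖hsCov e μ V k 0‖ₑ < ∞)
    (w : ℝ → ℝ) (a c b : ℝ) (T : ℕ) {B : ℝ≥0∞}
    (hB : ∀ ω, ∫⁻ x, ⨆ n ∈ Finset.range (T + 1), ‖quadDev e μ w V b ω n x‖ₑ ^ 2 ∂μ ≤ B) :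
    ∫⁻ x, bandDev e μ w V a c b T x ∂μ ≤ (1 + B) * ENNReal.ofReal (c - a) := by
  unfold bandDev
  rw [lintegral_lintegral_swap (measurable_one_add_iSup_quadDev e hm hC w b T).aemeasurable]
  calc _ ≤ ∫⁻ _ in Set.Ioc a c, 1 + B := by
        refine lintegral_mono fun ω => ?_
        rw [lintegral_add_left measurable_const, lintegral_const, measure_univ, mul_one]
        gcongr
        exact hB ω
    _ = _ := by rw [setLIntegral_const, Real.volume_Ioc]

/-- Summability of the covariances and the rate of the maximal deviation for one series. -/
theorem HasPhysicalDependence.covariance_and_rate {ε' : Ω → S} {g : (ℕ → S) → H}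
    (h : HasPhysicalDependence μ ε ε' g V p) (hp : 4 < p) (hm : ∀ t, Measurable (V t))
    (hL : ∀ t, MemLp (V t) (ENNReal.ofReal p) μ) (hmean : ∀ t, ∫ x, V t x ∂μ = 0)
    (hst : ∀ t h, crossCov μ V V (t + h) t = crossCov μ V V h 0) {w : ℝ → ℝ} (hw : IsLagWindow w)
    {b : ℕ → ℝ} {ℓ : ℝ} (hb : IsBandwidth w (nu μ ε ε' V 2) b ℓ) (a c : ℝ) :
    (∀ k, hsOperator e (hsCov e μ V k 0) = crossCov μ V V k 0) ∧
    ∑' k, ‖hsCov e μ V k 0‖ₑ < ∞ ∧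
    Tendsto (fun T : ℕ => ENNReal.ofReal (√(b T * T) / T ^ 2) *
      ∫⁻ x, bandDev e μ w V a c (b T) T x ∂μ) atTop (𝓝 0) := by
  have hLq : ∀ q ≤ p, ∀ t, MemLp (V t) (ENNReal.ofReal q) μ := fun q hq t =>
    (hL t).mono_exponent (ENNReal.ofReal_le_ofReal hq)
  have hI : ∀ t, Integrable (V t) μ := fun t => by
    have := hLq 1 (by linarith) t
    rwa [ENNReal.ofReal_one, memLp_one_iff_integrable] at this
  have hc2 := h.isCausal (q := 2) (by norm_num) (hLq 2 (by linarith)) hmean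
  -- The moment inequality covers exponents up to 6, so p is lowered to min p 6, which still exceeds
  -- 4.
  have hc6 := h.isCausal (q := min p 6) (by rw [le_min_iff]; constructor <;> linarith)
    (hLq _ (min_le_left _ _)) hmean
  have hν : ∑' k, nu μ ε ε' V (min p 6) k < ∞ := by
    have := h.tsum_nu hI (min p 6) 1
    simp only [Pi.one_apply, one_mul] at this
    rw [this]
    exact lt_of_le_of_lt (ENNReal.tsum_le_tsum fun j : ℕ => h.nu_mono hI (min_le_left p 6) j)
      h.summable_nu
  have hν0 : nu μ ε ε' V 2 0 < ∞ :=
    (h.nu_mono hI (by linarith : (2 : ℝ) ≤ p) 0).trans_lt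
      ((ENNReal.le_tsum (f := fun j : ℕ => nu μ ε ε' V p j) 0).trans_lt h.summable_nu)
  have hℓ := hb.one_le
  have hcℓ := hc2.tsum_absPow_hsCov_lt_top e (by linarith) hν0 hb.summable_nu
  -- The weighted sum says nothing about lag zero, where the weight vanishes.
  have h0 : ‖hsCov e μ V 0 0‖ₑ < ∞ := enorm_lt_top
  have hC := tsum_lt_top_of_absPow (ν := fun k => ‖hsCov e μ V k 0‖ₑ) (by linarith) h0 hcℓ
  -- The window error has order β ≤ ℓ, so summability with weight |k|^ℓ is enough for the bias.
  have hβℓ : max 1 (ℓ / 2) ≤ ℓ := max_le hℓ (by linarith)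
  have hβ1 : 1 ≤ max 1 (ℓ / 2) := le_max_left _ _
  have hCβ : ∑' k, absPow (max 1 (ℓ / 2)) k * ‖hsCov e μ V k 0‖ₑ < ∞ :=
    (ENNReal.tsum_le_tsum fun k => mul_le_mul' (absPow_mono (by linarith) hβℓ k) le_rfl).trans_lt hcℓ
  refine ⟨fun k => hc2.hsOperator_hsCov e le_rfl k 0, hC, ?_⟩
  obtain ⟨D, hD, hbound⟩ := hc6.exists_lintegral_max_quadDev_le e
    (lt_min hp (by norm_num)) (min_le_right _ _) hν hst hw hβ1 hb.window_order hC hCβ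
  have hrate := hb.tendsto_rate hw
  have hlim := ENNReal.Tendsto.const_mul hrate
    (Or.inr (by finiteness : (1 + D) * ENNReal.ofReal (c - a) ≠ ∞))
  rw [mul_zero] at hlim
  refine tendsto_of_tendsto_of_tendsto_of_le_of_le' tendsto_const_nhds hlim
    (Eventually.of_forall fun _ => zero_le) ?_
  filter_upwards [hb.tendsto_mul.eventually_ge_atTop 0, eventually_ge_atTop 1] with T hT hT1
  have hb0 : 0 ≤ b T := by
    by_contra! hneg
    have : (0 : ℝ) < T := by exact_mod_cast hT1
    nlinarith
  set U := (∑' k : ℤ, ENNReal.ofReal (w (b T * k) ^ 2)) * T +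
    (T * ENNReal.ofReal (b T ^ max 1 (ℓ / 2))) ^ 2 + 1
  -- This absorbs the constant 1 inside `bandDev`, so that the whole bound is a multiple of U.
  have hU : 1 ≤ U := le_add_self
  calc _ ≤ ENNReal.ofReal (√(b T * T) / T ^ 2) * ((1 + D * U) * ENNReal.ofReal (c - a)) := by
        gcongr
        exact lintegral_bandDev_le e hm hC w a c (b T) T fun ω => hbound (b T) hb0 ω T hT1
    _ ≤ ENNReal.ofReal (√(b T * T) / T ^ 2) * ((U + D * U) * ENNReal.ofReal (c - a)) := by
        gcongr
    _ = _ := by ring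

end Moments

/-! ### Continuity in the frequency, which yields integrability on [a, c]. -/

section Continuity

variable {E : Type*} [NormedAddCommGroup E] [InnerProductSpace ℂ E]

lemma continuous_norm_sq_smul_sub {f g u v : ℝ → E} (hf : Continuous f) (hg : Continuous g)
    (hu : Continuous u) (hv : Continuous v) (r s t : ℂ) (k : ℝ) :
    Continuous fun ω => ‖r • (s • f ω - t • g ω)‖ ^ 2 - k * ‖u ω - v ω‖ ^ 2 := by
  fun_prop

lemma continuous_re_inner_smul {f u v : ℝ → E} (hf : Continuous f) (hu : Continuous u)
    (hv : Continuous v) (r s : ℂ) (k : ℝ) :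
    Continuous fun ω => k * (inner ℂ (r • (u ω - v ω)) (s • f ω) : ℂ).re := by
  fun_prop

end Continuity

/-! ### Domination of the remainder. -/

section Remainder

variable {Ω : Type*} {m0 : MeasurableSpace Ω} {μ : Measure Ω} [IsProbabilityMeasure μ]
variable {H : Type*} [NormedAddCommGroup H] [InnerProductSpace ℂ H] [CompleteSpace H]
variable {ι : Type*} (e : HilbertBasis ι ℂ H) {w : ℝ → ℝ} {X Y V : ℤ → Ω → H}

lemma hsOperator_quadSum (w : ℝ → ℝ) (V : ℤ → Ω → H) (b ω : ℝ) (n : ℕ) (x : Ω) :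
    hsOperator e (quadSum e w V b ω n x) = ∑ s ∈ Finset.Icc 1 n, ∑ t ∈ Finset.Icc 1 n,
      lagWeight w b ω s t • tensor (V s x) (V t x) := by
  simp only [quadSum, map_sum, map_smul, hsOperator_hsTensor]

lemma seqEstimator_eq (w : ℝ → ℝ) (V : ℤ → Ω → H) (b : ℝ) (T : ℕ) (η ω : ℝ) (x : Ω) :
    seqEstimator w V b T η ω x =
      hsOperator e ((⌊η * T⌋₊ : ℂ)⁻¹ • quadSum e w V b ω ⌊η * T⌋₊ x) := by
  rw [seqEstimator, map_smul, hsOperator_quadSum]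

lemma continuous_quadDev (hC : ∑' k, ‖hsCov e μ V k 0‖ₑ < ∞) (w : ℝ → ℝ) (b : ℝ) (n : ℕ) (x : Ω) :
    Continuous fun ω => quadDev e μ w V b ω n x :=
  (continuous_quadSum e w V b n x).sub ((continuous_hsSpectral e hC).const_smul (n : ℂ))

lemma partialSum_eq (hC : ∑' k, ‖hsCov e μ V k 0‖ₑ < ∞)
    (hcov : ∀ k, hsOperator e (hsCov e μ V k 0) = crossCov μ V V k 0) (w : ℝ → ℝ) (b : ℝ) (T : ℕ)
    (η ω : ℝ) (x : Ω) :
    partialSum μ w V b T η ω x =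
      hsOperator e (((√b / √T : ℝ) : ℂ) • quadDev e μ w V b ω ⌊η * T⌋₊ x) := by
  rw [partialSum, map_smul, quadDev, map_sub, map_smul, hsOperator_quadSum,
    hsOperator_hsSpectral e hC hcov, Finset.sum_sub_distrib, Finset.sum_const, Nat.card_Icc,
    Nat.add_sub_cancel, Nat.cast_smul_eq_nsmul]

variable (hCX : ∑' k, ‖hsCov e μ X k 0‖ₑ < ∞) (hCY : ∑' k, ‖hsCov e μ Y k 0‖ₑ < ∞)
  (hcX : ∀ k, hsOperator e (hsCov e μ X k 0) = crossCov μ X X k 0)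
  (hcY : ∀ k, hsOperator e (hsCov e μ Y k 0) = crossCov μ Y Y k 0)
include hCX hCY hcX hcY

lemma popDiff_eq (ω : ℝ) :
    popDiff μ X Y ω = hsOperator e (hsSpectral e μ X ω - hsSpectral e μ Y ω) := by
  rw [popDiff, map_sub, hsOperator_hsSpectral e hCX hcX, hsOperator_hsSpectral e hCY hcY]

lemma distIntegrand_eq (w : ℝ → ℝ) (b₁ b₂ : ℝ) (T₁ T₂ : ℕ) (η : ℝ) (x : Ω) (ω : ℝ) :
    distIntegrand μ e w X Y b₁ b₂ T₁ T₂ η x ω =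
      ‖(η : ℂ) • ((⌊η * T₁⌋₊ : ℂ)⁻¹ • quadSum e w X b₁ ω ⌊η * T₁⌋₊ x -
        (⌊η * T₂⌋₊ : ℂ)⁻¹ • quadSum e w Y b₂ ω ⌊η * T₂⌋₊ x)‖ ^ 2 -
      η ^ 2 * ‖hsSpectral e μ X ω - hsSpectral e μ Y ω‖ ^ 2 := by
  rw [distIntegrand, popDiff_eq e hCX hCY hcX hcY, empDiff, seqEstimator_eq e, seqEstimator_eq e,
    ← map_sub, ← map_smul, hsNorm_hsOperator, hsNorm_hsOperator]

lemma linIntegrand_eq (hC : ∑' k, ‖hsCov e μ V k 0‖ₑ < ∞)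
    (hcov : ∀ k, hsOperator e (hsCov e μ V k 0) = crossCov μ V V k 0) (w : ℝ → ℝ) (b : ℝ) (T : ℕ)
    (η : ℝ) (x : Ω) (ω : ℝ) :
    linIntegrand μ e w X Y V b T η x ω = 2 / √(b * T) *
      (inner ℂ ((η : ℂ) • (hsSpectral e μ X ω - hsSpectral e μ Y ω))
        (((√b / √T : ℝ) : ℂ) • quadDev e μ w V b ω ⌊η * T⌋₊ x) : ℂ).re := by
  rw [linIntegrand, popDiff_eq e hCX hCY hcX hcY, partialSum_eq e hC hcov, ← map_smul,
    hsInner_hsOperator]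

/-- The prefactors combine as (2/√(bT)) · (√b/√T) = 2/T, which gives the normalization by 1/T in
`sequential_error_le`. -/
lemma linIntegrand_eq_of_pos (hC : ∑' k, ‖hsCov e μ V k 0‖ₑ < ∞)
    (hcov : ∀ k, hsOperator e (hsCov e μ V k 0) = crossCov μ V V k 0) (w : ℝ → ℝ) {b : ℝ} {T : ℕ}
    (hb : 0 < b) (hT : 1 ≤ T) (η : ℝ) (x : Ω) (ω : ℝ) :
    linIntegrand μ e w X Y V b T η x ω = 2 *
      (inner ℂ ((η : ℂ) • (hsSpectral e μ X ω - hsSpectral e μ Y ω))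
        (((T : ℝ)⁻¹ : ℂ) • quadDev e μ w V b ω ⌊η * T⌋₊ x) : ℂ).re := by
  have hT0 : (0 : ℝ) < T := by exact_mod_cast hT
  have h1 := Real.sqrt_pos.2 hb
  have h2 := Real.sqrt_pos.2 hT0
  rw [linIntegrand_eq e hCX hCY hcX hcY hC hcov, inner_smul_right, inner_smul_right,
    ← Complex.ofReal_inv, Complex.re_ofReal_mul, Complex.re_ofReal_mul, Real.sqrt_mul hb.le,
    ← mul_assoc, ← mul_assoc]
  congr 1
  nth_rewrite 3 [← Real.mul_self_sqrt hT0.le]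
  field_simp

lemma continuous_distIntegrand (w : ℝ → ℝ) (b₁ b₂ : ℝ) (T₁ T₂ : ℕ) (η : ℝ) (x : Ω) :
    Continuous (distIntegrand μ e w X Y b₁ b₂ T₁ T₂ η x) := by
  refine (continuous_norm_sq_smul_sub (continuous_quadSum e w X b₁ ⌊η * T₁⌋₊ x)
    (continuous_quadSum e w Y b₂ ⌊η * T₂⌋₊ x) (continuous_hsSpectral e hCX)
    (continuous_hsSpectral e hCY) η (⌊η * T₁⌋₊ : ℂ)⁻¹ (⌊η * T₂⌋₊ : ℂ)⁻¹ (η ^ 2)).congr fun ω => ?_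
  exact (distIntegrand_eq e hCX hCY hcX hcY w b₁ b₂ T₁ T₂ η x ω).symm

lemma continuous_linIntegrand (hC : ∑' k, ‖hsCov e μ V k 0‖ₑ < ∞)
    (hcov : ∀ k, hsOperator e (hsCov e μ V k 0) = crossCov μ V V k 0) (w : ℝ → ℝ) (b : ℝ) (T : ℕ)
    (η : ℝ) (x : Ω) : Continuous (linIntegrand μ e w X Y V b T η x) := by
  refine (continuous_re_inner_smul (continuous_quadDev e hC w b ⌊η * T⌋₊ x)
    (continuous_hsSpectral e hCX) (continuous_hsSpectral e hCY) η ((√b / √T : ℝ) : ℂ)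
    (2 / √(b * T))).congr fun ω => ?_
  exact (linIntegrand_eq e hCX hCY hcX hcY hC hcov w b T η x ω).symm

/-- The remainder is dominated, uniformly in `η`, by the maximal deviations. -/
theorem enorm_remainder_le {L : ℝ} (hLX : ∀ ω, ‖hsSpectral e μ X ω‖ ≤ L)
    (hLY : ∀ ω, ‖hsSpectral e μ Y ω‖ ≤ L) (w : ℝ → ℝ) {a c b₁ b₂ : ℝ} {T₁ T₂ : ℕ} (hac : a ≤ c)
    (hb₁ : 0 < b₁) (hb₂ : 0 < b₂) (hT₁ : 1 ≤ T₁) (hT₂ : 1 ≤ T₂) {η : ℝ}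
    (hη : η ∈ Set.Icc (0 : ℝ) 1) (x : Ω) :
    ‖remainder μ e w a c X Y b₁ b₂ T₁ T₂ η x‖ₑ ≤ ENNReal.ofReal √(b₁ * T₁ + b₂ * T₂) *
      (ENNReal.ofReal ((20 + 12 * L ^ 2) / T₁ ^ 2) * bandDev e μ w X a c b₁ T₁ x +
        ENNReal.ofReal ((20 + 12 * L ^ 2) / T₂ ^ 2) * bandDev e μ w Y a c b₂ T₂ x) := by
  have hd := continuous_distIntegrand e hCX hCY hcX hcY w b₁ b₂ T₁ T₂ η x
  have hl₁ := continuous_linIntegrand e hCX hCY hcX hcY hCX hcX w b₁ T₁ η x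
  have hl₂ := continuous_linIntegrand e hCX hCY hcX hcY hCY hcY w b₂ T₂ η x
  have e1 : remainder μ e w a c X Y b₁ b₂ T₁ T₂ η x = √(b₁ * T₁ + b₂ * T₂) *
      ∫ ω in Set.Ioc a c, (distIntegrand μ e w X Y b₁ b₂ T₁ T₂ η x ω -
        (linIntegrand μ e w X Y X b₁ T₁ η x ω - linIntegrand μ e w X Y Y b₂ T₂ η x ω)) := by
    have h1 := intervalIntegral.integral_sub (hd.intervalIntegrable (μ := volume) a c)
      ((hl₁.sub hl₂).intervalIntegrable a c)
    have h2 := intervalIntegral.integral_sub (hl₁.intervalIntegrable (μ := volume) a c)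
      (hl₂.intervalIntegrable a c)
    simp only [Pi.sub_apply] at h1
    rw [← intervalIntegral.integral_of_le hac, h1, h2, remainder, centeredDist]
    ring
  have hsup : ∀ (V : ℤ → Ω → H) (b ω : ℝ) (T : ℕ),
      ENNReal.ofReal ((20 + 12 * L ^ 2) / T ^ 2 * (1 + ‖quadDev e μ w V b ω ⌊η * T⌋₊ x‖ ^ 2)) ≤
      ENNReal.ofReal ((20 + 12 * L ^ 2) / T ^ 2) *
        (1 + ⨆ n ∈ Finset.range (T + 1), ‖quadDev e μ w V b ω n x‖ₑ ^ 2) := by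
    intro V b ω T
    -- Apart from scalar factors, η enters only through ⌊ηT⌋ ≤ T, so uniformity over [0, 1] reduces
    -- to a finite maximum.
    have hN : ⌊η * T⌋₊ ∈ Finset.range (T + 1) := by
      rw [Finset.mem_range, Nat.lt_succ_iff]
      exact Nat.floor_le_of_le (mul_le_of_le_one_left (Nat.cast_nonneg T) hη.2)
    rw [ENNReal.ofReal_mul (by positivity), ENNReal.ofReal_add zero_le_one (by positivity),
      ENNReal.ofReal_one, ENNReal.ofReal_pow (norm_nonneg _), ofReal_norm]
    gcongr
    exact le_iSup₂ (f := fun n (_ : n ∈ Finset.range (T + 1)) => ‖quadDev e μ w V b ω n x‖ₑ ^ 2) _ hN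
  have hpt : ∀ ω, ‖distIntegrand μ e w X Y b₁ b₂ T₁ T₂ η x ω -
      (linIntegrand μ e w X Y X b₁ T₁ η x ω - linIntegrand μ e w X Y Y b₂ T₂ η x ω)‖ₑ ≤
      ENNReal.ofReal ((20 + 12 * L ^ 2) / T₁ ^ 2) *
        (1 + ⨆ n ∈ Finset.range (T₁ + 1), ‖quadDev e μ w X b₁ ω n x‖ₑ ^ 2) +
      ENNReal.ofReal ((20 + 12 * L ^ 2) / T₂ ^ 2) *
        (1 + ⨆ n ∈ Finset.range (T₂ + 1), ‖quadDev e μ w Y b₂ ω n x‖ₑ ^ 2) := by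
    intro ω
    refine le_trans ?_ (add_le_add (hsup X b₁ ω T₁) (hsup Y b₂ ω T₂))
    rw [← ENNReal.ofReal_add (by positivity) (by positivity), Real.enorm_eq_ofReal_abs,
      distIntegrand_eq e hCX hCY hcX hcY,
      linIntegrand_eq_of_pos e hCX hCY hcX hcY hCX hcX w hb₁ hT₁,
      linIntegrand_eq_of_pos e hCX hCY hcX hcY hCY hcY w hb₂ hT₂]
    refine ENNReal.ofReal_le_ofReal ?_
    have h0 : ∀ (V : ℤ → Ω → H) (b : ℝ) (T : ℕ), ⌊η * T⌋₊ = 0 →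
        quadSum e w V b ω ⌊η * T⌋₊ x = 0 := fun V b T hN => by simp [hN, quadSum]
    set F₁ := hsSpectral e μ X ω
    set F₂ := hsSpectral e μ Y ω
    have hX := sequential_error_le hη hT₁ (hLX ω) (h0 X b₁ T₁)
    have hY := sequential_error_le hη hT₂ (hLY ω) (h0 Y b₂ T₂)
    refine le_trans ?_ (add_le_add hX hY)
    have e2 : ∀ S₁ S₂ : lp (fun _ : ι => H) 2, (η : ℂ) • (S₁ - S₂) =
        (η : ℂ) • (F₁ - F₂) + ((η : ℂ) • (S₁ - F₁) - (η : ℂ) • (S₂ - F₂)) := fun S₁ S₂ => by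
      simp only [smul_sub]; abel
    rw [e2]
    exact norm_sq_sub_linear_le hη.1 (hLX ω) (hLY ω)
  rw [e1, enorm_mul, Real.enorm_of_nonneg (Real.sqrt_nonneg _)]
  gcongr
  refine (enorm_integral_le_lintegral_enorm _).trans ((lintegral_mono hpt).trans ?_)
  have hmeas : Measurable fun ω => 1 + ⨆ n ∈ Finset.range (T₁ + 1),
      ‖quadDev e μ w X b₁ ω n x‖ₑ ^ 2 :=
    measurable_const.add (Measurable.biSup _ (Finset.countable_toSet _) fun n _ =>
      (continuous_quadDev e hCX w b₁ n x).enorm.measurable.pow_const 2)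
  rw [lintegral_add_left (hmeas.const_mul _), lintegral_const_mul' _ _ ENNReal.ofReal_ne_top,
    lintegral_const_mul' _ _ ENNReal.ofReal_ne_top]
  rfl

end Remainder

end SpectralTest

/-! ### The asymptotic expansion. -/

open SpectralTest in
theorem theorem3p2
    {Ω : Type*} [MeasurableSpace Ω] (μ : Measure Ω) [IsProbabilityMeasure μ]
    {H : Type*} [NormedAddCommGroup H] [InnerProductSpace ℂ H] [CompleteSpace H]
    [TopologicalSpace.SeparableSpace H] [MeasurableSpace H] [BorelSpace H]
    {ι : Type*} (e : HilbertBasis ι ℂ H)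
    {S₁ S₂ : Type*} [MeasurableSpace S₁] [MeasurableSpace S₂]
    (X Y : ℤ → Ω → H)
    (p : ℝ) (hp : 4 < p)
    (hXY : IsCenteredWeaklyStationaryPair μ X Y p)
    (ε₁ : ℤ → Ω → S₁) (ε₁' : Ω → S₁) (g₁ : (ℕ → S₁) → H)
    (hX : HasPhysicalDependence μ ε₁ ε₁' g₁ X p)
    (ε₂ : ℤ → Ω → S₂) (ε₂' : Ω → S₂) (g₂ : (ℕ → S₂) → H)
    (hY : HasPhysicalDependence μ ε₂ ε₂' g₂ Y p)
    (w : ℝ → ℝ) (hw : IsLagWindow w)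
    (b₁ b₂ : ℕ → ℝ) (ℓ₁ ℓ₂ : ℝ)
    (hb₁ : IsBandwidth w (nu μ ε₁ ε₁' X 2) b₁ ℓ₁)
    (hb₂ : IsBandwidth w (nu μ ε₂ ε₂' Y 2) b₂ ℓ₂)
    (T₁ T₂ : ℕ → ℕ) (hT₁ : Tendsto T₁ atTop atTop) (hT₂ : Tendsto T₂ atTop atTop)
    (hbal :
      (IndepFun (fun x t => X t x) (fun x t => Y t x) μ ∧
        ∃ θ ∈ Set.Ioo (0 : ℝ) 1,
          Tendsto (fun n => b₁ (T₁ n) * T₁ n / (b₁ (T₁ n) * T₁ n + b₂ (T₂ n) * T₂ n))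
            atTop (𝓝 θ)) ∨
      (T₁ = T₂ ∧ b₁ ~[atTop] b₂))
    (a c : ℝ) (ha : 0 ≤ a) (hac : a ≤ c) (hc : c ≤ Real.pi) :
    ((∀ ω : ℝ, Summable (spectralTerm μ X ω) ∧ Summable (spectralTerm μ Y ω) ∧
        IsHilbertSchmidt e (spectralDensity μ X ω) ∧
        IsHilbertSchmidt e (spectralDensity μ Y ω)) ∧
      ∀ n, ∀ η ∈ Set.Icc (0 : ℝ) 1, ∀ x,
        IntervalIntegrable (distIntegrand μ e w X Y (b₁ (T₁ n)) (b₂ (T₂ n)) (T₁ n) (T₂ n) η x)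
          volume a c ∧
        IntervalIntegrable (linIntegrand μ e w X Y X (b₁ (T₁ n)) (T₁ n) η x) volume a c ∧
        IntervalIntegrable (linIntegrand μ e w X Y Y (b₂ (T₂ n)) (T₂ n) η x) volume a c) ∧
    UniformlyLittleOP μ
      (fun n => remainder μ e w a c X Y (b₁ (T₁ n)) (b₂ (T₂ n)) (T₁ n) (T₂ n)) := by
  obtain ⟨hcX, hCX, hrX⟩ := hX.covariance_and_rate e hp hXY.measurable_fst hXY.memLp_fst
    hXY.mean_fst hXY.cov_XX hw hb₁ a c
  obtain ⟨hcY, hCY, hrY⟩ := hY.covariance_and_rate e hp hXY.measurable_snd hXY.memLp_snd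
    hXY.mean_snd hXY.cov_YY hw hb₂ a c
  refine ⟨⟨fun ω => ⟨summable_spectralTerm e hCX hcX ω, summable_spectralTerm e hCY hcY ω, ?_, ?_⟩,
    fun n η _ x => ⟨?_, ?_, ?_⟩⟩, ?_⟩
  · rw [← hsOperator_hsSpectral e hCX hcX]
    exact isHilbertSchmidt_hsOperator e _
  · rw [← hsOperator_hsSpectral e hCY hcY]
    exact isHilbertSchmidt_hsOperator e _
  · exact (continuous_distIntegrand e hCX hCY hcX hcY w _ _ _ _ η x).intervalIntegrable a c
  · exact (continuous_linIntegrand e hCX hCY hcX hcY hCX hcX w _ _ η x).intervalIntegrable a c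
  · exact (continuous_linIntegrand e hCX hCY hcX hcY hCY hcY w _ _ η x).intervalIntegrable a c
  have hpos₁ := (hb₁.tendsto_mul.comp hT₁).eventually_gt_atTop 0
  have hpos₂ := (hb₂.tendsto_mul.comp hT₂).eventually_gt_atTop 0
  simp only [Function.comp_apply] at hpos₁ hpos₂
  obtain ⟨K, hK, hbound⟩ := exists_balance_le hT₁ hpos₁ hpos₂
    (hbal.imp (fun h => h.2) id)
  set L := max (∑' k, ‖hsCov e μ X k 0‖) (∑' k, ‖hsCov e μ Y k 0‖)
  have hLX : ∀ ω, ‖hsSpectral e μ X ω‖ ≤ L := fun ω =>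
    (norm_hsSpectral_le e hCX ω).trans (le_max_left _ _)
  have hLY : ∀ ω, ‖hsSpectral e μ Y ω‖ ≤ L := fun ω =>
    (norm_hsSpectral_le e hCY ω).trans (le_max_right _ _)
  set A := ENNReal.ofReal (√K * (20 + 12 * L ^ 2)) with hA
  -- Trades the common factor √(b₁T₁ + b₂T₂) for √(bT) of a single series, so that the rate of each
  -- series applies separately.
  have hscale : ∀ {B u : ℝ} (T : ℕ), B ≤ K * u →
      ENNReal.ofReal √B * ENNReal.ofReal ((20 + 12 * L ^ 2) / T ^ 2) ≤
        A * ENNReal.ofReal (√u / T ^ 2) := by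
    intro B u T hB
    rw [hA, ← ENNReal.ofReal_mul (Real.sqrt_nonneg _), ← ENNReal.ofReal_mul (by positivity)]
    refine ENNReal.ofReal_le_ofReal ?_
    calc √B * ((20 + 12 * L ^ 2) / T ^ 2) ≤ (√K * √u) * ((20 + 12 * L ^ 2) / T ^ 2) := by
          rw [← Real.sqrt_mul hK]
          gcongr
      _ = _ := by ring
  have hmX := fun n => measurable_bandDev e hXY.measurable_fst hCX w a c (b₁ (T₁ n)) (T₁ n)
  have hmY := fun n => measurable_bandDev e hXY.measurable_snd hCY w a c (b₂ (T₂ n)) (T₂ n)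
  refine uniformlyLittleOP_of_lintegral (G := fun n x =>
      A * (ENNReal.ofReal (√(b₁ (T₁ n) * T₁ n) / T₁ n ^ 2) *
        bandDev e μ w X a c (b₁ (T₁ n)) (T₁ n) x) +
      A * (ENNReal.ofReal (√(b₂ (T₂ n) * T₂ n) / T₂ n ^ 2) *
        bandDev e μ w Y a c (b₂ (T₂ n)) (T₂ n) x))
    (fun n => ((((hmX n).const_mul _).const_mul _).add (((hmY n).const_mul _).const_mul _)).aemeasurable)
    ?_ ?_
  · filter_upwards [hpos₁, hpos₂, hbound, hT₁.eventually_ge_atTop 1, hT₂.eventually_ge_atTop 1]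
      with n hn₁ hn₂ ⟨hB₁, hB₂⟩ h1 h2 η hη x
    refine (enorm_remainder_le e hCX hCY hcX hcY hLX hLY w hac
      (pos_of_mul_pos_left hn₁ (Nat.cast_nonneg _)) (pos_of_mul_pos_left hn₂ (Nat.cast_nonneg _))
      h1 h2 hη x).trans ?_
    rw [mul_add, ← mul_assoc, ← mul_assoc, ← mul_assoc, ← mul_assoc]
    exact add_le_add (mul_le_mul' (hscale (T₁ n) hB₁) le_rfl)
      (mul_le_mul' (hscale (T₂ n) hB₂) le_rfl)
  · have hlim := (ENNReal.Tendsto.const_mul (hrX.comp hT₁)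
      (Or.inr (ENNReal.ofReal_ne_top : A ≠ ∞))).add
      (ENNReal.Tendsto.const_mul (hrY.comp hT₂) (Or.inr (ENNReal.ofReal_ne_top : A ≠ ∞)))
    rw [mul_zero, add_zero] at hlim
    refine hlim.congr fun n => ?_
    rw [lintegral_add_left (((hmX n).const_mul _).const_mul _),
      lintegral_const_mul _ ((hmX n).const_mul _), lintegral_const_mul _ (hmX n),
      lintegral_const_mul _ ((hmY n).const_mul _), lintegral_const_mul _ (hmY n)]
    rfl
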